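/- Let $k$ be an odd positive integer. For $\mathbf p\in\mathbb R^2$ let $A_{\mathbf p}(x)=\frac12\,\frac{(-(x_2-p_2),\,x_1-p_1)}{|x-\mathbf p|^2}$ be the Aharonov–Bohm potential with pole $\mathbf p$ and circulation $1/2$, and let $H^{1,\mathbf p}(\Omega,\mathbb C)$ be the completion of $\{u\in H^1(\Omega,\mathbb C)\cap C^\infty(\Omega,\mathbb C): u=0 \text{ near } \mathbf p\}$ with respect to the norm $\big(\|\nabla u\|_{L^2(\Omega)}^2+\|u\|_{L^2(\Omega)}^2+\|u/|x-\mathbf p|\|_{L^2(\Omega)}^2\big)^{1/2}$; $H^{1,\mathbf p}_{\rm loc}(\mathbb R^2,\mathbb C)$ consists of the functions that are in $H^{1,\mathbf p}(D_R,\mathbb C)$ for all $R>0$, where $D_R=\{|x|<R\}$. For $b=|b|(\cos\alpha,\sin\alpha)\neq0$ with $\alpha\in[0,2\pi)$, let $\theta_b(x)$ and $\theta_0^b(x)$ be the angles in $[\alpha,\alpha+2\pi)$ of $x-b$ (for $x\ne b$) and of $x$ (for $x\neq 0$), let $\theta_0(x)$ be the angle of $x\neq0$ in $[0,2\pi)$,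 and let $\psi_k(r\cos t,r\sin t)=r^{k/2}\sin(\tfrac k2t)$ for $t\in[0,2\pi)$, $\psi_2^k(t)=\frac{e^{it/2}}{\sqrt\pi}\sin(\tfrac k2 t)$. For every $\mathbf p=(\cos\alpha,\sin\alpha)$, $\alpha\in\mathbb R$, there is a unique (up to null sets) $\Psi_{\mathbf p}\in H^{1,\mathbf p}_{\rm loc}(\mathbb R^2,\mathbb C)$ that satisfies $(i\nabla+A_{\mathbf p})^2\Psi_{\mathbf p}=0$ in $\mathbb R^2$ in the weak $H^{1,\mathbf p}$-sense (tested with $C^\infty_{\rm c}(\mathbb R^2\setminus\{\mathbf p\},\mathbb C)$) and $$\int_{\mathbb R^2\setminus D_r}\big|(i\nabla+A_{\mathbf p})\big(\Psi_{\mathbf p}-e^{\frac i2(\theta_{\mathbf p}-\theta_0^{\mathbf p})}e^{\frac i2\theta_0}\psi_k\big)\big|^2dx<+\infty\quad\text{for all } r>1,$$ and it has a representative that is continuous on $\mathbb R^2\setminus\{\mathbf p\}$. With this representative, the integral $$\xi_{\mathbf p}(1)=\int_0^{2\pi}e^{-\frac i2\theta_{\mathbf p}(\cos t,\sin t)}\,\Psi_{\mathbf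 p}(\cos t,\sin t)\,e^{\frac i2\theta_0^{\mathbf p}(\cos t,\sin t)}\,\overline{\psi_2^k(t)}\,dt$$ converges absolutely, and the function $f(\alpha)=\xi_{(\cos\alpha,\sin\alpha)}(1)-\sqrt\pi$, $\alpha\in\mathbb R$, satisfies $$f(\alpha)=f\big(\alpha-\tfrac{2\pi}k\big)\quad\text{and}\quad f(\alpha)=f(2\pi-\alpha)\qquad\text{for all }\alpha\in\mathbb R.$$ -/

import Mathlib

open MeasureTheory Filter Topology Complex
open scoped ContDiff

namespace AharonovBohm

/-! The plane `ℝ²` is identified with `ℂ`, the point `(x₁, x₂)` being `x₁ + i x₂`; Lebesgue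
measure, Euclidean norm and real differentiability are those of `ℝ²`. -/

/-- The standard basis `(1,0), (0,1)` of the plane. -/
noncomputable def basisVec (j : Fin 2) : ℂ := ![1, I] j

/-- The `j`-th partial derivative of a complex-valued function on the plane. -/
noncomputable def partialDeriv (j : Fin 2) (u : ℂ → ℂ) (x : ℂ) : ℂ :=
  fderiv ℝ u x (basisVec j)

/-- The `j`-th component of the Aharonov-Bohm potential with pole `p` and circulation `1/2`:
`A_p(x) = (1/2) (-(x₂ - p₂), x₁ - p₁) / |x - p|²`. -/
noncomputable def potential (p : ℂ) (j : Fin 2) (x : ℂ) : ℝ :=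
  (1 / 2) * (![-(x.im - p.im), x.re - p.re] j / ((x.re - p.re) ^ 2 + (x.im - p.im) ^ 2))

/-- The `j`-th component of `(i∇ + A_p) u`, where `G` is the gradient of `u`. -/
noncomputable def magGrad (p : ℂ) (u : ℂ → ℂ) (G : Fin 2 → ℂ → ℂ) (j : Fin 2) (x : ℂ) : ℂ :=
  I * G j x + (potential p j x : ℂ) * u x

/-- `u ∈ H^{1,p}(Ω, ℂ)` with gradient `G`. The space `H^{1,p}(Ω, ℂ)` is the completion of the
functions in `H¹(Ω) ∩ C^∞(Ω)` that vanish near `p`, with respect to the norm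
`(‖∇u‖² + ‖u‖² + ‖u/|x-p|‖²)^{1/2}` (all norms in `L²(Ω)`); its elements are realized as the
functions `u` which are limits of sequences of such functions, and `G` is the limit of
their gradients. -/
def MemH1 (p : ℂ) (Ω : Set ℂ) (u : ℂ → ℂ) (G : Fin 2 → ℂ → ℂ) : Prop :=
  MemLp u 2 (volume.restrict Ω) ∧ (∀ j, MemLp (G j) 2 (volume.restrict Ω)) ∧
  ∃ v : ℕ → ℂ → ℂ,
    (∀ n, ContDiffOn ℝ ∞ (v n) Ω ∧ (∀ᶠ x in 𝓝 p, v n x = 0) ∧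
      MemLp (v n) 2 (volume.restrict Ω) ∧
      ∀ j, MemLp (partialDeriv j (v n)) 2 (volume.restrict Ω)) ∧
    Tendsto (fun n => eLpNorm (fun x => v n x - u x) 2 (volume.restrict Ω)) atTop (𝓝 0) ∧
    (∀ j, Tendsto (fun n => eLpNorm (fun x => partialDeriv j (v n) x - G j x) 2
      (volume.restrict Ω)) atTop (𝓝 0)) ∧
    Tendsto (fun n => eLpNorm (fun x => (v n x - u x) / (‖x - p‖ : ℂ)) 2
      (volume.restrict Ω)) atTop (𝓝 0)

/-- `u ∈ H^{1,p}_loc(ℝ², ℂ)` with gradient `G`. -/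
def MemH1Loc (p : ℂ) (u : ℂ → ℂ) (G : Fin 2 → ℂ → ℂ) : Prop :=
  ∀ R : ℝ, 0 < R → MemH1 p (Metric.ball 0 R) u G

/-- `(i∇ + A_p)² u = 0` in `ℝ²` in the weak `H^{1,p}`-sense, for `u` with gradient `G`. The test
functions are those of `C_c^∞(ℝ² \ {p})`, which are dense in the space `H^{1,p}_0` of
every disk by the very definition of that space. -/
def WeaklyHarmonic (p : ℂ) (u : ℂ → ℂ) (G : Fin 2 → ℂ → ℂ) : Prop :=
  ∀ v : ℂ → ℂ, ContDiff ℝ ∞ v → HasCompactSupport v → p ∉ tsupport v →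
    ∫ x, ∑ j, magGrad p u G j x *
      (starRingEnd ℂ) (magGrad p v (fun i => partialDeriv i v) j x) = 0

/-- The angle of `z ≠ 0` in `[a, a + 2π)`: the `t` in that interval with `z = |z| e^{it}`. -/
noncomputable def angle (a : ℝ) (z : ℂ) : ℝ := toIcoMod Real.two_pi_pos a (arg z)

/-- `θ_b : ℝ² \ {b} → [α, α + 2π)`, where `b = |b| e^{iα}` with `α ∈ [0, 2π)`. -/
noncomputable def thetaPole (b x : ℂ) : ℝ := angle (angle 0 b) (x - b)

/-- `θ_0^b : ℝ² \ {0} → [α, α + 2π)`, where `b = |b| e^{iα}` with `α ∈ [0, 2π)`. -/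
noncomputable def thetaOrigin (b x : ℂ) : ℝ := angle (angle 0 b) x

/-- `θ_0 : ℝ² \ {0} → [0, 2π)`. -/
noncomputable def thetaZero (x : ℂ) : ℝ := angle 0 x

/-- `ψ_k(r cos t, r sin t) = r^{k/2} sin(k t / 2)` for `t ∈ [0, 2π)`. -/
noncomputable def psi (k : ℕ) (x : ℂ) : ℝ :=
  ‖x‖ ^ ((k : ℝ) / 2) * Real.sin ((k : ℝ) / 2 * thetaZero x)

/-- `e^{(i/2)(θ_p - θ_0^p)} e^{(i/2) θ_0} ψ_k`. It is smooth off the segment from `0` to `p`. -/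
noncomputable def asymptote (k : ℕ) (p x : ℂ) : ℂ :=
  exp (I / 2 * ((thetaPole p x - thetaOrigin p x : ℝ) : ℂ)) *
    exp (I / 2 * (thetaZero x : ℂ)) * (psi k x : ℂ)

/-- `Ψ` belongs to `H^{1,p}_loc(ℝ², ℂ)`, solves `(i∇ + A_p)² Ψ = 0` weakly in `ℝ²`, and
`(i∇ + A_p)(Ψ - e^{(i/2)(θ_p - θ_0^p)} e^{(i/2) θ_0} ψ_k)` is square integrable outside the
disk `D_r(0)`, for every `r > 1`. -/
def IsLimitProfile (k : ℕ) (p : ℂ) (Ψ : ℂ → ℂ) : Prop :=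
  ∃ G : Fin 2 → ℂ → ℂ, MemH1Loc p Ψ G ∧ WeaklyHarmonic p Ψ G ∧
    ∀ r : ℝ, 1 < r →
      ∫⁻ x in (Metric.ball (0 : ℂ) r)ᶜ,
        ∑ j, ‖magGrad p (fun y => Ψ y - asymptote k p y)
          (fun i y => G i y - partialDeriv i (asymptote k p) y) j x‖ₑ ^ 2 < ⊤

/-- The limit profile `Ψ_p`, as a function continuous off `p`. (A limit profile is unique up to a
null set and smooth off `p`, so its values off `p` are those of its continuous version.) -/
noncomputable def limitProfile (k : ℕ) (p : ℂ) : ℂ → ℂ :=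
  Classical.epsilon fun Ψ : ℂ → ℂ => IsLimitProfile k p Ψ ∧ ContinuousOn Ψ {p}ᶜ

/-- `ψ_2^k(t) = π^{-1/2} e^{it/2} sin(k t / 2)`. -/
noncomputable def psiTwo (k : ℕ) (t : ℝ) : ℂ :=
  exp (I * ((t / 2 : ℝ) : ℂ)) / ((Real.sqrt Real.pi : ℝ) : ℂ) *
    ((Real.sin ((k : ℝ) / 2 * t) : ℝ) : ℂ)

/-- The point `(r cos t, r sin t)`. -/
noncomputable def polarPt (r t : ℝ) : ℂ := ⟨r * Real.cos t, r * Real.sin t⟩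

/-- The integrand in the definition of `ξ_p(r)`. -/
noncomputable def xiIntegrand (k : ℕ) (p : ℂ) (r t : ℝ) : ℂ :=
  exp (-(I / 2) * (thetaPole p (polarPt r t) : ℂ)) * limitProfile k p (polarPt r t) *
    exp (I / 2 * (thetaOrigin p (polarPt r t) : ℂ)) * (starRingEnd ℂ) (psiTwo k t)

/-- The Fourier-type coefficient `ξ_p(r)` of the limit profile. -/
noncomputable def xi (k : ℕ) (p : ℂ) (r : ℝ) : ℂ :=
  ∫ t in (0 : ℝ)..(2 * Real.pi), xiIntegrand k p r t

/-- `f(α) = ξ_{(cos α, sin α)}(1) - √π`. -/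
noncomputable def f (k : ℕ) (α : ℝ) : ℂ :=
  xi k (polarPt 1 α) 1 - ((Real.sqrt Real.pi : ℝ) : ℂ)

end AharonovBohm

/-! Write k = 2n + 1 and regard the plane as ℂ. Removing the phase e^{iθ_p/2} turns i∇ + A_p into
i∇, acting on functions that change sign along a loop around p. With w a branch of (x - p)^{1/2} and
g entire, e^{iθ_p/2} Im(w g) does not depend on the branch and solves the equation
(`weaklyHarmonic_twistedIm`). It is O(|x - p|^{1/2}) at p, hence in H^{1,p}_loc
(`memH1Loc_twistedIm`).

Existence. The asymptote has the same form with w g replaced by x^{k/2}, cut along the ray from 0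
through p (`asymptote_eq_twistedIm`). The energy of the difference therefore depends only on the
difference of the complex derivatives, that is, after multiplication by w, on g/2 + (x - p) g' minus
(n + 1/2) x^n (1 - p/x)^{1/2}. Truncating the binomial series after (p/x)^n leaves a polynomial and
an error O(1/|x|). The equation g/2 + (x - p) g' = polynomial is solved monomial by monomial in x -
p (`exists_profilePoly`). The energy density of the difference is then O(|x|^{-3}), which is
integrable at infinity (`isLimitProfile_twistedIm`).

Uniqueness. The difference of two limit profiles has finite energy on the whole plane. Because the
circulation is 1/2, functions on circles around p become antiperiodic once the phase is removed, so
a Hardy inequality holds without subtraction of means, even on annuli (`MagApprox.hardy`). Testing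
the equation with a cutoff times the difference bounds the energy in a disk of radius ρ by a fixed
multiple of the energy outside it (`MagApprox.exists_energy_le`). As ρ → ∞ the latter tends to 0
(`MagApprox.ae_eq_zero`).

Invariance. The profile is now explicit on the unit circle: at e^{i(α+τ)} the integrand of ξ is
`trace n c τ` / √π, and α enters only through c = kα/2 (`f_eq`). Both oscillating factors of `trace`
change sign under c ↦ c + π. As the polynomial has real coefficients, complex conjugation gives
symmetry under (c, τ) ↦ (-c, 2π - τ). The map α ↦ α - 2π/k shifts c by -π, and α ↦ 2π - α sends c to
kπ - c. -/

namespace AharonovBohm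

local notation "conj" => starRingEnd ℂ

/-! ### Wirtinger calculus -/

/-- The real-linear map `h ↦ a h + b conj h`. -/
noncomputable def wirtingerMap (a b : ℂ) : ℂ →L[ℝ] ℂ :=
  a • (ContinuousLinearMap.id ℝ ℂ) + b • (conjCLE : ℂ →L[ℝ] ℂ)

@[simp] lemma wirtingerMap_apply (a b h : ℂ) : wirtingerMap a b h = a * h + b * conj h := by
  simp [wirtingerMap]

/-- `u` is real differentiable at `x` with Wirtinger derivatives `a = ∂u` and `b = ∂̄u`. -/
def HasWirtinger (u : ℂ → ℂ) (a b x : ℂ) : Prop := HasFDerivAt u (wirtingerMap a b) x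

lemma hasWirtinger_congr {u : ℂ → ℂ} {a b a' b' x : ℂ} (h : HasWirtinger u a b x)
    (ha : a = a') (hb : b = b') : HasWirtinger u a' b' x := by
  subst ha hb; exact h

lemma HasWirtinger.sub {u v : ℂ → ℂ} {a b c d x : ℂ} (hu : HasWirtinger u a b x)
    (hv : HasWirtinger v c d x) : HasWirtinger (fun y => u y - v y) (a - c) (b - d) x := by
  refine (HasFDerivAt.sub hu hv).congr_fderiv ?_
  ext h; simp; ring

lemma HasWirtinger.mul {u v : ℂ → ℂ} {a b c d x : ℂ} (hu : HasWirtinger u a b x)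
    (hv : HasWirtinger v c d x) :
    HasWirtinger (fun y => u y * v y) (a * v x + u x * c) (b * v x + u x * d) x := by
  refine (HasFDerivAt.mul hu hv).congr_fderiv ?_
  ext h; simp; ring

lemma HasWirtinger.conj {u : ℂ → ℂ} {a b x : ℂ} (hu : HasWirtinger u a b x) :
    HasWirtinger (fun y => conj (u y)) (conj b) (conj a) x := by
  refine (conjCLE.hasFDerivAt.comp x hu).congr_fderiv ?_
  ext h; simp; ring

lemma hasWirtinger_of_hasDerivAt {g : ℂ → ℂ} {g' x : ℂ} (h : HasDerivAt g g' x) :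
    HasWirtinger g g' 0 x := by
  refine (h.hasFDerivAt.restrictScalars ℝ).congr_fderiv ?_
  ext h; simp [mul_comm]

/-- Formally |z|^s = z^{s/2} (conj z)^{s/2}. Differentiating (|z|²)^{s/2} avoids any choice of
branch. -/
lemma hasWirtinger_norm_rpow (s : ℝ) {p x : ℂ} (hx : x ≠ p) :
    HasWirtinger (fun y => ((‖y - p‖ ^ s : ℝ) : ℂ))
      (s / 2 * (‖x - p‖ ^ s : ℝ) / (x - p)) (s / 2 * (‖x - p‖ ^ s : ℝ) / conj (x - p)) x := by
  have hz : x - p ≠ 0 := sub_ne_zero.2 hx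
  have hn : ‖x - p‖ ≠ 0 := norm_ne_zero_iff.2 hz
  have h1 : HasFDerivAt (fun y : ℂ => ‖y - p‖ ^ 2) (2 • (innerSL ℝ (x - p))) x := by
    simpa using ((hasFDerivAt_id (𝕜 := ℝ) x).sub_const p).norm_sq
  have h2 := h1.rpow_const (p := s / 2) (Or.inl (by positivity))
  have h3 := ofRealCLM.hasFDerivAt.comp x h2
  have e : (fun y => ((‖y - p‖ ^ s : ℝ) : ℂ)) =
      ofRealCLM ∘ (fun y : ℂ => (‖y - p‖ ^ 2) ^ (s / 2)) := by
    funext y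
    simp only [Function.comp, ofRealCLM_apply]
    rw [← Real.rpow_natCast, ← Real.rpow_mul (norm_nonneg _)]
    congr 2; push_cast; ring
  unfold HasWirtinger
  rw [e]
  refine h3.congr_fderiv ?_
  ext h
  have e2 : (‖x - p‖ ^ 2) ^ (s / 2 - 1) = ‖x - p‖ ^ s / ‖x - p‖ ^ 2 := by
    rw [← Real.rpow_natCast, ← Real.rpow_mul (norm_nonneg _), ← Real.rpow_sub (by positivity)]
    congr 1; push_cast; ring
  have e3 : (‖x - p‖ : ℂ) ^ 2 = (x - p) * conj (x - p) := by
    rw [mul_conj, normSq_eq_norm_sq]; push_cast; rfl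
  have hc : conj (x - p) ≠ 0 := (map_ne_zero _).2 hz
  have e4 : ((inner ℝ (x - p) h : ℝ) : ℂ) = (h * conj (x - p) + conj h * (x - p)) / 2 := by
    rw [Complex.inner, re_eq_add_conj]; simp
  simp only [wirtingerMap_apply, ContinuousLinearMap.comp_apply, _root_.smul_apply,
    ofRealCLM_apply, innerSL_apply_apply, smul_eq_mul, nsmul_eq_mul, e2]
  push_cast
  rw [e4, e3]
  field_simp

lemma HasWirtinger.partialDeriv_zero {u : ℂ → ℂ} {a b x : ℂ} (h : HasWirtinger u a b x) :
    partialDeriv 0 u x = a + b := by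
  rw [partialDeriv, h.fderiv]; simp [basisVec]

lemma HasWirtinger.partialDeriv_one {u : ℂ → ℂ} {a b x : ℂ} (h : HasWirtinger u a b x) :
    partialDeriv 1 u x = I * (a - b) := by
  rw [partialDeriv, h.fderiv]; simp [basisVec]; ring

lemma _root_.DifferentiableAt.exists_hasWirtinger {u : ℂ → ℂ} {x : ℂ}
    (h : DifferentiableAt ℝ u x) : ∃ a b, HasWirtinger u a b x := by
  refine ⟨(fderiv ℝ u x 1 - I * fderiv ℝ u x I) / 2, (fderiv ℝ u x 1 + I * fderiv ℝ u x I) / 2,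
    h.hasFDerivAt.congr_fderiv ?_⟩
  ext z
  have h1 : fderiv ℝ u x z = z.re * fderiv ℝ u x 1 + z.im * fderiv ℝ u x I := by
    conv_lhs => rw [show z = z.re • (1 : ℂ) + z.im • I by simp]
    rw [map_add, map_smul, map_smul, real_smul, real_smul]
  have e : conj z = (z.re : ℂ) - z.im * I := by
    apply Complex.ext <;> simp
  rw [wirtingerMap_apply, e, h1]
  linear_combination (fderiv ℝ u x I * z.im) * I_sq +
    (fderiv ℝ u x 1 - I * fderiv ℝ u x I) / 2 * (re_add_im z)

/-! ### The components `M_∓ = M_1 ∓ i M_2` of the magnetic gradient -/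

/-- `M_1 - i M_2`, where `M = (i∇ + A_p) u`. -/
noncomputable def magMinus (p : ℂ) (u : ℂ → ℂ) (G : Fin 2 → ℂ → ℂ) (x : ℂ) : ℂ :=
  magGrad p u G 0 x - I * magGrad p u G 1 x

/-- `M_1 + i M_2`, where `M = (i∇ + A_p) u`. -/
noncomputable def magPlus (p : ℂ) (u : ℂ → ℂ) (G : Fin 2 → ℂ → ℂ) (x : ℂ) : ℂ :=
  magGrad p u G 0 x + I * magGrad p u G 1 x

/-- The map (M_1, M_2) ↦ (M_1 - i M_2, M_1 + i M_2) is √2 times a unitary map. -/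
lemma sum_magGrad_mul_conj (p : ℂ) (u v : ℂ → ℂ) (G H : Fin 2 → ℂ → ℂ) (x : ℂ) :
    ∑ j, magGrad p u G j x * conj (magGrad p v H j x) =
      (magMinus p u G x * conj (magMinus p v H x) + magPlus p u G x * conj (magPlus p v H x)) / 2
    := by
  simp only [Fin.sum_univ_two, magMinus, magPlus, map_sub, map_add, map_mul, conj_I]
  linear_combination (magGrad p u G 1 x * conj (magGrad p v H 1 x)) * I_sq

lemma sum_norm_sq_magGrad (p : ℂ) (u : ℂ → ℂ) (G : Fin 2 → ℂ → ℂ) (x : ℂ) :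
    ∑ j, ‖magGrad p u G j x‖ ^ 2 = (‖magMinus p u G x‖ ^ 2 + ‖magPlus p u G x‖ ^ 2) / 2 := by
  have h := sum_magGrad_mul_conj p u u G G x
  simp only [mul_conj, normSq_eq_norm_sq] at h
  exact_mod_cast h

/-- In complex notation the potential is a single fraction, so that M_- and M_+ become 2i(∂ -
1/(4z)) and 2i(∂̄ + 1/(4 conj z)) with z = x - p. -/
lemma potential_minus (p x : ℂ) :
    (potential p 0 x : ℂ) - I * (potential p 1 x : ℂ) = -I / (2 * (x - p)) := by
  -- At the pole both sides vanish, as division by zero gives zero.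
  by_cases hx : x = p
  · subst hx; simp [potential]
  have hz : x - p ≠ 0 := sub_ne_zero.2 hx
  have hc : conj (x - p) ≠ 0 := (map_ne_zero _).2 hz
  have e : ((((x.re - p.re) ^ 2 + (x.im - p.im) ^ 2 : ℝ)) : ℂ) = (x - p) * conj (x - p) := by
    rw [mul_conj, normSq_apply]; simp only [sub_re, sub_im]; push_cast; ring
  have e2 : conj (x - p) = ((x.re - p.re : ℝ) : ℂ) - ((x.im - p.im : ℝ) : ℂ) * I := by
    apply Complex.ext <;> simp; ring
  simp only [potential, Matrix.cons_val_zero, Matrix.cons_val_one]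
  simp only [ofReal_mul, ofReal_div, e]
  rw [← mul_div_mul_right (-I) (2 * (x - p)) hc, mul_assoc 2]
  have hN : (x - p) * conj (x - p) ≠ 0 := mul_ne_zero hz hc
  generalize (x - p) * conj (x - p) = N at *
  rw [e2, ofReal_neg]
  generalize hX : ((x.re - p.re : ℝ) : ℂ) = X
  generalize hY : ((x.im - p.im : ℝ) : ℂ) = Y
  push_cast
  field_simp
  linear_combination -Y * I_sq

lemma potential_plus (p x : ℂ) :
    (potential p 0 x : ℂ) + I * (potential p 1 x : ℂ) = I / (2 * conj (x - p)) := by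
  have h := congrArg conj (potential_minus p x)
  simpa [map_ofNat] using h

lemma magMinus_eq {p : ℂ} {u : ℂ → ℂ} {G : Fin 2 → ℂ → ℂ} {a b x : ℂ}
    (h0 : G 0 x = a + b) (h1 : G 1 x = I * (a - b)) :
    magMinus p u G x = 2 * I * (a - u x / (4 * (x - p))) := by
  have h := potential_minus p x
  simp only [magMinus, magGrad, h0, h1]
  rw [show 2 * I * (a - u x / (4 * (x - p))) = 2 * I * a + u x * (-I / (2 * (x - p))) by
    rw [show 4 * (x - p) = 2 * (2 * (x - p)) by ring]; field_simp; ring, ← h]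
  linear_combination (- I * (a - b)) * I_sq

lemma magPlus_eq {p : ℂ} {u : ℂ → ℂ} {G : Fin 2 → ℂ → ℂ} {a b x : ℂ}
    (h0 : G 0 x = a + b) (h1 : G 1 x = I * (a - b)) :
    magPlus p u G x = 2 * I * (b + u x / (4 * conj (x - p))) := by
  have h := potential_plus p x
  simp only [magPlus, magGrad, h0, h1]
  rw [show 2 * I * (b + u x / (4 * conj (x - p))) = 2 * I * b + u x * (I / (2 * conj (x - p)))
    by rw [show 4 * conj (x - p) = 2 * (2 * conj (x - p)) by ring]; field_simp, ← h]
  linear_combination (I * (a - b)) * I_sq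

/-! ### Functions that are locally `e^{iθ/2}` times the imaginary part of a holomorphic function -/

/-- With `w = |x-p|^{1/2} e^{iθ_p/2}`, this is `e^{iθ_p/2} Im (w g)`. -/
noncomputable def twistedIm (p : ℂ) (g : ℂ → ℂ) (x : ℂ) : ℂ :=
  ((‖x - p‖ ^ (-(1 / 2) : ℝ) : ℝ) * ((x - p) * g x) -
    (‖x - p‖ ^ (1 / 2 : ℝ) : ℝ) * conj (g x)) * (-I / 2)

lemma hasWirtinger_twistedIm {p x g' : ℂ} {g : ℂ → ℂ} (hx : x ≠ p) (hg : HasDerivAt g g' x) :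
    HasWirtinger (twistedIm p g)
      ((((‖x - p‖ ^ (-(1 / 2) : ℝ) : ℝ) : ℂ) * (3 / 4 * g x + (x - p) * g') -
        ((‖x - p‖ ^ (1 / 2 : ℝ) : ℝ) : ℂ) / (x - p) * (1 / 4 * conj (g x))) * (-I / 2))
      ((((‖x - p‖ ^ (-(1 / 2) : ℝ) : ℝ) : ℂ) / conj (x - p) * (-(1 / 4) * (x - p) * g x) -
        ((‖x - p‖ ^ (1 / 2 : ℝ) : ℝ) : ℂ) * (conj g' + conj (g x) / (4 * conj (x - p)))) *
          (-I / 2)) x := by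
  have hz : x - p ≠ 0 := sub_ne_zero.2 hx
  have hc : conj (x - p) ≠ 0 := (map_ne_zero _).2 hz
  have h1 := hasWirtinger_of_hasDerivAt (((hasDerivAt_id x).sub_const p).mul hg)
  have h2 := (hasWirtinger_norm_rpow (-(1 / 2)) hx).mul h1
  have h3 := (hasWirtinger_norm_rpow (1 / 2) hx).mul (hasWirtinger_of_hasDerivAt hg).conj
  have h4 := (h2.sub h3).mul (hasWirtinger_of_hasDerivAt (hasDerivAt_const x (-I / 2)))
  refine hasWirtinger_congr h4 ?_ ?_
  · simp; field_simp; ring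
  · simp; field_simp; ring

/-- The phase satisfies ∂e^{iθ/2} = e^{iθ/2}/(4z), which cancels the potential. What remains is
e^{iθ/2} (w g)', and w (w g)' = g/2 + z g'. In the same way M_+ is -e^{iθ/2} conj((w g)'). -/
lemma magMinus_twistedIm {p x g' : ℂ} {g : ℂ → ℂ} (hx : x ≠ p) (hg : HasDerivAt g g' x) :
    magMinus p (twistedIm p g) (fun j => partialDeriv j (twistedIm p g)) x =
      ((‖x - p‖ ^ (-(1 / 2) : ℝ) : ℝ) : ℂ) * (g x / 2 + (x - p) * g') := by
  have hz : x - p ≠ 0 := sub_ne_zero.2 hx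
  have h := hasWirtinger_twistedIm hx hg
  rw [magMinus_eq h.partialDeriv_zero h.partialDeriv_one, twistedIm]
  field_simp
  linear_combination (x - p) * (-(4 * g x) - 8 * (x - p) * g') * ((‖x - p‖ ^ (-(1 / 2) : ℝ) : ℝ) : ℂ) * I_sq

lemma magPlus_twistedIm {p x g' : ℂ} {g : ℂ → ℂ} (hx : x ≠ p) (hg : HasDerivAt g g' x) :
    magPlus p (twistedIm p g) (fun j => partialDeriv j (twistedIm p g)) x =
      -((‖x - p‖ ^ (1 / 2 : ℝ) : ℝ) : ℂ) / conj (x - p) * conj (g x / 2 + (x - p) * g') := by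
  have hz : x - p ≠ 0 := sub_ne_zero.2 hx
  have hc : conj (x - p) ≠ 0 := (map_ne_zero _).2 hz
  have h := hasWirtinger_twistedIm hx hg
  rw [magPlus_eq h.partialDeriv_zero h.partialDeriv_one, twistedIm]
  have e : conj (g x / 2 + (x - p) * g') = conj (g x) / 2 + conj (x - p) * conj g' := by
    simp [map_ofNat]
  rw [e]
  generalize conj (x - p) = c at *
  generalize conj (g x) = d at *
  generalize conj g' = d' at *
  field_simp
  linear_combination (4 * d + 8 * c * d') * ((‖x - p‖ ^ (1 / 2 : ℝ) : ℝ) : ℂ) * I_sq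

/-! ### Weak harmonicity -/

lemma integrable_fderiv_apply {F : ℂ → ℂ} (hF : ContDiff ℝ 1 F) (hc : HasCompactSupport F)
    (v : ℂ) : Integrable (fun x => fderiv ℝ F x v) :=
  ((hF.continuous_fderiv one_ne_zero).clm_apply continuous_const).integrable_of_hasCompactSupport
    (hc.fderiv_apply (𝕜 := ℝ) v)

/-- Integration by parts against the constant 1. -/
lemma integral_fderiv_apply_eq_zero {F : ℂ → ℂ} (hF : ContDiff ℝ 1 F) (hc : HasCompactSupport F)
    (v : ℂ) : ∫ x, fderiv ℝ F x v = 0 := by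
  have h := integral_bilinear_fderiv_right_eq_neg_left_of_integrable (μ := volume)
    (f := fun _ => (1 : ℝ)) (g := F) (B := ContinuousLinearMap.lsmul ℝ ℝ) (v := v) (by simp)
    (by simpa using integrable_fderiv_apply hF hc v)
    (by simpa using hF.continuous.integrable_of_hasCompactSupport hc)
    (fun _ _ => differentiableAt_const _) (fun x _ => hF.differentiable one_ne_zero x)
  simpa using h

lemma contDiffAt_norm_rpow (s : ℝ) {p x : ℂ} (hx : x ≠ p) {n : ℕ∞} :
    ContDiffAt ℝ n (fun y => ((‖y - p‖ ^ s : ℝ) : ℂ)) x := by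
  have hz : x - p ≠ 0 := sub_ne_zero.2 hx
  exact ofRealCLM.contDiff.contDiffAt.comp x
    (((contDiffAt_id.sub contDiffAt_const).norm ℝ hz).rpow_const_of_ne (norm_ne_zero_iff.2 hz))

lemma contDiffAt_conj {n : ℕ∞} {u : ℂ → ℂ} {x : ℂ} (h : ContDiffAt ℝ n u x) :
    ContDiffAt ℝ n (fun y => conj (u y)) x :=
  conjCLE.contDiff.contDiffAt.comp x h

/-- A singularity of φ at p is harmless, since v vanishes near p. -/
lemma contDiff_mul_conj {p : ℂ} {φ v : ℂ → ℂ} (hφ : ∀ x, x ≠ p → ContDiffAt ℝ 1 φ x)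
    (hv : ContDiff ℝ ∞ v) (hp : p ∉ tsupport v) : ContDiff ℝ 1 (fun x => φ x * conj (v x)) := by
  rw [contDiff_iff_contDiffAt]
  intro x
  by_cases hx : x = p
  · subst hx
    have h : (fun y => φ y * conj (v y)) =ᶠ[𝓝 x] fun _ => 0 := by
      filter_upwards [notMem_tsupport_iff_eventuallyEq.1 hp] with y hy
      simp [hy]
    exact contDiffAt_const.congr_of_eventuallyEq h
  · exact (hφ x hx).mul (contDiffAt_conj (n := 1) (hv.contDiffAt.of_le (by norm_cast)))

lemma hasCompactSupport_mul_conj {φ v : ℂ → ℂ} (hc : HasCompactSupport v) :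
    HasCompactSupport (fun x => φ x * conj (v x)) :=
  HasCompactSupport.mul_left (f := φ) (hc.comp_left (g := conj) (map_zero _))

lemma HasWirtinger.fderiv_bar {u : ℂ → ℂ} {a b x : ℂ} (h : HasWirtinger u a b x) :
    fderiv ℝ u x 1 + I * fderiv ℝ u x I = 2 * b := by
  rw [h.fderiv]; simp; linear_combination (a - b) * I_sq

lemma HasWirtinger.fderiv_hol {u : ℂ → ℂ} {a b x : ℂ} (h : HasWirtinger u a b x) :
    fderiv ℝ u x 1 - I * fderiv ℝ u x I = 2 * a := by
  rw [h.fderiv]; simp; linear_combination (b - a) * I_sq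

/-- If `M_- = φ₁` with `∂̄φ₁ = -φ₁ / (4 conj (x-p))` and `M_+ = φ₂` with `∂φ₂ = φ₂ / (4 (x-p))`,
then `u` is weakly harmonic for the magnetic Laplacian. -/
lemma weaklyHarmonic_of_hasWirtinger {p : ℂ} {u : ℂ → ℂ} {G : Fin 2 → ℂ → ℂ} {φ₁ φ₂ : ℂ → ℂ}
    (h₁ : ∀ x, x ≠ p → ContDiffAt ℝ 1 φ₁ x) (h₂ : ∀ x, x ≠ p → ContDiffAt ℝ 1 φ₂ x)
    (hw₁ : ∀ x, x ≠ p → ∃ a, HasWirtinger φ₁ a (-(φ₁ x / (4 * conj (x - p)))) x)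
    (hw₂ : ∀ x, x ≠ p → ∃ b, HasWirtinger φ₂ (φ₂ x / (4 * (x - p))) b x)
    (hm : ∀ x, x ≠ p → magMinus p u G x = φ₁ x) (hp : ∀ x, x ≠ p → magPlus p u G x = φ₂ x) :
    WeaklyHarmonic p u G := by
  intro v hv hvc hvp
  have hF₁ := contDiff_mul_conj h₁ hv hvp
  have hF₂ := contDiff_mul_conj h₂ hv hvp
  have hc₁ := hasCompactSupport_mul_conj (φ := φ₁) hvc
  have hc₂ := hasCompactSupport_mul_conj (φ := φ₂) hvc
  set F₁ : ℂ → ℂ := fun x => φ₁ x * conj (v x) with hF₁d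
  set F₂ : ℂ → ℂ := fun x => φ₂ x * conj (v x) with hF₂d
  -- The integrand is the total derivative -i(∂̄F₁ + ∂F₂): the equations for φ₁ and φ₂ supply
  -- exactly the potential terms in the magnetic gradient of v.
  have key : ∀ x, ∑ j, magGrad p u G j x * conj (magGrad p v (fun i => partialDeriv i v) j x) =
      (-I / 2) * (fderiv ℝ F₁ x 1 + I * fderiv ℝ F₁ x I) +
        (-I / 2) * (fderiv ℝ F₂ x 1 - I * fderiv ℝ F₂ x I) := by
    intro x
    by_cases hx : x = p
    · subst hx
      have hv0 := notMem_tsupport_iff_eventuallyEq.1 hvp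
      have e₁ : F₁ =ᶠ[𝓝 x] fun _ => 0 := by
        filter_upwards [hv0] with y hy; simp [hF₁d, hy]
      have e₂ : F₂ =ᶠ[𝓝 x] fun _ => 0 := by
        filter_upwards [hv0] with y hy; simp [hF₂d, hy]
      have e₃ : fderiv ℝ v x = 0 := fderiv_of_notMem_tsupport ℝ hvp
      have e₄ : v x = 0 := hv0.self_of_nhds
      simp [e₁.fderiv_eq, e₂.fderiv_eq, magGrad, partialDeriv, e₃, e₄]
    · obtain ⟨a, ha⟩ := hw₁ x hx
      obtain ⟨b, hb⟩ := hw₂ x hx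
      obtain ⟨c, d, hcd⟩ :=
        (hv.contDiffAt.differentiableAt (x := x) (by simp)).exists_hasWirtinger
      rw [sum_magGrad_mul_conj, (ha.mul hcd.conj).fderiv_bar, (hb.mul hcd.conj).fderiv_hol,
        hm x hx, hp x hx, magMinus_eq hcd.partialDeriv_zero hcd.partialDeriv_one,
        magPlus_eq hcd.partialDeriv_zero hcd.partialDeriv_one]
      simp only [map_mul, map_sub, map_add, map_div₀, conj_I, map_ofNat, conj_conj]
      ring
  simp_rw [key]
  have i₁ := integrable_fderiv_apply hF₁ hc₁
  have i₂ := integrable_fderiv_apply hF₂ hc₂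
  have j₁ : Integrable (fun x => fderiv ℝ F₁ x 1 + I * fderiv ℝ F₁ x I) :=
    (i₁ 1).add ((i₁ I).const_mul I)
  have j₂ : Integrable (fun x => fderiv ℝ F₂ x 1 - I * fderiv ℝ F₂ x I) :=
    (i₂ 1).sub ((i₂ I).const_mul I)
  rw [integral_add (j₁.const_mul _) (j₂.const_mul _), integral_const_mul, integral_const_mul,
    integral_add (i₁ 1) ((i₁ I).const_mul I), integral_sub (i₂ 1) ((i₂ I).const_mul I),
    integral_const_mul, integral_const_mul]
  simp [integral_fderiv_apply_eq_zero hF₁ hc₁, integral_fderiv_apply_eq_zero hF₂ hc₂]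

lemma _root_.Differentiable.contDiff_real {g : ℂ → ℂ} (hg : Differentiable ℂ g) {n : ℕ∞} :
    ContDiff ℝ n g :=
  (hg.contDiff (n := n)).restrict_scalars ℝ

/-- M_- is |z|^{-1/2} times a holomorphic function and M_+ is |z|^{1/2} times an antiholomorphic
one. Only the powers of |z| contribute to ∂̄M_- and ∂M_+, and they produce the required factors
∓1/4. -/
lemma weaklyHarmonic_twistedIm (p : ℂ) {g : ℂ → ℂ} (hg : Differentiable ℂ g) :
    WeaklyHarmonic p (twistedIm p g) (fun j => partialDeriv j (twistedIm p g)) := by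
  have hg' : Differentiable ℂ (deriv g) := fun x =>
    (hg.analyticAt x).deriv.differentiableAt
  have hH : Differentiable ℂ (fun x => g x / 2 + (x - p) * deriv g x) := by fun_prop
  have hK : ∀ x, x ≠ p → DifferentiableAt ℂ (fun x => (g x / 2 + (x - p) * deriv g x) / (x - p)) x :=
    fun x hx => (hH x).div (by fun_prop) (sub_ne_zero.2 hx)
  refine weaklyHarmonic_of_hasWirtinger
    (φ₁ := fun x => ((‖x - p‖ ^ (-(1 / 2) : ℝ) : ℝ) : ℂ) * (g x / 2 + (x - p) * deriv g x))
    (φ₂ := fun x => ((‖x - p‖ ^ (1 / 2 : ℝ) : ℝ) : ℂ) *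
      (-conj ((g x / 2 + (x - p) * deriv g x) / (x - p)))) ?_ ?_ ?_ ?_ ?_ ?_
  · exact fun x hx => (contDiffAt_norm_rpow (n := 1) _ hx).mul (hH.contDiff_real (n := 1)).contDiffAt
  · intro x hx
    refine (contDiffAt_norm_rpow (n := 1) _ hx).mul (contDiffAt_conj (n := 1) ?_).neg
    simp only [div_eq_mul_inv _ (_ - p)]
    exact ((hH.contDiff_real (n := 1)).contDiffAt).mul
      ((contDiffAt_id.sub contDiffAt_const).inv (sub_ne_zero.2 hx))
  · intro x hx
    refine ⟨_, hasWirtinger_congr ((hasWirtinger_norm_rpow _ hx).mul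
      (hasWirtinger_of_hasDerivAt (hH x).hasDerivAt)) rfl ?_⟩
    push_cast; ring
  · intro x hx
    have h1 := (hasWirtinger_of_hasDerivAt (hK x hx).hasDerivAt).conj
    have h2 := (hasWirtinger_of_hasDerivAt (hasDerivAt_const x (0 : ℂ))).sub h1
    simp only [map_zero, sub_zero, zero_sub] at h2
    refine ⟨_, hasWirtinger_congr ((hasWirtinger_norm_rpow (1 / 2) hx).mul h2) ?_ rfl⟩
    rw [div_mul_eq_div_div]; push_cast; ring
  · exact fun x hx => magMinus_twistedIm hx (hg x).hasDerivAt
  · intro x hx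
    rw [magPlus_twistedIm hx (hg x).hasDerivAt, map_div₀]
    ring

/-! ### Cutoff functions -/

/-- A smooth bump function that is `1` on the unit disk and supported in the disk of radius `2`. -/
noncomputable def unitBump : ContDiffBump (0 : ℂ) := ⟨1, 2, one_pos, one_lt_two⟩

/-- A smooth function that is `1` for `|x - p| ≤ ρ` and `0` for `|x - p| ≥ 2ρ`. -/
noncomputable def cutoff (p : ℂ) (ρ : ℝ) (x : ℂ) : ℂ := (unitBump (ρ⁻¹ • (x - p)) : ℂ)

lemma contDiff_cutoff (p : ℂ) (ρ : ℝ) : ContDiff ℝ ∞ (cutoff p ρ) := by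
  have h : ContDiff ℝ ∞ (fun x : ℂ => ρ⁻¹ • (x - p)) := by fun_prop
  exact ofRealCLM.contDiff.comp (unitBump.contDiff.comp h)

lemma norm_inv_smul_sub {p x : ℂ} {ρ : ℝ} (hρ : 0 < ρ) : ‖ρ⁻¹ • (x - p)‖ = ‖x - p‖ / ρ := by
  rw [norm_smul, norm_inv, Real.norm_of_nonneg hρ.le]; ring

lemma cutoff_eq_one {p x : ℂ} {ρ : ℝ} (hρ : 0 < ρ) (h : ‖x - p‖ ≤ ρ) : cutoff p ρ x = 1 := by
  rw [cutoff, unitBump.one_of_mem_closedBall, ofReal_one]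
  rw [mem_closedBall_zero_iff, norm_inv_smul_sub hρ]
  exact (div_le_one hρ).2 h

lemma cutoff_eq_zero {p x : ℂ} {ρ : ℝ} (hρ : 0 < ρ) (h : 2 * ρ ≤ ‖x - p‖) :
    cutoff p ρ x = 0 := by
  rw [cutoff, unitBump.zero_of_le_dist, ofReal_zero]
  rw [dist_zero_right, norm_inv_smul_sub hρ]
  exact (le_div_iff₀ hρ).2 h

lemma cutoff_eq_ofReal (p : ℂ) (ρ : ℝ) (x : ℂ) :
    ∃ t : ℝ, cutoff p ρ x = t ∧ 0 ≤ t ∧ t ≤ 1 :=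
  ⟨_, rfl, unitBump.nonneg, unitBump.le_one⟩

lemma norm_cutoff_le (p : ℂ) (ρ : ℝ) (x : ℂ) : ‖cutoff p ρ x‖ ≤ 1 := by
  obtain ⟨t, h, h0, h1⟩ := cutoff_eq_ofReal p ρ x
  rwa [h, norm_real, Real.norm_of_nonneg h0]

lemma partialDeriv_cutoff_of_lt {p x : ℂ} {ρ : ℝ} (hρ : 0 < ρ) (h : ‖x - p‖ < ρ) (j : Fin 2) :
    partialDeriv j (cutoff p ρ) x = 0 := by
  have : cutoff p ρ =ᶠ[𝓝 x] fun _ => 1 := by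
    have hc : ContinuousAt (fun y => ‖y - p‖) x := by fun_prop
    filter_upwards [hc.eventually_lt_const h] with y hy using cutoff_eq_one hρ hy.le
  rw [partialDeriv, this.fderiv_eq]; simp

lemma partialDeriv_cutoff_of_gt {p x : ℂ} {ρ : ℝ} (hρ : 0 < ρ) (h : 2 * ρ < ‖x - p‖) (j : Fin 2) :
    partialDeriv j (cutoff p ρ) x = 0 := by
  have : cutoff p ρ =ᶠ[𝓝 x] fun _ => 0 := by
    have hc : ContinuousAt (fun y => ‖y - p‖) x := by fun_prop
    filter_upwards [hc.eventually_const_lt h] with y hy using cutoff_eq_zero hρ hy.le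
  rw [partialDeriv, this.fderiv_eq]; simp

lemma norm_basisVec (j : Fin 2) : ‖basisVec j‖ = 1 := by
  fin_cases j <;> simp [basisVec]

/-- The bound is scale invariant: the gradient is O(1/ρ) and lives where |x - p| ≤ 2ρ. The weight |x
- p| lets a term (∂cutoff) u be absorbed by u/|x - p|, which the norm of H^{1,p} and the Hardy
inequality control. -/
lemma exists_partialDeriv_cutoff_le : ∃ C : ℝ, 0 ≤ C ∧ ∀ (p : ℂ) (ρ : ℝ), 0 < ρ → ∀ (x : ℂ)
    (j : Fin 2), ‖partialDeriv j (cutoff p ρ) x‖ * ‖x - p‖ ≤ C := by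
  have hcont : Continuous (fderiv ℝ (fun y => unitBump y)) :=
    (unitBump.contDiff (n := 1)).continuous_fderiv one_ne_zero
  obtain ⟨C, hC⟩ := hcont.bounded_above_of_compact_support
    (unitBump.hasCompactSupport.fderiv (𝕜 := ℝ))
  have hC0 : 0 ≤ C := (norm_nonneg _).trans (hC 0)
  refine ⟨C * 2, by positivity, fun p ρ hρ x j => ?_⟩
  by_cases hx : 2 * ρ < ‖x - p‖
  · rw [partialDeriv_cutoff_of_gt hρ hx]; simp; positivity
  have h1 : HasFDerivAt (fun y : ℂ => ρ⁻¹ • (y - p)) (ρ⁻¹ • ContinuousLinearMap.id ℝ ℂ) x :=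
    ((hasFDerivAt_id x).sub_const p).const_smul ρ⁻¹
  have h2 : HasFDerivAt (fun y => unitBump y) _ (ρ⁻¹ • (x - p)) :=
    ((unitBump.contDiff (n := 1)).differentiable one_ne_zero _).hasFDerivAt
  have h3 := ofRealCLM.hasFDerivAt.comp x (h2.comp x h1)
  have h4 : partialDeriv j (cutoff p ρ) x =
      ((fderiv ℝ (fun y => unitBump y) (ρ⁻¹ • (x - p)) (ρ⁻¹ • basisVec j) : ℝ) : ℂ) := by
    rw [partialDeriv, show cutoff p ρ = ofRealCLM ∘ (fun y => unitBump y) ∘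
      fun y : ℂ => ρ⁻¹ • (y - p) from rfl, h3.fderiv]
    rfl
  have h5 : ‖partialDeriv j (cutoff p ρ) x‖ ≤ C * ρ⁻¹ := by
    rw [h4, norm_real]
    refine (ContinuousLinearMap.le_opNorm _ _).trans ?_
    rw [norm_smul, norm_basisVec, mul_one, norm_inv, Real.norm_of_nonneg hρ.le]
    exact mul_le_mul_of_nonneg_right (hC _) (by positivity)
  calc _ ≤ C * ρ⁻¹ * (2 * ρ) := by
        have := not_lt.1 hx
        gcongr
    _ = C * 2 := by field_simp

/-! ### Membership in `H^{1,p}` -/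

/-- The square is |x - p|^{-1}, and the polar weight r of the plane cancels this singularity. -/
lemma memLp_norm_rpow_neg_half (p : ℂ) (R : ℝ) :
    MemLp (fun x => ‖x - p‖ ^ (-(1 / 2) : ℝ)) 2 (volume.restrict (Metric.ball (0 : ℂ) R)) := by
  have hm : Measurable (fun x : ℂ => ‖x - p‖ ^ (-(1 / 2) : ℝ)) := by fun_prop
  rw [memLp_two_iff_integrable_sq_norm hm.aestronglyMeasurable]
  have h0 : IntegrableOn (fun x : ℂ => ‖x‖⁻¹) (Metric.ball (0 : ℂ) (R + ‖p‖)) := by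
    rw [integrableOn_fun_norm_addHaar volume (f := fun r => r⁻¹)]
    have : IntegrableOn (fun _ : ℝ => (1 : ℝ)) (Set.Ioo 0 (R + ‖p‖)) := by simp
    refine this.congr_fun (fun r hr => ?_) measurableSet_Ioo
    have := hr.1.ne'
    simp [this]
  have h1 : IntegrableOn (fun x : ℂ => ‖x - p‖⁻¹) (Metric.ball p (R + ‖p‖)) := by
    have := (measurePreserving_sub_right (volume : Measure ℂ) p).integrableOn_comp_preimage
      (MeasurableEquiv.subRight p).measurableEmbedding |>.2 h0
    refine this.mono_set fun x hx => ?_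
    simpa [dist_eq_norm] using hx
  have h2 : IntegrableOn (fun x : ℂ => ‖x - p‖⁻¹) (Metric.ball 0 R) := by
    refine h1.mono_set (Metric.ball_subset_ball' ?_)
    simp
  refine h2.congr (Eventually.of_forall fun x => ?_)
  simp only
  rw [Real.norm_of_nonneg (by positivity), ← Real.rpow_natCast, ← Real.rpow_mul (norm_nonneg _)]
  norm_num [Real.rpow_neg_one]

/-- A fixed L² function dominates, and its integral over disks whose area tends to 0 is small by
absolute continuity. -/
lemma tendsto_eLpNorm_of_shrinking_support {p : ℂ} {R C : ℝ} {f : ℕ → ℂ → ℂ}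
    (hf : ∀ n, ∀ x ∈ Metric.ball (0 : ℂ) R, x ≠ p → ‖f n x‖ ≤ C * ‖x - p‖ ^ (-(1 / 2) : ℝ))
    (hs : ∀ (n : ℕ) x, 2 * ((n : ℝ) + 1)⁻¹ < ‖x - p‖ → f n x = 0) :
    Tendsto (fun n => eLpNorm (f n) 2 (volume.restrict (Metric.ball (0 : ℂ) R))) atTop (𝓝 0) := by
  set μ := volume.restrict (Metric.ball (0 : ℂ) R)
  have hK : MemLp (fun x => C * ‖x - p‖ ^ (-(1 / 2) : ℝ)) 2 μ :=
    (memLp_norm_rpow_neg_half p R).const_mul C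
  have hsmall : Tendsto (fun n : ℕ => μ (Metric.closedBall p (2 * ((n : ℝ) + 1)⁻¹))) atTop (𝓝 0) := by
    have h1 : Tendsto (fun n : ℕ => volume (Metric.closedBall p (2 * ((n : ℝ) + 1)⁻¹)))
        atTop (𝓝 0) := by
      simp_rw [Complex.volume_closedBall]
      have h2 : Tendsto (fun n : ℕ => 2 * ((n : ℝ) + 1)⁻¹) atTop (𝓝 0) := by
        have := tendsto_one_div_add_atTop_nhds_zero_nat (𝕜 := ℝ)
        simpa using this.const_mul 2
      have h3 := ENNReal.tendsto_ofReal h2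
      have h4 := ENNReal.Tendsto.mul_const (b := (NNReal.pi : ENNReal)) (ENNReal.Tendsto.pow (n := 2) h3)
        (Or.inr ENNReal.coe_ne_top)
      simpa using h4
    exact tendsto_of_tendsto_of_tendsto_of_le_of_le tendsto_const_nhds h1 (fun _ => zero_le)
      (fun n => Measure.restrict_apply_le _ _)
  rw [ENNReal.tendsto_atTop_zero]
  intro ε hε
  obtain ⟨e, he0, heε⟩ : ∃ e : ℝ, 0 < e ∧ ENNReal.ofReal e ≤ ε := by
    by_cases h : ε = ⊤
    · exact ⟨1, one_pos, by simp [h]⟩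
    · exact ⟨ε.toReal, ENNReal.toReal_pos hε.ne' h, ENNReal.ofReal_toReal_le⟩
  obtain ⟨δ, hδ, H⟩ := hK.eLpNorm_indicator_le (by norm_num) (by simp) he0
  obtain ⟨N, hN⟩ := (ENNReal.tendsto_atTop_zero.1 hsmall) (ENNReal.ofReal δ)
    (ENNReal.ofReal_pos.2 hδ)
  refine ⟨N, fun n hn => (le_trans ?_ (H _ measurableSet_closedBall (hN n hn))).trans heε⟩
  refine eLpNorm_mono_ae ?_
  have hne : ∀ᵐ x ∂μ, x ≠ p := ae_restrict_of_ae (by simp [ae_iff])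
  filter_upwards [ae_restrict_mem Metric.isOpen_ball.measurableSet, hne] with x hx hxp
  by_cases h : x ∈ Metric.closedBall p (2 * ((n : ℝ) + 1)⁻¹)
  · rw [Set.indicator_of_mem h]
    exact (hf n x hx hxp).trans (le_abs_self _)
  · rw [hs n x (by simpa [dist_eq_norm] using h)]
    simp

lemma measurable_partialDeriv (j : Fin 2) (u : ℂ → ℂ) : Measurable (partialDeriv j u) :=
  measurable_fderiv_apply_const ℝ u _

lemma partialDeriv_mul {u v : ℂ → ℂ} {x : ℂ} (hu : DifferentiableAt ℝ u x)
    (hv : DifferentiableAt ℝ v x) (j : Fin 2) :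
    partialDeriv j (fun y => u y * v y) x =
      u x * partialDeriv j v x + partialDeriv j u x * v x := by
  rw [partialDeriv, fderiv_fun_mul hu hv]
  simp [partialDeriv]; ring

lemma partialDeriv_sub {u v : ℂ → ℂ} {x : ℂ} (hu : DifferentiableAt ℝ u x)
    (hv : DifferentiableAt ℝ v x) (j : Fin 2) :
    partialDeriv j (fun y => u y - v y) x = partialDeriv j u x - partialDeriv j v x := by
  rw [partialDeriv, fderiv_fun_sub hu hv]
  simp [partialDeriv]

/-- The bounds say u = O(|x - p|^{1/2}) and ∇u = O(|x - p|^{-1/2}). The approximants are u minus its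
product with a cutoff at scale 1/(n+1). Each of the three errors is supported in a shrinking disk
and dominated by a multiple of |x - p|^{-1/2}. -/
lemma memH1Loc_of_bound {p : ℂ} {u : ℂ → ℂ} (hu : ∀ x, x ≠ p → ContDiffAt ℝ ∞ u x)
    (hb : ∀ R : ℝ, ∃ C : ℝ, 0 ≤ C ∧ ∀ x ∈ Metric.ball (0 : ℂ) R, x ≠ p →
      ‖u x‖ ≤ C * ‖x - p‖ ^ (-(1 / 2) : ℝ) * ‖x - p‖ ∧
      ∀ j, ‖partialDeriv j u x‖ ≤ C * ‖x - p‖ ^ (-(1 / 2) : ℝ)) :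
    MemH1Loc p u (fun j => partialDeriv j u) := by
  intro R hR
  obtain ⟨C, hC0, hC⟩ := hb R
  obtain ⟨D, hD0, hD⟩ := exists_partialDeriv_cutoff_le
  set μ := volume.restrict (Metric.ball (0 : ℂ) R) with hμ
  have hne : ∀ᵐ x ∂μ, x ≠ p := ae_restrict_of_ae (by simp [ae_iff])
  have hmem : ∀ᵐ x ∂μ, x ∈ Metric.ball (0 : ℂ) R :=
    ae_restrict_mem Metric.isOpen_ball.measurableSet
  have hum : Measurable u :=
    measurable_of_continuousOn_compl_singleton p fun x hx => (hu x hx).continuousAt.continuousWithinAt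
  have hlen : ∀ x ∈ Metric.ball (0 : ℂ) R, ‖x - p‖ ≤ R + ‖p‖ := fun x hx =>
    (norm_sub_le _ _).trans (by gcongr; simpa using (Metric.mem_ball.1 hx).le)
  have hK := memLp_norm_rpow_neg_half p R
  have hLp : ∀ {f : ℂ → ℂ} {c : ℝ}, Measurable f → (∀ x ∈ Metric.ball (0 : ℂ) R, x ≠ p →
      ‖f x‖ ≤ c * ‖x - p‖ ^ (-(1 / 2) : ℝ)) → MemLp f 2 μ := fun {f c} hf h => by
    refine hK.of_le_mul (c := c) hf.aestronglyMeasurable ?_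
    filter_upwards [hmem, hne] with x hx hxp
    rw [Real.norm_of_nonneg (by positivity)]
    exact h x hx hxp
  have hu1 : ∀ x ∈ Metric.ball (0 : ℂ) R, x ≠ p →
      ‖u x‖ ≤ C * (R + ‖p‖) * ‖x - p‖ ^ (-(1 / 2) : ℝ) := fun x hx hxp =>
    ((hC x hx hxp).1).trans (by
      rw [mul_right_comm]
      gcongr
      exact hlen x hx)
  let v : ℕ → ℂ → ℂ := fun n x => u x - cutoff p ((n : ℝ) + 1)⁻¹ x * u x
  have hρ : ∀ n : ℕ, 0 < ((n : ℝ) + 1)⁻¹ := fun n => by positivity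
  have hv0 : ∀ n, ∀ᶠ x in 𝓝 p, v n x = 0 := fun n => by
    filter_upwards [Metric.ball_mem_nhds p (hρ n)] with x hx
    simp only [v]
    rw [cutoff_eq_one (hρ n) (by simpa [dist_eq_norm] using (Metric.mem_ball.1 hx).le)]
    ring
  have hvs : ∀ n, ContDiff ℝ ∞ (v n) := fun n => by
    rw [contDiff_iff_contDiffAt]
    intro x
    by_cases hx : x = p
    · subst hx
      exact contDiffAt_const.congr_of_eventuallyEq (hv0 n)
    · exact (hu x hx).sub ((contDiff_cutoff p _).contDiffAt.mul (hu x hx))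
  have hd : ∀ n j x, x ≠ p → partialDeriv j (v n) x - partialDeriv j u x =
      -(cutoff p ((n : ℝ) + 1)⁻¹ x * partialDeriv j u x +
        partialDeriv j (cutoff p ((n : ℝ) + 1)⁻¹) x * u x) := fun n j x hx => by
    have h1 := (hu x hx).differentiableAt (by simp)
    have h2 := (contDiff_cutoff p ((n : ℝ) + 1)⁻¹).contDiffAt.differentiableAt (x := x) (by simp)
    have h3 : DifferentiableAt ℝ (fun y => cutoff p ((n : ℝ) + 1)⁻¹ y * u y) x := h2.mul h1
    rw [show v n = fun y => u y - cutoff p ((n : ℝ) + 1)⁻¹ y * u y from rfl,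
      partialDeriv_sub h1 h3, partialDeriv_mul h2 h1]
    ring
  have hcut : ∀ n x, ‖v n x - u x‖ ≤ ‖u x‖ := fun n x => by
    simp only [v, sub_sub_cancel_left, norm_neg, norm_mul]
    exact mul_le_of_le_one_left (norm_nonneg _) (norm_cutoff_le _ _ _)
  have hcut0 : ∀ (n : ℕ) x, 2 * ((n : ℝ) + 1)⁻¹ < ‖x - p‖ → v n x - u x = 0 := fun n x hx => by
    simp only [v]; rw [cutoff_eq_zero (hρ n) hx.le]; ring
  have hdb : ∀ n j x, x ∈ Metric.ball (0 : ℂ) R → x ≠ p →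
      ‖partialDeriv j (v n) x - partialDeriv j u x‖ ≤
        (C + D * C) * ‖x - p‖ ^ (-(1 / 2) : ℝ) := fun n j x hx hxp => by
    rw [hd n j x hxp, norm_neg]
    refine (norm_add_le _ _).trans ?_
    rw [norm_mul, norm_mul, add_mul]
    refine add_le_add ?_ ?_
    · exact (mul_le_of_le_one_left (norm_nonneg _) (norm_cutoff_le _ _ _)).trans ((hC x hx hxp).2 j)
    · calc _ ≤ ‖partialDeriv j (cutoff p ((n : ℝ) + 1)⁻¹) x‖ *
            (C * ‖x - p‖ ^ (-(1 / 2) : ℝ) * ‖x - p‖) := by gcongr; exact (hC x hx hxp).1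
        _ = (‖partialDeriv j (cutoff p ((n : ℝ) + 1)⁻¹) x‖ * ‖x - p‖) *
            (C * ‖x - p‖ ^ (-(1 / 2) : ℝ)) := by ring
        _ ≤ D * (C * ‖x - p‖ ^ (-(1 / 2) : ℝ)) := by gcongr; exact hD p _ (hρ n) x j
        _ = _ := by ring
  refine ⟨hLp hum hu1, fun j => hLp (measurable_partialDeriv j u) fun x hx hxp => (hC x hx hxp).2 j,
    v, fun n => ⟨(hvs n).contDiffOn, hv0 n, ?_, fun j => ?_⟩, ?_, fun j => ?_, ?_⟩
  · refine hLp (c := 2 * (C * (R + ‖p‖))) (hvs n).continuous.measurable fun x hx hxp => ?_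
    calc ‖v n x‖ = ‖(v n x - u x) + u x‖ := by ring_nf
      _ ≤ ‖v n x - u x‖ + ‖u x‖ := norm_add_le _ _
      _ ≤ 2 * ‖u x‖ := by linarith [hcut n x]
      _ ≤ _ := by rw [mul_assoc 2]; gcongr; exact hu1 x hx hxp
  · refine hLp (c := (C + D * C) + C) (measurable_partialDeriv j _) fun x hx hxp => ?_
    calc _ = ‖(partialDeriv j (v n) x - partialDeriv j u x) + partialDeriv j u x‖ := by ring_nf
      _ ≤ _ := norm_add_le _ _
      _ ≤ _ := by rw [add_mul _ C]; exact add_le_add (hdb n j x hx hxp) ((hC x hx hxp).2 j)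
  · exact tendsto_eLpNorm_of_shrinking_support (p := p)
      (fun n x hx hxp => (hcut n x).trans (hu1 x hx hxp)) hcut0
  · have : ∀ n, eLpNorm (fun x => partialDeriv j (v n) x - partialDeriv j u x) 2 μ =
        eLpNorm (fun x => -(cutoff p ((n : ℝ) + 1)⁻¹ x * partialDeriv j u x +
        partialDeriv j (cutoff p ((n : ℝ) + 1)⁻¹) x * u x)) 2 μ := fun n => by
      refine eLpNorm_congr_ae ?_
      filter_upwards [hne] with x hxp using hd n j x hxp
    refine Tendsto.congr (fun n => (this n).symm) ?_
    refine tendsto_eLpNorm_of_shrinking_support (p := p) (C := C + D * C) (fun n x hx hxp => ?_)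
      fun n x hx => ?_
    · rw [← hd n j x hxp]; exact hdb n j x hx hxp
    · rw [cutoff_eq_zero (hρ n) hx.le, partialDeriv_cutoff_of_gt (hρ n) hx]; ring
  · refine tendsto_eLpNorm_of_shrinking_support (p := p) (C := C) (fun n x hx hxp => ?_)
      fun n x hx => ?_
    · have : 0 < ‖x - p‖ := norm_pos_iff.2 (sub_ne_zero.2 hxp)
      rw [norm_div, norm_real, norm_norm, div_le_iff₀ this]
      exact (hcut n x).trans (hC x hx hxp).1
    · rw [hcut0 n x hx, zero_div]

lemma norm_rpow_half_eq {z : ℂ} (hz : z ≠ 0) :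
    ‖z‖ ^ (1 / 2 : ℝ) = ‖z‖ * ‖z‖ ^ (-(1 / 2) : ℝ) := by
  nth_rewrite 2 [← Real.rpow_one ‖z‖]
  rw [← Real.rpow_add (norm_pos_iff.2 hz)]
  norm_num

lemma memH1Loc_twistedIm (p : ℂ) {g : ℂ → ℂ} (hg : Differentiable ℂ g) :
    MemH1Loc p (twistedIm p g) (fun j => partialDeriv j (twistedIm p g)) := by
  have hg' : Differentiable ℂ (deriv g) := fun x =>
    (hg.analyticAt x).deriv.differentiableAt
  refine memH1Loc_of_bound (fun x hx => ?_) fun R => ?_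
  · have h0 := (hg.contDiff_real (n := ⊤)).contDiffAt (x := x)
    exact (((contDiffAt_norm_rpow (n := ⊤) _ hx).mul
      ((contDiffAt_id.sub contDiffAt_const).mul h0)).sub
      ((contDiffAt_norm_rpow (n := ⊤) _ hx).mul (contDiffAt_conj (n := ⊤) h0))).mul contDiffAt_const
  obtain ⟨A, hA⟩ := (isCompact_closedBall (0 : ℂ) R).exists_bound_of_continuousOn
    hg.continuous.continuousOn
  obtain ⟨B, hB⟩ := (isCompact_closedBall (0 : ℂ) R).exists_bound_of_continuousOn
    hg'.continuous.continuousOn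
  -- A bounds g, B bounds g', and R + |p| bounds |x - p| on the disk. The absolute values keep the
  -- constant nonnegative even when the disk is empty.
  refine ⟨|A| + |R + ‖p‖| * |B|, by positivity, fun x hx hxp => ?_⟩
  have hz : x - p ≠ 0 := sub_ne_zero.2 hxp
  have hn : 0 < ‖x - p‖ := norm_pos_iff.2 hz
  have hlen : ‖x - p‖ ≤ |R + ‖p‖| := by
    refine ((norm_sub_le _ _).trans ?_).trans (le_abs_self _)
    gcongr; simpa using (Metric.mem_ball.1 hx).le
  have hgA : ‖g x‖ ≤ |A| := (hA x (Metric.ball_subset_closedBall hx)).trans (le_abs_self _)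
  have hgB : ‖deriv g x‖ ≤ |B| := (hB x (Metric.ball_subset_closedBall hx)).trans (le_abs_self _)
  have hW := hasWirtinger_twistedIm hxp (hg x).hasDerivAt
  rw [norm_rpow_half_eq hz] at hW
  set r := ‖x - p‖ ^ (-(1 / 2) : ℝ) with hr
  have hr0 : 0 ≤ r := by positivity
  have hI : ‖-I / 2‖ = 1 / 2 := by simp
  constructor
  · rw [twistedIm, norm_rpow_half_eq hz, ← hr, norm_mul, hI]
    have h1 : ‖(r : ℂ) * ((x - p) * g x) - ((‖x - p‖ * r : ℝ) : ℂ) * conj (g x)‖ ≤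
        2 * (r * ‖x - p‖ * ‖g x‖) := by
      refine (norm_sub_le _ _).trans (le_of_eq ?_)
      rw [norm_mul, norm_mul, norm_mul, norm_real, norm_real, Real.norm_of_nonneg hr0,
        Real.norm_of_nonneg (by positivity), RCLike.norm_conj]
      ring
    calc _ ≤ 2 * (r * ‖x - p‖ * ‖g x‖) * (1 / 2) := by gcongr
      _ = ‖g x‖ * r * ‖x - p‖ := by ring
      _ ≤ _ := by
        gcongr
        exact hgA.trans (le_add_of_nonneg_right (by positivity))
  · set a := ((r : ℂ) * (3 / 4 * g x + (x - p) * deriv g x) -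
      ((‖x - p‖ * r : ℝ) : ℂ) / (x - p) * (1 / 4 * conj (g x))) * (-I / 2) with ha
    set b := ((r : ℂ) / conj (x - p) * (-(1 / 4) * (x - p) * g x) -
      ((‖x - p‖ * r : ℝ) : ℂ) * (conj (deriv g x) + conj (g x) / (4 * conj (x - p)))) *
        (-I / 2) with hb
    have hnr : ‖(r : ℂ)‖ = r := by rw [norm_real, Real.norm_of_nonneg hr0]
    have hng : ‖((‖x - p‖ * r : ℝ) : ℂ)‖ = ‖x - p‖ * r := by
      rw [norm_real, Real.norm_of_nonneg (by positivity)]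
    have hab1 : ‖a‖ ≤ r * (|A| + |R + ‖p‖| * |B|) / 2 := by
      rw [ha, norm_mul, hI]
      have e1 : ‖(r : ℂ) * (3 / 4 * g x + (x - p) * deriv g x)‖ ≤
          r * (3 / 4 * |A| + |R + ‖p‖| * |B|) := by
        rw [norm_mul, hnr]
        gcongr
        refine (norm_add_le _ _).trans ?_
        rw [norm_mul, norm_mul]
        gcongr
        norm_num
      have e2 : ‖((‖x - p‖ * r : ℝ) : ℂ) / (x - p) * (1 / 4 * conj (g x))‖ ≤ r * (1 / 4 * |A|) := by
        rw [norm_mul, norm_div, hng, mul_div_cancel_left₀ _ hn.ne', norm_mul, RCLike.norm_conj]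
        gcongr
        norm_num
      have := (norm_sub_le _ _).trans (add_le_add e1 e2)
      calc _ ≤ _ := mul_le_mul_of_nonneg_right this (by norm_num)
        _ = _ := by ring
    have hab2 : ‖b‖ ≤ r * (|A| + |R + ‖p‖| * |B|) / 2 := by
      rw [hb, norm_mul, hI]
      have e1 : ‖(r : ℂ) / conj (x - p) * (-(1 / 4) * (x - p) * g x)‖ ≤ r * (1 / 4 * |A|) := by
        rw [norm_mul, norm_div, norm_mul, norm_mul, hnr, RCLike.norm_conj]
        calc _ = r * (‖(-(1 / 4) : ℂ)‖ * ‖g x‖) := by field_simp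
          _ ≤ _ := by gcongr; norm_num
      have e2 : ‖((‖x - p‖ * r : ℝ) : ℂ) * (conj (deriv g x) + conj (g x) / (4 * conj (x - p)))‖ ≤
          r * (1 / 4 * |A| + |R + ‖p‖| * |B|) := by
        rw [norm_mul, hng]
        have : ‖conj (deriv g x) + conj (g x) / (4 * conj (x - p))‖ ≤
            ‖deriv g x‖ + ‖g x‖ / (4 * ‖x - p‖) := by
          refine (norm_add_le _ _).trans (le_of_eq ?_)
          rw [norm_div, norm_mul, RCLike.norm_conj, RCLike.norm_conj, RCLike.norm_conj]
          norm_num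
        calc _ ≤ ‖x - p‖ * r * (‖deriv g x‖ + ‖g x‖ / (4 * ‖x - p‖)) := by gcongr
          _ = r * (1 / 4 * ‖g x‖ + ‖x - p‖ * ‖deriv g x‖) := by field_simp; ring
          _ ≤ _ := by gcongr
      have := (norm_sub_le _ _).trans (add_le_add e1 e2)
      calc _ ≤ (r * (1 / 4 * |A|) + r * (1 / 4 * |A| + |R + ‖p‖| * |B|)) * (1 / 2) :=
            mul_le_mul_of_nonneg_right this (by norm_num)
        _ ≤ (r * (1 / 2 * |A|) + r * (1 / 4 * |A| + 1 / 4 * |A| + |R + ‖p‖| * |B|)) * (1 / 2) := by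
            have : 0 ≤ r * |A| := by positivity
            linarith
        _ = _ := by ring
    have hsum : ‖a‖ + ‖b‖ ≤ (|A| + |R + ‖p‖| * |B|) * r := by linarith
    intro j
    refine le_trans ?_ hsum
    fin_cases j
    · simp only [Fin.zero_eta, hW.partialDeriv_zero]
      exact norm_add_le _ _
    · simp only [Fin.mk_one, hW.partialDeriv_one, norm_mul, norm_I, one_mul]
      exact norm_sub_le _ _

/-! ### Polynomial approximation of the square root -/

/-- T is the Taylor polynomial of (1 - X)^{1/2}, built one coefficient at a time. Since T(0) = 1,
the new coefficient c only has to solve Q(0) + 2c = 0. -/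
lemma exists_polynomial_sq_sub (n : ℕ) : ∃ T Q : Polynomial ℝ, T.eval 0 = 1 ∧ T.natDegree ≤ n ∧
    T ^ 2 - (1 - Polynomial.X) = Polynomial.X ^ (n + 1) * Q := by
  induction n with
  | zero => exact ⟨1, 1, by simp, by simp, by ring⟩
  | succ n ih =>
    obtain ⟨T, Q, hT, hd, h⟩ := ih
    set c : ℝ := -Q.eval 0 / 2
    have hdvd : Polynomial.X ∣ Q + 2 * Polynomial.C c * T +
        Polynomial.C c ^ 2 * Polynomial.X ^ (n + 1) := by
      rw [Polynomial.X_dvd_iff, Polynomial.coeff_zero_eq_eval_zero]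
      simp [hT, c]; ring
    obtain ⟨Q', hQ'⟩ := hdvd
    refine ⟨T + Polynomial.C c * Polynomial.X ^ (n + 1), Q', by simp [hT], ?_, ?_⟩
    · refine (Polynomial.natDegree_add_le _ _).trans (max_le (by omega) ?_)
      exact Polynomial.natDegree_C_mul_X_pow_le _ _
    · calc _ = T ^ 2 - (1 - Polynomial.X) + Polynomial.X ^ (n + 1) *
            (2 * Polynomial.C c * T + Polynomial.C c ^ 2 * Polynomial.X ^ (n + 1)) := by ring
        _ = Polynomial.X ^ (n + 1) * (Q + 2 * Polynomial.C c * T +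
            Polynomial.C c ^ 2 * Polynomial.X ^ (n + 1)) := by rw [h]; ring
        _ = _ := by rw [hQ']; ring

/-- The root v is specified by its square and the sign of its real part, so no branch has to be
fixed. For small s, T(s) is close to 1, so v + T(s) has real part at least 1/2 and can be divided
out of (v - T)(v + T) = -s^{n+1} Q. For the other s a crude bound suffices. -/
lemma exists_polynomial_sqrt_approx (n : ℕ) : ∃ (T : Polynomial ℝ) (C : ℝ), T.natDegree ≤ n ∧
    ∀ s v : ℂ, ‖s‖ ≤ 1 → v ^ 2 = 1 - s → 0 ≤ v.re →
      ‖v - Polynomial.aeval s T‖ ≤ C * ‖s‖ ^ (n + 1) := by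
  obtain ⟨T, Q, hT, hd, h⟩ := exists_polynomial_sq_sub n
  have hcont : ∀ P : Polynomial ℝ, Continuous fun s : ℂ => Polynomial.aeval s P :=
    fun P => P.continuous_aeval
  obtain ⟨A, hA⟩ := (isCompact_closedBall (0 : ℂ) 1).exists_bound_of_continuousOn
    (hcont T).continuousOn
  obtain ⟨B, hB⟩ := (isCompact_closedBall (0 : ℂ) 1).exists_bound_of_continuousOn
    (hcont Q).continuousOn
  have hA0 : 0 ≤ A := (norm_nonneg _).trans (hA 0 (by simp))
  have hB0 : 0 ≤ B := (norm_nonneg _).trans (hB 0 (by simp))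
  have hT0 : Polynomial.aeval (0 : ℂ) T = 1 := by
    rw [← Polynomial.coeff_zero_eq_aeval_zero', Polynomial.coeff_zero_eq_eval_zero, hT]; simp
  obtain ⟨δ, hδ, hδT⟩ := Metric.continuousAt_iff.1 ((hcont T).continuousAt (x := (0 : ℂ)))
    (1 / 2)
    (by norm_num)
  -- The first summand serves |s| < δ, the second |s| ≥ δ, where |v| ≤ 2 and |T(s)| ≤ A.
  refine ⟨T, 2 * B + (2 + A) / δ ^ (n + 1), hd, fun s v hs hv hre => ?_⟩
  have hs' : s ∈ Metric.closedBall (0 : ℂ) 1 := by simpa using hs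
  rw [add_mul]
  by_cases hsd : ‖s‖ < δ
  · have h1 : ‖Polynomial.aeval s T - 1‖ < 1 / 2 := by
      have := hδT (x := s) (by simpa using hsd)
      rwa [dist_eq_norm, hT0] at this
    have h2 : 1 / 2 ≤ ‖v + Polynomial.aeval s T‖ := by
      refine le_trans ?_ (re_le_norm _)
      have h3 := (abs_le.1 ((abs_re_le_norm _).trans h1.le)).1
      simp only [sub_re, one_re, add_re] at h3 ⊢
      linarith
    have h4 : (v - Polynomial.aeval s T) * (v + Polynomial.aeval s T) =
        -(s ^ (n + 1) * Polynomial.aeval s Q) := by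
      have h5 := congrArg (Polynomial.aeval s) h
      simp only [map_sub, map_pow, map_one, Polynomial.aeval_X, map_mul] at h5
      linear_combination hv - h5
    have h6 : ‖v - Polynomial.aeval s T‖ * ‖v + Polynomial.aeval s T‖ ≤ ‖s‖ ^ (n + 1) * B := by
      rw [← norm_mul, h4, norm_neg, norm_mul, norm_pow]
      gcongr
      exact hB s hs'
    have h7 : ‖v - Polynomial.aeval s T‖ * (1 / 2) ≤ ‖s‖ ^ (n + 1) * B :=
      (by gcongr : _ ≤ _).trans h6
    have : 0 ≤ (2 + A) / δ ^ (n + 1) * ‖s‖ ^ (n + 1) := by positivity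
    linarith
  · have hvn : ‖v‖ ≤ 2 := by
      have : ‖v‖ ^ 2 ≤ 2 := by
        rw [← norm_pow, hv]
        refine (norm_sub_le _ _).trans ?_
        rw [norm_one]; linarith
      nlinarith [norm_nonneg v]
    have h1 : ‖v - Polynomial.aeval s T‖ ≤ 2 + A :=
      (norm_sub_le _ _).trans (add_le_add hvn (hA s hs'))
    have h2 : 1 ≤ ‖s‖ ^ (n + 1) / δ ^ (n + 1) := by
      rw [← div_pow]
      exact one_le_pow₀ ((one_le_div hδ).2 (not_lt.1 hsd))
    calc _ ≤ (2 + A) * 1 := by rw [mul_one]; exact h1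
      _ ≤ (2 + A) * (‖s‖ ^ (n + 1) / δ ^ (n + 1)) := by gcongr
      _ = (2 + A) / δ ^ (n + 1) * ‖s‖ ^ (n + 1) := by ring
      _ ≤ _ := le_add_of_nonneg_left (by positivity)

/-- The operator is diagonal on monomials, with eigenvalue m + 1/2 ≠ 0 on X^m. -/
lemma exists_polynomial_half_add_X_mul_derivative (S : Polynomial ℝ) :
    ∃ q : Polynomial ℝ, Polynomial.C (1 / 2) * q + Polynomial.X * q.derivative = S := by
  induction S using Polynomial.induction_on' with
  | add S T hS hT =>
    obtain ⟨q, rfl⟩ := hS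
    obtain ⟨r, rfl⟩ := hT
    exact ⟨q + r, by rw [Polynomial.derivative_add]; ring⟩
  | monomial m a =>
    refine ⟨Polynomial.monomial m (a / (m + 1 / 2)), ?_⟩
    have hX : Polynomial.X * (Polynomial.monomial m (a / (m + 1 / 2))).derivative =
        Polynomial.monomial m (a / (m + 1 / 2) * m) := by
      cases m with
      | zero => simp
      | succ m => simp [Polynomial.X_mul_monomial]
    rw [Polynomial.C_mul_monomial, hX, ← map_add]
    congr 1
    have : (m : ℝ) + 1 / 2 ≠ 0 := by positivity
    field_simp
    ring

/-- There is a real polynomial `q` such that `q/2 + (y-1) q'` at `y - 1` approximates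
`(n + 1/2) y^n (1 - 1/y)^{1/2}` up to `O(1/y)`. -/
lemma exists_profilePoly (n : ℕ) : ∃ q : Polynomial ℝ, ∃ C : ℝ, ∀ y v : ℂ, 1 ≤ ‖y‖ →
    v ^ 2 = 1 - 1 / y → 0 ≤ v.re →
    ‖(2 * n + 1) / 2 * y ^ n * v - (Polynomial.aeval (y - 1) q / 2 +
      (y - 1) * Polynomial.aeval (y - 1) q.derivative)‖ ≤ C / ‖y‖ := by
  obtain ⟨T, C, hd, hT⟩ := exists_polynomial_sqrt_approx n
  -- Since deg T ≤ n, y^n T(1/y) is a polynomial, the reflection of T. Composition with X + 1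
  -- rewrites it in the variable y - 1.
  obtain ⟨q, hq⟩ := exists_polynomial_half_add_X_mul_derivative
    (Polynomial.C ((2 * n + 1) / 2 : ℝ) * (T.reflect n).comp (Polynomial.X + 1))
  refine ⟨q, (2 * n + 1) / 2 * C, fun y v hy hv hre => ?_⟩
  have hy0 : y ≠ 0 := norm_pos_iff.1 (one_pos.trans_le hy)
  have hyn : 0 < ‖y‖ := one_pos.trans_le hy
  have h1 := congrArg (Polynomial.aeval (y - 1)) hq
  simp only [map_add, map_mul, Polynomial.aeval_C, Polynomial.aeval_X, Polynomial.aeval_comp,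
    map_one, sub_add_cancel] at h1
  let _ : Invertible y⁻¹ := invertibleOfNonzero (inv_ne_zero hy0)
  have h2 : Polynomial.aeval y (T.reflect n) = y ^ n * Polynomial.aeval (y⁻¹) T := by
    have h3 := Polynomial.eval₂_reflect_mul_pow (algebraMap ℝ ℂ) (y⁻¹) n T hd
    rw [invOf_eq_inv, inv_inv] at h3
    rw [Polynomial.aeval_def, Polynomial.aeval_def, ← h3, inv_pow]
    field_simp
  have h4 : Polynomial.aeval (y - 1) q / 2 + (y - 1) * Polynomial.aeval (y - 1) q.derivative =
      (2 * n + 1) / 2 * y ^ n * Polynomial.aeval (y⁻¹) T := by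
    rw [h2] at h1
    simp only [coe_algebraMap] at h1
    push_cast at h1
    linear_combination h1
  rw [h4, ← mul_sub, norm_mul, norm_mul, norm_pow]
  have h5 := hT y⁻¹ v (by rw [norm_inv]; exact inv_le_one_of_one_le₀ hy) (by rw [hv, one_div]) hre
  have h6 : ‖((2 * n + 1) / 2 : ℂ)‖ = (2 * n + 1) / 2 := by
    rw [show ((2 * n + 1) / 2 : ℂ) = (((2 * n + 1) / 2 : ℝ) : ℂ) by push_cast; rfl, norm_real,
      Real.norm_of_nonneg (by positivity)]
  rw [h6]
  calc _ ≤ (2 * n + 1) / 2 * ‖y‖ ^ n * (C * ‖y⁻¹‖ ^ (n + 1)) := by gcongr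
    _ = _ := by rw [norm_inv, inv_pow]; field_simp; ring

/-! ### Angles and branches of the square root -/

lemma norm_mul_exp_angle (a : ℝ) (z : ℂ) : (‖z‖ : ℂ) * exp (angle a z * I) = z := by
  have h : angle a z = arg z - toIcoDiv Real.two_pi_pos a (arg z) * (2 * Real.pi) := by
    rw [angle, toIcoMod, zsmul_eq_mul]
  have h2 : ((angle a z : ℝ) : ℂ) * I = arg z * I -
      (toIcoDiv Real.two_pi_pos a (arg z)) * (2 * Real.pi * I) := by
    rw [h]; push_cast; ring
  rw [h2, exp_periodic.sub_int_mul_eq, norm_mul_exp_arg_mul_I]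

lemma angle_mem (a : ℝ) (z : ℂ) : angle a z ∈ Set.Ico a (a + 2 * Real.pi) :=
  toIcoMod_mem_Ico _ _ _

lemma exists_int_of_exp_eq {s t : ℝ} (h : exp (s * I) = exp (t * I)) :
    ∃ m : ℤ, s = t + m * (2 * Real.pi) := by
  obtain ⟨m, hm⟩ := exp_eq_exp_iff_exists_int.1 h
  refine ⟨m, ?_⟩
  have h2 : ((s : ℂ)) * I = ((t + m * (2 * Real.pi) : ℝ) : ℂ) * I := by
    rw [hm]; push_cast; ring
  exact_mod_cast mul_right_cancel₀ I_ne_zero h2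

lemma angle_eq {a t r : ℝ} {z : ℂ} (hr : 0 < r) (hz : z = r * exp (t * I))
    (ht : t ∈ Set.Ico a (a + 2 * Real.pi)) : angle a z = t := by
  have hn : ‖z‖ = r := by
    rw [hz, norm_mul, norm_exp_ofReal_mul_I, norm_real, Real.norm_of_nonneg hr.le, mul_one]
  have h1 := norm_mul_exp_angle a z
  rw [hn] at h1
  have h2 : exp (angle a z * I) = exp (t * I) :=
    mul_left_cancel₀ (ofReal_ne_zero.2 hr.ne') (h1.trans hz)
  obtain ⟨m, hm⟩ := exists_int_of_exp_eq h2
  have h3 := angle_mem a z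
  have hpi := Real.pi_pos
  have hm0 : m = 0 := by
    have h4 : (m : ℝ) < 1 := by
      by_contra! h
      nlinarith [h3.2, ht.1]
    have h5 : (-1 : ℝ) < m := by
      by_contra! h
      nlinarith [h3.1, ht.2]
    have h6 : m < 1 := by exact_mod_cast h4
    have h7 : -1 < m := by exact_mod_cast h5
    omega
  rw [hm, hm0]; simp

/-- The branch of the square root on the plane cut along the ray of angle `a`. -/
noncomputable def sqrtBranch (a : ℝ) (z : ℂ) : ℂ :=
  (‖z‖ ^ (1 / 2 : ℝ) : ℝ) * exp (I / 2 * angle a z)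

lemma sqrtBranch_sq (a : ℝ) (z : ℂ) : sqrtBranch a z ^ 2 = z := by
  rw [sqrtBranch, mul_pow, ← ofReal_pow, ← Real.rpow_natCast, ← Real.rpow_mul (norm_nonneg _),
    ← exp_nat_mul]
  nth_rewrite 3 [← norm_mul_exp_angle a z]
  norm_num
  left
  congr 1
  ring

lemma sqrtBranch_ne_zero (a : ℝ) {z : ℂ} (hz : z ≠ 0) : sqrtBranch a z ≠ 0 := by
  intro h
  apply hz
  rw [← sqrtBranch_sq a z, h]
  simp

/-- Rotation by -(a + π) moves the cut, the ray of angle a, to the negative real axis, which is the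
cut of `arg`. -/
lemma angle_eq_add_arg {a : ℝ} {z : ℂ} (hz : exp (-((a + Real.pi : ℝ) : ℂ) * I) * z ∈ slitPlane) :
    angle a z = a + Real.pi + arg (exp (-((a + Real.pi : ℝ) : ℂ) * I) * z) := by
  set y := exp (-((a + Real.pi : ℝ) : ℂ) * I) * z with hy
  have hy0 : y ≠ 0 := slitPlane_ne_zero hz
  refine angle_eq (r := ‖y‖) (norm_pos_iff.2 hy0) ?_ ?_
  · rw [ofReal_add, add_mul, exp_add, mul_left_comm, norm_mul_exp_arg_mul_I, hy, ← mul_assoc,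
      ← exp_add, neg_mul, add_neg_cancel, exp_zero, one_mul]
  · have h1 := neg_pi_lt_arg y
    have h2 := (arg_le_pi y).lt_of_ne (mem_slitPlane_iff_arg.1 hz).1
    constructor <;> linarith

lemma exists_hasDerivAt_sqrtBranch {a : ℝ} {z : ℂ}
    (hz : exp (-((a + Real.pi : ℝ) : ℂ) * I) * z ∈ slitPlane) :
    HasDerivAt (sqrtBranch a) (1 / (2 * sqrtBranch a z)) z := by
  set c := exp (-((a + Real.pi : ℝ) : ℂ) * I) with hc
  have hev : sqrtBranch a =ᶠ[𝓝 z]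
      fun y => exp (I / 2 * ((a + Real.pi : ℝ) : ℂ)) * (c * y) ^ (1 / 2 : ℂ) := by
    have h1 : ∀ᶠ y in 𝓝 z, c * y ∈ slitPlane :=
      (continuous_const.mul continuous_id).continuousAt.eventually_mem
        (isOpen_slitPlane.mem_nhds hz)
    filter_upwards [h1] with y hy
    have hcn : ‖c‖ = 1 := by rw [hc, ← ofReal_neg, norm_exp_ofReal_mul_I]
    have hyn : ‖c * y‖ = ‖y‖ := by rw [norm_mul, hcn, one_mul]
    have hn : 0 < ‖y‖ := hyn ▸ norm_pos_iff.2 (slitPlane_ne_zero hy)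
    have hang := angle_eq_add_arg hy
    rw [← hc] at hang
    rw [sqrtBranch, hang, cpow_def_of_ne_zero (slitPlane_ne_zero hy), log,
      hyn, Real.rpow_def_of_pos hn, ofReal_exp, ← exp_add, ← exp_add]
    congr 1
    push_cast
    ring
  have hd : DifferentiableAt ℂ (sqrtBranch a) z := by
    refine DifferentiableAt.congr_of_eventuallyEq ?_ hev
    exact (((differentiableAt_id.const_mul c).cpow_const hz)).const_mul _
  have hz0 : z ≠ 0 := fun h => slitPlane_ne_zero hz (by rw [h, mul_zero])
  have hs := sqrtBranch_ne_zero a hz0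
  -- The value of the derivative is read off from the square being the identity.
  have h2 := hd.hasDerivAt.pow 2
  have h3 : HasDerivAt (sqrtBranch a ^ 2) 1 z := by
    have : sqrtBranch a ^ 2 = id := funext fun y => sqrtBranch_sq a y
    rw [this]; exact hasDerivAt_id z
  have h4 := h2.unique h3
  have h5 : deriv (sqrtBranch a) z = 1 / (2 * sqrtBranch a z) := by
    rw [eq_div_iff (by simpa using hs)]
    simp at h4
    linear_combination h4
  rw [← h5]
  exact hd.hasDerivAt

/-- The cut a is arbitrary: another branch changes the sign of both factors. This is why `twistedIm`
is single-valued and smooth across any cut where g is. -/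
lemma twistedIm_eq_exp_mul_im (a : ℝ) {p x : ℂ} (hx : x ≠ p) (g : ℂ → ℂ) :
    twistedIm p g x = exp (I / 2 * angle a (x - p)) * ((sqrtBranch a (x - p) * g x).im : ℝ) := by
  have hz : x - p ≠ 0 := sub_ne_zero.2 hx
  have hn : (‖x - p‖ : ℂ) ≠ 0 := by simpa using hz
  set E := exp (I / 2 * angle a (x - p)) with hE
  have hEE : E * conj E = 1 := by
    rw [mul_conj, hE, normSq_eq_norm_sq, show I / 2 * (angle a (x - p) : ℂ) =
      ((angle a (x - p) / 2 : ℝ) : ℂ) * I by push_cast; ring, norm_exp_ofReal_mul_I]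
    simp
  have hr := norm_rpow_half_eq hz
  have hsq := sqrtBranch_sq a (x - p)
  have hrr : ((‖x - p‖ ^ (-(1 / 2) : ℝ) : ℝ) : ℂ) * ((‖x - p‖ ^ (1 / 2 : ℝ) : ℝ) : ℂ) = 1 := by
    rw [← ofReal_mul, ← Real.rpow_add (norm_pos_iff.2 hz)]; norm_num
  rw [im_eq_sub_conj, map_mul, sqrtBranch, twistedIm]
  rw [sqrtBranch, ← hE] at hsq
  rw [← hE, map_mul, conj_ofReal]
  set s := ((‖x - p‖ ^ (1 / 2 : ℝ) : ℝ) : ℂ)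
  set t := ((‖x - p‖ ^ (-(1 / 2) : ℝ) : ℝ) : ℂ)
  nth_rewrite 1 [← hsq]
  have hI : ∀ z : ℂ, z / (2 * I) = z * (-I / 2) := fun z => by
    field_simp
    linear_combination z * I_sq
  rw [hI]
  linear_combination (g x * E ^ 2 * s * (-I / 2)) * hrr + (s * conj (g x) * (-I / 2)) * hEE

/-! ### The explicit limit profile -/

/-- The real polynomial of `exists_profilePoly`. -/
noncomputable def profilePoly (n : ℕ) : Polynomial ℝ := (exists_profilePoly n).choose

/-- The entire function `x ↦ p^n q(x/p - 1)` (for `|p| = 1`). -/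
noncomputable def profileFun (n : ℕ) (p x : ℂ) : ℂ :=
  p ^ n * Polynomial.aeval (conj p * x - 1) (profilePoly n)

lemma hasDerivAt_profileFun (n : ℕ) (p x : ℂ) : HasDerivAt (profileFun n p)
    (p ^ n * (Polynomial.aeval (conj p * x - 1) (profilePoly n).derivative * conj p)) x := by
  have h1 : HasDerivAt (fun x => conj p * x - 1) (conj p) x := by
    simpa using ((hasDerivAt_id x).const_mul (conj p)).sub_const 1
  exact (((profilePoly n).hasDerivAt_aeval (conj p * x - 1)).comp x h1).const_mul (p ^ n)

lemma differentiable_profileFun (n : ℕ) (p : ℂ) : Differentiable ℂ (profileFun n p) :=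
  fun x => (hasDerivAt_profileFun n p x).differentiableAt

/-- `e^{it/2} sin(kt/2)`. -/
noncomputable def spinSin (k : ℕ) (t : ℝ) : ℂ :=
  exp (I / 2 * t) * (Real.sin ((k : ℝ) / 2 * t) : ℝ)

/-- Each factor is multiplied by (-1)^m, the sine because k is odd. -/
lemma spinSin_add_int_mul {k : ℕ} (hk : Odd k) (t : ℝ) (m : ℤ) :
    spinSin k (t + m * (2 * Real.pi)) = spinSin k t := by
  have h1 : (k : ℝ) / 2 * (t + m * (2 * Real.pi)) = (k : ℝ) / 2 * t + ((k * m : ℤ) : ℝ) * Real.pi := by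
    push_cast; ring
  have h2 : exp (I / 2 * ((t + m * (2 * Real.pi) : ℝ) : ℂ)) = exp (I / 2 * t) * (-1) ^ m := by
    rw [← exp_pi_mul_I, ← exp_int_mul, ← exp_add]
    congr 1; push_cast; ring
  have h3 : ((-1 : ℝ)) ^ ((k : ℤ) * m) = (-1) ^ m := by
    rw [zpow_mul, zpow_natCast, hk.neg_one_pow]
  have h4 : ((-1 : ℂ)) ^ m * (-1) ^ m = 1 := by
    rw [← mul_zpow]; simp
  rw [spinSin, spinSin, h1, Real.sin_add_int_mul_pi, h2, h3]
  push_cast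
  linear_combination (exp (I / 2 * t) * sin (k / 2 * t)) * h4

lemma exists_int_angle_eq (a b : ℝ) (z : ℂ) :
    ∃ m : ℤ, angle a z = angle b z + m * (2 * Real.pi) := by
  refine ⟨toIcoDiv Real.two_pi_pos b (arg z) - toIcoDiv Real.two_pi_pos a (arg z), ?_⟩
  simp only [angle, toIcoMod, zsmul_eq_mul]
  push_cast; ring

/-- As e^{iθ_0/2} sin(kθ_0/2) does not depend on the choice of angle, θ_0 may be replaced by θ_0^p,
whose phase then cancels. -/
lemma asymptote_eq {k : ℕ} (hk : Odd k) (p x : ℂ) :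
    asymptote k p x = exp (I / 2 * (thetaPole p x : ℂ)) *
      ((‖x‖ ^ ((k : ℝ) / 2) * Real.sin ((k : ℝ) / 2 * thetaOrigin p x) : ℝ) : ℂ) := by
  obtain ⟨m, hm⟩ := exists_int_angle_eq (angle 0 p) 0 x
  have h1 : spinSin k (thetaOrigin p x) = spinSin k (thetaZero x) := by
    rw [thetaOrigin, hm, spinSin_add_int_mul hk, thetaZero]
  rw [spinSin, spinSin] at h1
  have h2 : exp (I / 2 * ((thetaPole p x - thetaOrigin p x : ℝ) : ℂ)) *
      exp (I / 2 * (thetaOrigin p x : ℂ)) = exp (I / 2 * (thetaPole p x : ℂ)) := by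
    rw [← exp_add]; congr 1; push_cast; ring
  rw [asymptote, psi, mul_assoc, ofReal_mul, mul_left_comm (exp (I / 2 * (thetaZero x : ℂ))), ← h1,
    ← h2, ofReal_mul]
  ring

lemma sqrtBranch_pow_im (a : ℝ) (z : ℂ) (k : ℕ) :
    (sqrtBranch a z ^ k).im = ‖z‖ ^ ((k : ℝ) / 2) * Real.sin ((k : ℝ) / 2 * angle a z) := by
  have h : sqrtBranch a z ^ k =
      ((‖z‖ ^ ((k : ℝ) / 2) : ℝ) : ℂ) * exp ((((k : ℝ) / 2 * angle a z : ℝ) : ℂ) * I) := by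
    rw [sqrtBranch, mul_pow, ← exp_nat_mul, ← ofReal_pow, ← Real.rpow_natCast,
      ← Real.rpow_mul (norm_nonneg _)]
    congr 1
    · congr 2; ring
    · congr 1; push_cast; ring
  rw [h, im_ofReal_mul, exp_ofReal_mul_I_im]

/-- The function `g` for which the asymptote is `e^{iθ_p/2} Im (w g)`, `w = (x-p)^{1/2}`. -/
noncomputable def asymptoteFun (k : ℕ) (p x : ℂ) : ℂ :=
  sqrtBranch (angle 0 p) x ^ k / sqrtBranch (angle 0 p) (x - p)

lemma asymptote_eq_twistedIm {k : ℕ} (hk : Odd k) {p x : ℂ} (hx : x ≠ p) :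
    asymptote k p x = twistedIm p (asymptoteFun k p) x := by
  rw [twistedIm_eq_exp_mul_im (angle 0 p) hx, asymptote_eq hk, asymptoteFun,
    mul_div_cancel₀ _ (sqrtBranch_ne_zero _ (sub_ne_zero.2 hx)), sqrtBranch_pow_im]
  rfl

/-! ### Comparison of the profile with the asymptote off the line through 0 and p -/

section OffRay

variable {p x : ℂ}

lemma exp_angle_of_norm_one (hp : ‖p‖ = 1) : exp ((angle 0 p : ℂ) * I) = p := by
  have := norm_mul_exp_angle 0 p
  rwa [hp, ofReal_one, one_mul] at this

lemma exp_neg_angle_add_pi (hp : ‖p‖ = 1) :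
    exp (-((angle 0 p + Real.pi : ℝ) : ℂ) * I) = -conj p := by
  have h1 : conj p = exp (-((angle 0 p : ℝ) : ℂ) * I) := by
    conv_lhs => rw [← exp_angle_of_norm_one hp, ← exp_conj]
    simp
  rw [h1, show -((angle 0 p + Real.pi : ℝ) : ℂ) * I =
    -((angle 0 p : ℝ) : ℂ) * I + -(Real.pi * I) by push_cast; ring, exp_add, exp_neg (Real.pi * I),
    exp_pi_mul_I]
  norm_num

lemma conj_mul_self_of_norm_one (hp : ‖p‖ = 1) : conj p * p = 1 := by
  rw [mul_comm, mul_conj, normSq_eq_norm_sq, hp]; simp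

/-- In the rotated coordinate (conj p) x, subtracting p means subtracting 1, which keeps the
imaginary part. The branches are cut only along half-lines, but excluding the whole line costs just
a null set. -/
lemma mem_slitPlane_of_im_ne_zero (hp : ‖p‖ = 1) (hx : (conj p * x).im ≠ 0) :
    exp (-((angle 0 p + Real.pi : ℝ) : ℂ) * I) * x ∈ slitPlane ∧
    exp (-((angle 0 p + Real.pi : ℝ) : ℂ) * I) * (x - p) ∈ slitPlane := by
  rw [exp_neg_angle_add_pi hp]
  constructor
  · right; rw [neg_mul, neg_im]; exact neg_ne_zero.2 hx
  · right
    rw [mul_sub, neg_mul, neg_mul, conj_mul_self_of_norm_one hp, sub_im, neg_im, neg_im, one_im,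
      neg_zero, sub_zero]
    exact neg_ne_zero.2 hx

/-- After rotation x and x - p lie on the same side of the real line, so their angles differ by at
most π and the roots by at most π/2. This identifies the quotient as the root of 1 - p/x that
`exists_profilePoly` approximates. -/
lemma re_sqrtBranch_div_nonneg (hp : ‖p‖ = 1) (hx : (conj p * x).im ≠ 0) :
    0 ≤ (sqrtBranch (angle 0 p) (x - p) / sqrtBranch (angle 0 p) x).re := by
  obtain ⟨h1, h2⟩ := mem_slitPlane_of_im_ne_zero hp hx
  have e1 := angle_eq_add_arg h1
  have e2 := angle_eq_add_arg h2
  have him : (exp (-((angle 0 p + Real.pi : ℝ) : ℂ) * I) * (x - p)).im =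
      (exp (-((angle 0 p + Real.pi : ℝ) : ℂ) * I) * x).im := by
    rw [exp_neg_angle_add_pi hp, mul_sub, neg_mul, neg_mul, conj_mul_self_of_norm_one hp, sub_im,
      neg_im, neg_im, one_im]
    simp
  set y := exp (-((angle 0 p + Real.pi : ℝ) : ℂ) * I) * x
  set z := exp (-((angle 0 p + Real.pi : ℝ) : ℂ) * I) * (x - p)
  have hle : |(angle (angle 0 p) (x - p) - angle (angle 0 p) x) / 2| ≤ Real.pi / 2 := by
    rw [e1, e2, abs_le]
    rcases le_or_gt 0 y.im with h | h
    · have a1 := arg_nonneg_iff.2 h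
      have a2 := arg_nonneg_iff.2 (him ▸ h)
      have a3 := arg_le_pi y
      have a4 := arg_le_pi z
      constructor <;> linarith
    · have a1 := arg_neg_iff.2 h
      have a2 := arg_neg_iff.2 (him ▸ h)
      have a3 := neg_pi_lt_arg y
      have a4 := neg_pi_lt_arg z
      constructor <;> linarith
  have e : sqrtBranch (angle 0 p) (x - p) / sqrtBranch (angle 0 p) x =
      ((‖x - p‖ ^ (1 / 2 : ℝ) / ‖x‖ ^ (1 / 2 : ℝ) : ℝ) : ℂ) *
        exp (((angle (angle 0 p) (x - p) - angle (angle 0 p) x) / 2 : ℝ) * I) := by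
    rw [sqrtBranch, sqrtBranch, mul_div_mul_comm, ← exp_sub, ofReal_div]
    congr 2
    push_cast; ring
  rw [e, re_ofReal_mul, exp_ofReal_mul_I_re]
  have := abs_le.1 hle
  exact mul_nonneg (by positivity) (Real.cos_nonneg_of_mem_Icc ⟨by linarith [this.1], this.2⟩)

/-- With Z² = x, w² = x - p and w g = Z^{2n+1}, the left side is w (w g)' = w (n + 1/2) Z^{2n-1} =
(n + 1/2) x^n w/Z. -/
lemma asymptoteFun_spec {n : ℕ} (hp : ‖p‖ = 1) (hx : (conj p * x).im ≠ 0) :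
    ∃ h', HasDerivAt (asymptoteFun (2 * n + 1) p) h' x ∧
      asymptoteFun (2 * n + 1) p x / 2 + (x - p) * h' = (2 * n + 1) / 2 * x ^ n *
        (sqrtBranch (angle 0 p) (x - p) / sqrtBranch (angle 0 p) x) := by
  obtain ⟨h1, h2⟩ := mem_slitPlane_of_im_ne_zero hp hx
  have hx0 : x ≠ 0 := fun h => hx (by simp [h])
  have hxp : x - p ≠ 0 := fun h => slitPlane_ne_zero h2 (by rw [h, mul_zero])
  have d1 := exists_hasDerivAt_sqrtBranch h1
  have d2 : HasDerivAt (fun y => sqrtBranch (angle 0 p) (y - p))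
      (1 / (2 * sqrtBranch (angle 0 p) (x - p))) x := by
    have h3 : HasDerivAt (fun y => y - p) 1 x := (hasDerivAt_id x).sub_const p
    have h4 := (exists_hasDerivAt_sqrtBranch h2).comp x h3
    rw [mul_one] at h4
    exact h4
  have n1 := sqrtBranch_ne_zero (angle 0 p) hx0
  have n2 := sqrtBranch_ne_zero (angle 0 p) hxp
  have s1 := sqrtBranch_sq (angle 0 p) x
  have s2 := sqrtBranch_sq (angle 0 p) (x - p)
  refine ⟨_, (d1.pow (2 * n + 1)).div d2 n2, ?_⟩
  simp only [asymptoteFun, Pi.pow_apply]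
  generalize sqrtBranch (angle 0 p) x = Z at *
  generalize sqrtBranch (angle 0 p) (x - p) = w at *
  rw [← s2, ← s1, add_tsub_cancel_right]
  field_simp
  push_cast
  ring

lemma magGrad_sub (p : ℂ) (u v : ℂ → ℂ) (G H : Fin 2 → ℂ → ℂ) (j : Fin 2) (x : ℂ) :
    magGrad p (fun y => u y - v y) (fun i y => G i y - H i y) j x =
      magGrad p u G j x - magGrad p v H j x := by
  simp only [magGrad]; ring

/-- The density equals |E - F|²/|x - p|, where E and F are the values of g/2 + (x - p) g' for the
profile and for the asymptote. Up to sign, E - F is p^n times the error in `exists_profilePoly` at y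
= x/p, so C does not depend on p. -/
lemma exists_energy_density_bound (n : ℕ) : ∃ C : ℝ, ∀ p x : ℂ, ‖p‖ = 1 → 1 < ‖x‖ →
    (conj p * x).im ≠ 0 →
    ∑ j, ‖magGrad p (fun y => twistedIm p (profileFun n p) y - asymptote (2 * n + 1) p y)
      (fun i y => partialDeriv i (twistedIm p (profileFun n p)) y -
        partialDeriv i (asymptote (2 * n + 1) p) y) j x‖ ^ 2 ≤
      C ^ 2 / (‖x - p‖ * ‖x‖ ^ 2) := by
  obtain ⟨C, hC⟩ := (exists_profilePoly n).choose_spec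
  refine ⟨C, fun p x hp hx him => ?_⟩
  have hxp : x ≠ p := fun h => by rw [h, hp] at hx; exact lt_irrefl _ hx
  have hz : x - p ≠ 0 := sub_ne_zero.2 hxp
  have hzn : 0 < ‖x - p‖ := norm_pos_iff.2 hz
  have hx0 : x ≠ 0 := norm_pos_iff.1 (one_pos.trans hx)
  have hpp := conj_mul_self_of_norm_one hp
  have hp0 : p ≠ 0 := norm_pos_iff.1 (by rw [hp]; exact one_pos)
  obtain ⟨h', hh, hh2⟩ := asymptoteFun_spec (n := n) hp him
  have hg := hasDerivAt_profileFun n p x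
  have hev : asymptote (2 * n + 1) p =ᶠ[𝓝 x] twistedIm p (asymptoteFun (2 * n + 1) p) := by
    filter_upwards [isOpen_ne.mem_nhds hxp] with y hy
    exact asymptote_eq_twistedIm ⟨n, rfl⟩ hy
  have hpd : ∀ i, partialDeriv i (asymptote (2 * n + 1) p) x =
      partialDeriv i (twistedIm p (asymptoteFun (2 * n + 1) p)) x := fun i => by
    rw [partialDeriv, partialDeriv, hev.fderiv_eq]
  have hmag : ∀ j, magGrad p (fun y => twistedIm p (profileFun n p) y - asymptote (2 * n + 1) p y)
      (fun i y => partialDeriv i (twistedIm p (profileFun n p)) y -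
        partialDeriv i (asymptote (2 * n + 1) p) y) j x =
      magGrad p (twistedIm p (profileFun n p))
        (fun i => partialDeriv i (twistedIm p (profileFun n p))) j x -
      magGrad p (twistedIm p (asymptoteFun (2 * n + 1) p))
        (fun i => partialDeriv i (twistedIm p (asymptoteFun (2 * n + 1) p))) j x := fun j => by
    rw [magGrad_sub p _ _ (fun i => partialDeriv i (twistedIm p (profileFun n p)))
      (fun i => partialDeriv i (asymptote (2 * n + 1) p))]
    congr 1
    simp only [magGrad, hpd, hev.self_of_nhds]
  set v := sqrtBranch (angle 0 p) (x - p) / sqrtBranch (angle 0 p) x with hv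
  set E := profileFun n p x / 2 + (x - p) * (p ^ n *
    (Polynomial.aeval (conj p * x - 1) (profilePoly n).derivative * conj p)) with hE
  set F := asymptoteFun (2 * n + 1) p x / 2 + (x - p) * h' with hF
  have hEF : ‖E - F‖ ≤ C / ‖x‖ := by
    have hyn : ‖conj p * x‖ = ‖x‖ := by rw [norm_mul, RCLike.norm_conj, hp, one_mul]
    have h1 := hC (conj p * x) v (by rw [hyn]; exact hx.le) (by
      rw [hv, div_pow, sqrtBranch_sq, sqrtBranch_sq]
      have : conj p ≠ 0 := (map_ne_zero _).2 hp0
      field_simp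
      linear_combination -hpp) (re_sqrtBranch_div_nonneg hp him)
    rw [hyn] at h1
    have h2 : E - F = -(p ^ n * ((2 * n + 1) / 2 * (conj p * x) ^ n * v -
        (Polynomial.aeval (conj p * x - 1) (profilePoly n) / 2 + (conj p * x - 1) *
          Polynomial.aeval (conj p * x - 1) (profilePoly n).derivative))) := by
      rw [hh2, hE, profileFun]
      have e1 : p ^ n * (conj p * x) ^ n = x ^ n := by
        rw [← mul_pow, ← mul_assoc, mul_comm p, hpp, one_mul]
      linear_combination ((2 * n + 1) / 2 * v) * e1 - p ^ n * Polynomial.aeval (conj p * x - 1)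
        (profilePoly n).derivative * hpp
    rw [h2, norm_neg, norm_mul, norm_pow, hp, one_pow, one_mul]
    exact h1
  have hsum : ∑ j, ‖magGrad p (twistedIm p (profileFun n p))
        (fun i => partialDeriv i (twistedIm p (profileFun n p))) j x -
      magGrad p (twistedIm p (asymptoteFun (2 * n + 1) p))
        (fun i => partialDeriv i (twistedIm p (asymptoteFun (2 * n + 1) p))) j x‖ ^ 2 =
      ‖x - p‖⁻¹ * ‖E - F‖ ^ 2 := by
    have h1 := sum_norm_sq_magGrad p
      (fun y => twistedIm p (profileFun n p) y - twistedIm p (asymptoteFun (2 * n + 1) p) y)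
      (fun i y => partialDeriv i (twistedIm p (profileFun n p)) y -
        partialDeriv i (twistedIm p (asymptoteFun (2 * n + 1) p)) y) x
    simp only [magMinus, magPlus] at h1
    simp_rw [magGrad_sub p _ _ (fun i => partialDeriv i (twistedIm p (profileFun n p)))
      (fun i => partialDeriv i (twistedIm p (asymptoteFun (2 * n + 1) p)))] at h1
    rw [h1]
    have m1 := magMinus_twistedIm hxp hg
    have m2 := magMinus_twistedIm hxp hh
    have p1 := magPlus_twistedIm hxp hg
    have p2 := magPlus_twistedIm hxp hh
    rw [← hE] at m1 p1
    rw [← hF] at m2 p2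
    simp only [magMinus, magPlus] at m1 m2 p1 p2
    rw [show ∀ a b c d : ℂ, a - b - I * (c - d) = (a - I * c) - (b - I * d) from
        fun a b c d => by ring, m1, m2, ← mul_sub,
      show ∀ a b c d : ℂ, a - b + I * (c - d) = (a + I * c) - (b + I * d) from
        fun a b c d => by ring, p1, p2, ← mul_sub, ← map_sub, norm_mul, norm_mul, norm_div, norm_neg,
      norm_real, norm_real, RCLike.norm_conj, RCLike.norm_conj,
      Real.norm_of_nonneg (by positivity), Real.norm_of_nonneg (by positivity), norm_rpow_half_eq hz,
      mul_div_cancel_left₀ _ hzn.ne', mul_pow, ← Real.rpow_natCast, ← Real.rpow_mul (norm_nonneg _)]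
    norm_num [Real.rpow_neg_one]
  simp_rw [hmag]
  rw [hsum]
  calc _ ≤ ‖x - p‖⁻¹ * (C / ‖x‖) ^ 2 := by gcongr
    _ = _ := by field_simp

end OffRay

/-! ### Finite energy at infinity and existence of the limit profile -/

lemma ae_im_conj_mul_ne_zero {p : ℂ} (hp : ‖p‖ = 1) : ∀ᵐ x : ℂ, (conj p * x).im ≠ 0 := by
  let L : ℂ →ₗ[ℝ] ℝ := imLm ∘ₗ LinearMap.mulLeft ℝ (conj p)
  have h : volume ((LinearMap.ker L : Submodule ℝ ℂ) : Set ℂ) = 0 := by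
    refine Measure.addHaar_submodule _ _ fun htop => ?_
    have h1 : p * I ∈ LinearMap.ker L := by rw [htop]; trivial
    rw [LinearMap.mem_ker] at h1
    have h2 : (conj p * (p * I)).im = 0 := h1
    rw [← mul_assoc, conj_mul_self_of_norm_one hp] at h2
    simp at h2
  rw [ae_iff]
  convert! h using 2
  ext x
  simp [L]

lemma lintegral_energy_lt_top (n : ℕ) {p : ℂ} (hp : ‖p‖ = 1) {r : ℝ} (hr : 1 < r) :
    ∫⁻ x in (Metric.ball (0 : ℂ) r)ᶜ,
      ∑ j, ‖magGrad p (fun y => twistedIm p (profileFun n p) y - asymptote (2 * n + 1) p y)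
        (fun i y => partialDeriv i (twistedIm p (profileFun n p)) y -
          partialDeriv i (asymptote (2 * n + 1) p) y) j x‖ₑ ^ 2 < ⊤ := by
  obtain ⟨C, hC⟩ := exists_energy_density_bound n
  have hr0 : 0 < r := one_pos.trans hr
  have hδ : 0 < 1 - 1 / r := by rw [sub_pos, div_lt_one hr0]; exact hr
  -- For |x| ≥ r > 1 = |p| one has |x - p| ≥ (1 - 1/r)|x| and (1 + |x|)³ ≤ 8|x|³. The decay exponent
  -- 3 exceeds the dimension 2.
  set K := C ^ 2 * 8 / (1 - 1 / r) with hK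
  have hint : Integrable (fun x : ℂ => K * (1 + ‖x‖) ^ (-3 : ℝ)) :=
    (integrable_one_add_norm (by simp; norm_num)).const_mul K
  refine lt_of_le_of_lt ?_ hint.lintegral_lt_top
  refine (setLIntegral_mono_ae (g := fun x => ENNReal.ofReal (K * (1 + ‖x‖) ^ (-3 : ℝ)))
    hint.1.aemeasurable.ennreal_ofReal.restrict ?_).trans (setLIntegral_le_lintegral _ _)
  filter_upwards [ae_im_conj_mul_ne_zero hp] with x him hx
  have hxr : r ≤ ‖x‖ := by simpa using hx
  have hx1 : 1 < ‖x‖ := hr.trans_le hxr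
  have e : ∀ z : ℂ, ‖z‖ₑ ^ 2 = ENNReal.ofReal (‖z‖ ^ 2) := fun z => by
    rw [ENNReal.ofReal_pow (norm_nonneg _), ofReal_norm]
  simp_rw [e]
  rw [← ENNReal.ofReal_sum_of_nonneg (fun _ _ => by positivity)]
  refine ENNReal.ofReal_le_ofReal ((hC p x hp hx1 him).trans ?_)
  have h1 : (1 - 1 / r) * ‖x‖ ≤ ‖x - p‖ := by
    have h2 := norm_sub_norm_le x p
    rw [hp] at h2
    have h3 : 1 ≤ 1 / r * ‖x‖ := by
      rw [one_div, inv_mul_eq_div, one_le_div hr0]; exact hxr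
    linarith
  have h4 : (1 + ‖x‖) ^ (-3 : ℝ) = ((1 + ‖x‖) ^ 3)⁻¹ := by
    rw [Real.rpow_neg (by positivity)]; norm_cast
  rw [h4, hK]
  have hxp : 0 < ‖x‖ := by linarith
  have h5 : (1 + ‖x‖) ^ 3 ≤ 8 * ‖x‖ ^ 3 := by
    calc _ ≤ (2 * ‖x‖) ^ 3 := by gcongr; linarith
      _ = _ := by ring
  calc C ^ 2 / (‖x - p‖ * ‖x‖ ^ 2) ≤ C ^ 2 / ((1 - 1 / r) * ‖x‖ * ‖x‖ ^ 2) := by gcongr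
    _ = C ^ 2 * 8 / (1 - 1 / r) * (8 * ‖x‖ ^ 3)⁻¹ := by field_simp
    _ ≤ _ := by gcongr

theorem isLimitProfile_twistedIm (n : ℕ) {p : ℂ} (hp : ‖p‖ = 1) :
    IsLimitProfile (2 * n + 1) p (twistedIm p (profileFun n p)) :=
  ⟨_, memH1Loc_twistedIm p (differentiable_profileFun n p),
    weaklyHarmonic_twistedIm p (differentiable_profileFun n p),
    fun _ hr => lintegral_energy_lt_top n hp hr⟩

lemma continuousOn_twistedIm (p : ℂ) {g : ℂ → ℂ} (hg : Differentiable ℂ g) :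
    ContinuousOn (twistedIm p g) {p}ᶜ := fun x hx =>
  (HasFDerivAt.continuousAt (hasWirtinger_twistedIm hx (hg x).hasDerivAt)).continuousWithinAt

/-! ### The magnetic Hardy inequality -/

/-- Cauchy–Schwarz, by expanding the nonnegative integral of ((b - a) f - S)², where S is the
integral of f. -/
lemma sq_integral_le {f : ℝ → ℝ} (hf : Continuous f) {a b : ℝ} (hab : a ≤ b) :
    (∫ t in a..b, f t) ^ 2 ≤ (b - a) * ∫ t in a..b, f t ^ 2 := by
  set S := ∫ t in a..b, f t
  have h0 : 0 ≤ ∫ t in a..b, ((b - a) * f t - S) ^ 2 :=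
    intervalIntegral.integral_nonneg hab fun _ _ => sq_nonneg _
  have i1 : IntervalIntegrable (fun t => f t ^ 2) volume a b := (hf.pow 2).intervalIntegrable _ _
  have i2 : IntervalIntegrable f volume a b := hf.intervalIntegrable _ _
  have h1 : ∫ t in a..b, ((b - a) * f t - S) ^ 2 =
      (b - a) ^ 2 * (∫ t in a..b, f t ^ 2) - 2 * (b - a) * S * S + (b - a) * S ^ 2 := by
    have e : ∀ t, ((b - a) * f t - S) ^ 2 =
        (b - a) ^ 2 * f t ^ 2 - 2 * (b - a) * S * f t + S ^ 2 := fun t => by ring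
    simp_rw [e]
    rw [intervalIntegral.integral_add ((i1.const_mul _).sub (i2.const_mul _)) (by simp),
      intervalIntegral.integral_sub (i1.const_mul _) (i2.const_mul _),
      intervalIntegral.integral_const_mul, intervalIntegral.integral_const_mul,
      intervalIntegral.integral_const, smul_eq_mul]
  rw [h1] at h0
  rcases hab.eq_or_lt with h | h
  · subst h; simp [S]
  · have : 0 < b - a := sub_pos.2 h
    nlinarith

/-- Antiperiodicity gives 2 g(t) as the integral of g' over (-π, t) minus that over (t, π), hence a
pointwise bound with no mean to subtract. The constant π² is not optimal, but any constant suffices.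
-/
lemma lintegral_sq_le_of_antiperiodic {g g' : ℝ → ℂ} (hg : ∀ t, HasDerivAt g (g' t) t)
    (hg' : Continuous g') (hanti : g Real.pi = -g (-Real.pi)) :
    ∫⁻ t in Set.Ioo (-Real.pi) Real.pi, ‖g t‖ₑ ^ 2 ≤
      ENNReal.ofReal (Real.pi ^ 2) * ∫⁻ t in Set.Ioo (-Real.pi) Real.pi, ‖g' t‖ₑ ^ 2 := by
  have hpi := Real.pi_pos
  have hle : -Real.pi ≤ Real.pi := by linarith
  have e : ∀ z : ℂ, ‖z‖ₑ ^ 2 = ENNReal.ofReal (‖z‖ ^ 2) := fun z => by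
    rw [ENNReal.ofReal_pow (norm_nonneg _), ofReal_norm]
  set S := ∫ t in (-Real.pi)..Real.pi, ‖g' t‖ ^ 2 with hS
  have hS0 : 0 ≤ S := intervalIntegral.integral_nonneg hle fun _ _ => sq_nonneg _
  have hpt : ∀ t ∈ Set.Ioo (-Real.pi) Real.pi, ‖g t‖ ^ 2 ≤ Real.pi / 2 * S := fun t ht => by
    have ii : ∀ a b, IntervalIntegrable g' volume a b := fun a b => hg'.intervalIntegrable _ _
    have ni : ∀ a b, IntervalIntegrable (fun t => ‖g' t‖) volume a b :=
      fun a b => hg'.norm.intervalIntegrable _ _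
    have h1 : ∫ s in (-Real.pi)..t, g' s = g t - g (-Real.pi) :=
      intervalIntegral.integral_eq_sub_of_hasDerivAt (fun s _ => hg s) (ii _ _)
    have h2 : ∫ s in t..Real.pi, g' s = g Real.pi - g t :=
      intervalIntegral.integral_eq_sub_of_hasDerivAt (fun s _ => hg s) (ii _ _)
    have h3 : 2 * g t = (∫ s in (-Real.pi)..t, g' s) - ∫ s in t..Real.pi, g' s := by
      rw [h1, h2, hanti]; ring
    have h4 : 2 * ‖g t‖ ≤ ∫ s in (-Real.pi)..Real.pi, ‖g' s‖ := by
      rw [← intervalIntegral.integral_add_adjacent_intervals (ni (-Real.pi) t) (ni t Real.pi)]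
      calc 2 * ‖g t‖ = ‖2 * g t‖ := by rw [norm_mul]; norm_num
        _ ≤ _ := by
          rw [h3]
          exact (norm_sub_le _ _).trans (add_le_add
            (intervalIntegral.norm_integral_le_integral_norm ht.1.le)
            (intervalIntegral.norm_integral_le_integral_norm ht.2.le))
    have h5 := sq_integral_le hg'.norm hle
    have h6 : (2 * ‖g t‖) ^ 2 ≤ (∫ s in (-Real.pi)..Real.pi, ‖g' s‖) ^ 2 := by gcongr
    rw [← hS] at h5
    linarith
  have hR : ∫⁻ t in Set.Ioo (-Real.pi) Real.pi, ‖g' t‖ₑ ^ 2 = ENNReal.ofReal S := by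
    simp_rw [e]
    rw [hS, intervalIntegral.integral_of_le hle, integral_Ioc_eq_integral_Ioo, ofReal_integral_eq_lintegral_ofReal]
    · exact ((hg'.norm.pow 2).integrableOn_Icc).mono_set Set.Ioo_subset_Icc_self
    · exact Eventually.of_forall fun _ => sq_nonneg _
  rw [hR, ← ENNReal.ofReal_mul (by positivity)]
  calc _ ≤ ∫⁻ t in Set.Ioo (-Real.pi) Real.pi, ENNReal.ofReal (Real.pi / 2 * S) := by
        refine setLIntegral_mono measurable_const fun t ht => ?_
        rw [e]
        exact ENNReal.ofReal_le_ofReal (hpt t ht)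
    _ = ENNReal.ofReal (Real.pi ^ 2 * S) := by
        rw [setLIntegral_const, Real.volume_Ioo, ← ENNReal.ofReal_mul (by positivity)]
        congr 1; ring

lemma measurable_potential (p : ℂ) (j : Fin 2) : Measurable (potential p j) := by
  fin_cases j <;> (unfold potential; simp; fun_prop)

lemma measurable_magGrad (p : ℂ) {v : ℂ → ℂ} (hv : Measurable v) (j : Fin 2) :
    Measurable (magGrad p v (fun i => partialDeriv i v) j) :=
  ((measurable_partialDeriv j v).const_mul I).add
    ((measurable_ofReal.comp (measurable_potential p j)).mul hv)

/-- On a circle around p the function e^{-it/2} v is antiperiodic, and its derivative is, up to a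
unimodular factor, r times the tangential component of (i∇ + A_p) v. -/
lemma lintegral_circle_le {p : ℂ} {v : ℂ → ℂ} (hv : ContDiff ℝ ∞ v) {r : ℝ} (hr : 0 < r) :
    ∫⁻ t in Set.Ioo (-Real.pi) Real.pi,
        (‖v (p + r * exp (t * I)) / (‖(p + r * exp (t * I)) - p‖ : ℂ)‖ₑ ^ 2) ≤
      ENNReal.ofReal (Real.pi ^ 2) * ∫⁻ t in Set.Ioo (-Real.pi) Real.pi,
        ∑ j, ‖magGrad p v (fun i => partialDeriv i v) j (p + r * exp (t * I))‖ₑ ^ 2 := by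
  have hdv : Differentiable ℝ v := hv.differentiable (by simp)
  have hcv : Continuous (fderiv ℝ v) := hv.continuous_fderiv (by simp)
  set X : ℝ → ℂ := fun t => p + r * exp (t * I) with hX
  have hXd : ∀ t : ℝ, HasDerivAt X (r * exp (t * I) * I) t := fun t => by
    have h1 : HasDerivAt (fun s : ℝ => (s : ℂ) * I) I t := by
      simpa using (ofRealCLM.hasDerivAt (x := t)).mul_const I
    rw [mul_assoc]
    exact ((h1.cexp).const_mul (r : ℂ)).const_add p
  have hEd : ∀ t : ℝ, HasDerivAt (fun s : ℝ => exp (-(I / 2) * s)) (exp (-(I / 2) * t) * -(I / 2)) t :=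
    fun t => by
      have h1 : HasDerivAt (fun s : ℝ => -(I / 2) * (s : ℂ)) (-(I / 2)) t := by
        simpa using (ofRealCLM.hasDerivAt (x := t)).const_mul (-(I / 2))
      exact h1.cexp
  have hXc : Continuous X := by fun_prop
  set g : ℝ → ℂ := fun t => exp (-(I / 2) * t) * v (X t) with hg
  set g' : ℝ → ℂ := fun t => exp (-(I / 2) * t) * -(I / 2) * v (X t) +
    exp (-(I / 2) * t) * fderiv ℝ v (X t) (r * exp (t * I) * I) with hg'
  have hgd : ∀ t, HasDerivAt g (g' t) t := fun t =>
    (hEd t).mul ((hdv (X t)).hasFDerivAt.comp_hasDerivAt t (hXd t))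
  have hgc : Continuous g' := by
    have h1 : Continuous fun t => fderiv ℝ v (X t) (r * exp (t * I) * I) :=
      (hcv.comp hXc).clm_apply (by fun_prop)
    have h2 : Continuous fun t => v (X t) := hv.continuous.comp hXc
    fun_prop
  have hanti : g Real.pi = -g (-Real.pi) := by
    have h1 : X (-Real.pi) = X Real.pi := by
      simp [hX, exp_neg]
    have h2 : exp (-(I / 2) * (Real.pi : ℝ)) = -exp (-(I / 2) * ((-Real.pi : ℝ) : ℂ)) := by
      rw [show -(I / 2) * ((-Real.pi : ℝ) : ℂ) = -(I / 2) * (Real.pi : ℝ) + Real.pi * I by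
        push_cast; ring, exp_add, exp_pi_mul_I]
      ring
    simp only [hg]
    rw [h1, h2]; ring
  have hE : ∀ t : ℝ, ‖exp (-(I / 2) * t)‖ = 1 := fun t => by
    rw [show -(I / 2) * (t : ℂ) = ((-t / 2 : ℝ) : ℂ) * I by push_cast; ring, norm_exp_ofReal_mul_I]
  have hle : ∀ t : ℝ, ‖g' t‖ ^ 2 ≤
      r ^ 2 * ∑ j, ‖magGrad p v (fun i => partialDeriv i v) j (X t)‖ ^ 2 := fun t => by
    obtain ⟨a, b, hab⟩ := (hdv (X t)).exists_hasWirtinger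
    have hz : X t - p = r * exp (t * I) := by simp [hX]
    have hz0 : X t - p ≠ 0 := by
      rw [hz]; exact mul_ne_zero (ofReal_ne_zero.2 hr.ne') (exp_ne_zero _)
    have hzn : ‖X t - p‖ = r := by
      rw [hz, norm_mul, norm_exp_ofReal_mul_I, norm_real, Real.norm_of_nonneg hr.le, mul_one]
    rw [sum_norm_sq_magGrad, magMinus_eq hab.partialDeriv_zero hab.partialDeriv_one,
      magPlus_eq hab.partialDeriv_zero hab.partialDeriv_one]
    have h1 : g' t = exp (-(I / 2) * t) * (1 / 2) *
        ((X t - p) * (2 * I * (a - v (X t) / (4 * (X t - p)))) -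
        conj (X t - p) * (2 * I * (b + v (X t) / (4 * conj (X t - p))))) := by
      have hc : conj (X t - p) ≠ 0 := (map_ne_zero _).2 hz0
      simp only [hg', ← hz, hab.fderiv, wirtingerMap_apply, map_mul, conj_I]
      field_simp
      ring
    set m := 2 * I * (a - v (X t) / (4 * (X t - p)))
    set q := 2 * I * (b + v (X t) / (4 * conj (X t - p)))
    have h2 : ‖g' t‖ ≤ 1 / 2 * (r * ‖m‖ + r * ‖q‖) := by
      rw [h1, norm_mul, norm_mul, hE, one_mul]
      have : ‖(X t - p) * m - conj (X t - p) * q‖ ≤ r * ‖m‖ + r * ‖q‖ := by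
        refine (norm_sub_le _ _).trans (le_of_eq ?_)
        rw [norm_mul _ m, norm_mul _ q, RCLike.norm_conj, hzn]
      gcongr
      norm_num
    calc _ ≤ (1 / 2 * (r * ‖m‖ + r * ‖q‖)) ^ 2 := by gcongr
      _ ≤ _ := by nlinarith [mul_nonneg (sq_nonneg r) (sq_nonneg (‖m‖ - ‖q‖))]
  have e : ∀ z : ℂ, ‖z‖ₑ ^ 2 = ENNReal.ofReal (‖z‖ ^ 2) := fun z => by
    rw [ENNReal.ofReal_pow (norm_nonneg _), ofReal_norm]
  have main := lintegral_sq_le_of_antiperiodic hgd hgc hanti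
  have hr2 : ENNReal.ofReal (r ^ 2) ≠ 0 := by
    rw [Ne, ENNReal.ofReal_eq_zero, not_le]; positivity
  rw [← ENNReal.mul_le_mul_iff_right hr2 ENNReal.ofReal_ne_top]
  calc _ = ∫⁻ t in Set.Ioo (-Real.pi) Real.pi, ‖g t‖ₑ ^ 2 := by
        rw [← lintegral_const_mul' _ _ ENNReal.ofReal_ne_top]
        refine lintegral_congr fun t => ?_
        have hzn : ‖X t - p‖ = r := by
          simp only [hX, add_sub_cancel_left]
          rw [norm_mul, norm_exp_ofReal_mul_I, norm_real, Real.norm_of_nonneg hr.le, mul_one]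
        change _ * ‖v (X t) / (‖X t - p‖ : ℂ)‖ₑ ^ 2 = _
        rw [e, e, ← ENNReal.ofReal_mul (by positivity), hzn, hg, norm_div, norm_mul, hE, norm_real,
          Real.norm_of_nonneg hr.le]
        congr 1
        field_simp
    _ ≤ _ := main
    _ ≤ ENNReal.ofReal (Real.pi ^ 2) * (ENNReal.ofReal (r ^ 2) *
        ∫⁻ t in Set.Ioo (-Real.pi) Real.pi,
          ∑ j, ‖magGrad p v (fun i => partialDeriv i v) j (X t)‖ₑ ^ 2) := by
        gcongr
        rw [← lintegral_const_mul' _ _ ENNReal.ofReal_ne_top]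
        refine lintegral_mono fun t => ?_
        simp_rw [e]
        rw [← ENNReal.ofReal_sum_of_nonneg (fun _ _ => by positivity),
          ← ENNReal.ofReal_mul (by positivity)]
        exact ENNReal.ofReal_le_ofReal (hle t)
    _ = _ := by ring

lemma lintegral_eq_lintegral_polar (p : ℂ) {F : ℂ → ENNReal} (hF : Measurable F) :
    ∫⁻ x, F x = ∫⁻ r in Set.Ioi (0 : ℝ), ENNReal.ofReal r *
      ∫⁻ t in Set.Ioo (-Real.pi) Real.pi, F (p + r * exp (t * I)) := by
  rw [← lintegral_add_left_eq_self F p, ← Complex.lintegral_comp_polarCoord_symm,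
    polarCoord_target, Measure.volume_eq_prod, setLIntegral_prod]
  · refine lintegral_congr fun r => ?_
    rw [← lintegral_const_mul' _ _ ENNReal.ofReal_ne_top]
    refine lintegral_congr fun t => ?_
    simp only [Complex.polarCoord_symm_apply, smul_eq_mul, exp_mul_I, ofReal_cos, ofReal_sin]
  · have : Measurable fun z : ℝ × ℝ => ENNReal.ofReal z.1 • F (p + Complex.polarCoord.symm z) := by
      simp only [Complex.polarCoord_symm_apply, smul_eq_mul]
      refine (by fun_prop : Measurable fun z : ℝ × ℝ => ENNReal.ofReal z.1).mul (hF.comp ?_)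
      fun_prop
    exact this.aemeasurable

lemma eLpNorm_two_sq {α : Type*} [MeasurableSpace α] (μ : Measure α) (f : α → ℂ) :
    eLpNorm f 2 μ ^ 2 = ∫⁻ x, ‖f x‖ₑ ^ 2 ∂μ := by
  rw [eLpNorm_eq_lintegral_rpow_enorm_toReal two_ne_zero ENNReal.ofNat_ne_top, ← ENNReal.rpow_natCast,
    ← ENNReal.rpow_mul]
  simp

/-- The magnetic Hardy inequality on annuli around the pole, for smooth functions. -/
lemma hardy_smooth {p : ℂ} {v : ℂ → ℂ} (hv : ContDiff ℝ ∞ v) {J : Set ℝ} (hJ : MeasurableSet J) :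
    eLpNorm (fun x => v x / (‖x - p‖ : ℂ)) 2 (volume.restrict {x | ‖x - p‖ ∈ J}) ≤
      ENNReal.ofReal Real.pi * ∑ j, eLpNorm (magGrad p v (fun i => partialDeriv i v) j) 2
        (volume.restrict {x | ‖x - p‖ ∈ J}) := by
  have hS : MeasurableSet {x : ℂ | ‖x - p‖ ∈ J} :=
    (by fun_prop : Measurable fun x : ℂ => ‖x - p‖) hJ
  set μ := volume.restrict {x : ℂ | ‖x - p‖ ∈ J} with hμ
  have hvm := hv.continuous.measurable
  have key : ∫⁻ x, ‖v x / (‖x - p‖ : ℂ)‖ₑ ^ 2 ∂μ ≤ ENNReal.ofReal (Real.pi ^ 2) *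
      ∫⁻ x, ∑ j, ‖magGrad p v (fun i => partialDeriv i v) j x‖ₑ ^ 2 ∂μ := by
    have m1 : Measurable fun x => ‖v x / (‖x - p‖ : ℂ)‖ₑ ^ 2 := by fun_prop
    have m2 : Measurable fun x => ∑ j, ‖magGrad p v (fun i => partialDeriv i v) j x‖ₑ ^ 2 :=
      Finset.measurable_sum _ fun j _ => (measurable_magGrad p hvm j).enorm.pow_const 2
    rw [hμ, ← lintegral_indicator hS, ← lintegral_indicator hS,
      lintegral_eq_lintegral_polar p (m1.indicator hS),
      lintegral_eq_lintegral_polar p (m2.indicator hS),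
      ← lintegral_const_mul' _ _ ENNReal.ofReal_ne_top]
    -- The inequality holds circle by circle, hence on any union of circles around p.
    refine setLIntegral_mono' measurableSet_Ioi fun r hr => ?_
    have hr : 0 < r := hr
    have hn : ∀ t : ℝ, ‖p + r * exp (t * I) - p‖ = r := fun t => by
      rw [add_sub_cancel_left, norm_mul, norm_exp_ofReal_mul_I, norm_real,
        Real.norm_of_nonneg hr.le, mul_one]
    rw [mul_left_comm]
    gcongr
    by_cases h : r ∈ J
    · have hm : ∀ t : ℝ, p + r * exp (t * I) ∈ {x : ℂ | ‖x - p‖ ∈ J} := fun t => by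
        rw [Set.mem_ofPred_eq, hn]; exact h
      simp only [Set.indicator_of_mem (hm _)]
      exact lintegral_circle_le hv hr
    · have hm : ∀ t : ℝ, p + r * exp (t * I) ∉ {x : ℂ | ‖x - p‖ ∈ J} := fun t => by
        rw [Set.mem_ofPred_eq, hn]; exact h
      simp only [Set.indicator_of_notMem (hm _)]
      simp
  rw [← (ENNReal.pow_right_strictMono two_ne_zero).le_iff_le, eLpNorm_two_sq]
  refine key.trans ?_
  rw [mul_pow, ← ENNReal.ofReal_pow Real.pi_pos.le]
  gcongr
  rw [lintegral_finsetSum _ fun j _ => (measurable_magGrad p hvm j).enorm.pow_const 2]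
  simp_rw [← eLpNorm_two_sq]
  -- A sum of two squares is at most the square of the sum.
  rw [Fin.sum_univ_two, Fin.sum_univ_two, add_sq]
  rw [add_right_comm]
  exact le_self_add

/-! ### Uniqueness -/

/-- Smooth compactly supported functions that vanish near `p`. -/
def IsTest (p : ℂ) (v : ℂ → ℂ) : Prop :=
  ContDiff ℝ ∞ v ∧ HasCompactSupport v ∧ p ∉ tsupport v

/-- `M = (i∇ + A_p) v`. -/
noncomputable abbrev magD (p : ℂ) (v : ℂ → ℂ) (j : Fin 2) (x : ℂ) : ℂ :=
  magGrad p v (fun i => partialDeriv i v) j x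

lemma IsTest.sub {p : ℂ} {v w : ℂ → ℂ} (hv : IsTest p v) (hw : IsTest p w) :
    IsTest p (fun x => v x - w x) := by
  refine ⟨hv.1.sub hw.1, hv.2.1.sub hw.2.1, ?_⟩
  rw [notMem_tsupport_iff_eventuallyEq]
  filter_upwards [notMem_tsupport_iff_eventuallyEq.1 hv.2.2,
    notMem_tsupport_iff_eventuallyEq.1 hw.2.2] with x h1 h2
  simp [h1, h2]

lemma IsTest.cutoff_mul {p : ℂ} {v : ℂ → ℂ} (hv : IsTest p v) (ρ : ℝ) :
    IsTest p (fun x => cutoff p ρ x * v x) := by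
  refine ⟨(contDiff_cutoff p ρ).mul hv.1, hv.2.1.mul_left, ?_⟩
  rw [notMem_tsupport_iff_eventuallyEq]
  filter_upwards [notMem_tsupport_iff_eventuallyEq.1 hv.2.2] with x h1
  simp [h1]

lemma IsTest.differentiableAt {p : ℂ} {v : ℂ → ℂ} (hv : IsTest p v) (x : ℂ) :
    DifferentiableAt ℝ v x := hv.1.contDiffAt.differentiableAt (by simp)

lemma magD_sub {p : ℂ} {v w : ℂ → ℂ} {x : ℂ} (hv : DifferentiableAt ℝ v x)
    (hw : DifferentiableAt ℝ w x) (j : Fin 2) :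
    magD p (fun y => v y - w y) j x = magD p v j x - magD p w j x := by
  simp only [magD, magGrad, partialDeriv_sub hv hw]; ring

lemma magD_mul {p : ℂ} {v w : ℂ → ℂ} {x : ℂ} (hv : DifferentiableAt ℝ v x)
    (hw : DifferentiableAt ℝ w x) (j : Fin 2) :
    magD p (fun y => v y * w y) j x = v x * magD p w j x + I * partialDeriv j v x * w x := by
  simp only [magD, magGrad, partialDeriv_mul hv hw]; ring

lemma abs_potential_mul_norm_le (p x : ℂ) (j : Fin 2) : |potential p j x| * ‖x - p‖ ≤ 1 := by
  have h1 : (x.re - p.re) ^ 2 + (x.im - p.im) ^ 2 = ‖x - p‖ ^ 2 := by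
    rw [← normSq_eq_norm_sq, normSq_apply]; simp; ring
  by_cases hx : x = p
  · subst hx; simp
  have hn : 0 < ‖x - p‖ := norm_pos_iff.2 (sub_ne_zero.2 hx)
  have h2 : |![-(x.im - p.im), x.re - p.re] j| ≤ ‖x - p‖ := by
    fin_cases j
    · have := abs_im_le_norm (x - p)
      simp only [Fin.zero_eta, Matrix.cons_val_zero, abs_neg]
      simpa using this
    · have := abs_re_le_norm (x - p)
      simpa using this
  rw [potential, h1, abs_mul, abs_of_pos (by norm_num : (0 : ℝ) < 1 / 2), abs_div,
    abs_of_pos (by positivity : 0 < ‖x - p‖ ^ 2)]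
  calc _ ≤ 1 / 2 * (‖x - p‖ / ‖x - p‖ ^ 2) * ‖x - p‖ := by gcongr
    _ = 1 / 2 := by field_simp
    _ ≤ 1 := by norm_num

lemma norm_potential_mul_le (p x z : ℂ) (j : Fin 2) (h : x = p → z = 0) :
    ‖(potential p j x : ℂ) * z‖ ≤ ‖z / (‖x - p‖ : ℂ)‖ := by
  by_cases hx : x = p
  · simp [h hx]
  have hn : 0 < ‖x - p‖ := norm_pos_iff.2 (sub_ne_zero.2 hx)
  rw [norm_mul, norm_div, norm_real, norm_real, norm_norm, le_div_iff₀ hn, Real.norm_eq_abs]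
  calc _ = (|potential p j x| * ‖x - p‖) * ‖z‖ := by ring
    _ ≤ 1 * ‖z‖ := by gcongr; exact abs_potential_mul_norm_le p x j
    _ = _ := one_mul _

lemma continuousAt_potential {p x : ℂ} (hx : x ≠ p) (j : Fin 2) :
    ContinuousAt (potential p j) x := by
  have h : (x.re - p.re) ^ 2 + (x.im - p.im) ^ 2 ≠ 0 := by
    have h1 : (x.re - p.re) ^ 2 + (x.im - p.im) ^ 2 = ‖x - p‖ ^ 2 := by
      rw [← normSq_eq_norm_sq, normSq_apply]; simp; ring
    rw [h1]
    exact pow_ne_zero 2 (norm_ne_zero_iff.2 (sub_ne_zero.2 hx))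
  refine continuousAt_const.mul (ContinuousAt.div ?_ (by fun_prop) h)
  fin_cases j <;> (simp; fun_prop)

lemma IsTest.memLp_magD {p : ℂ} {v : ℂ → ℂ} (hv : IsTest p v) (j : Fin 2) (μ : Measure ℂ)
    [IsFiniteMeasureOnCompacts μ] : MemLp (magD p v j) 2 μ := by
  have h0 := notMem_tsupport_iff_eventuallyEq.1 hv.2.2
  refine Continuous.memLp_of_hasCompactSupport ?_ ?_
  · have hpd : Continuous (partialDeriv j v) :=
      (hv.1.continuous_fderiv (by simp)).clm_apply continuous_const
    have hc : Continuous fun x => (potential p j x : ℂ) * v x := by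
      rw [continuous_iff_continuousAt]
      intro x
      by_cases hx : x = p
      · subst hx
        refine (continuousAt_const (y := (0 : ℂ))).congr ?_
        filter_upwards [h0] with y hy
        simp [hy]
      · exact (continuous_ofReal.continuousAt.comp (continuousAt_potential hx j)).mul
          hv.1.continuous.continuousAt
    exact (continuous_const.mul hpd).add hc
  · have h1 : HasCompactSupport (partialDeriv j v) := hv.2.1.fderiv_apply (𝕜 := ℝ) _
    exact (h1.mul_left (f := fun _ => I)).add hv.2.1.mul_left

lemma IsTest.memLp_div {p : ℂ} {v : ℂ → ℂ} (hv : IsTest p v) (μ : Measure ℂ)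
    [IsFiniteMeasureOnCompacts μ] : MemLp (fun x => v x / (‖x - p‖ : ℂ)) 2 μ := by
  have h0 := notMem_tsupport_iff_eventuallyEq.1 hv.2.2
  refine Continuous.memLp_of_hasCompactSupport ?_ ?_
  · rw [continuous_iff_continuousAt]
    intro x
    by_cases hx : x = p
    · subst hx
      refine (continuousAt_const (y := (0 : ℂ))).congr ?_
      filter_upwards [h0] with y hy
      simp [hy]
    · refine hv.1.continuous.continuousAt.div (by fun_prop) ?_
      simpa [sub_eq_zero] using hx
  · simp_rw [div_eq_mul_inv]
    exact hv.2.1.mul_right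

/-- `u` and `M` are locally limits of `v_n` and `(i∇ + A_p) v_n` for test functions `v_n`. -/
def MagApprox (p : ℂ) (u : ℂ → ℂ) (M : Fin 2 → ℂ → ℂ) : Prop :=
  ∀ ρ : ℝ, 0 < ρ → ∃ v : ℕ → ℂ → ℂ, (∀ n, IsTest p (v n)) ∧
    (∀ j, Tendsto (fun n => eLpNorm (fun x => magD p (v n) j x - M j x) 2
      (volume.restrict (Metric.ball p ρ))) atTop (𝓝 0)) ∧
    Tendsto (fun n => eLpNorm (fun x => (v n x - u x) / (‖x - p‖ : ℂ)) 2
      (volume.restrict (Metric.ball p ρ))) atTop (𝓝 0)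

/-- v is smooth only on the disk of radius R, but the cutoff vanishes near every point outside it.
-/
lemma isTest_cutoff_mul_of_contDiffOn {p : ℂ} {R ρ : ℝ} (hρ : 0 < ρ) (hR : 2 * ρ + ‖p‖ < R)
    {v : ℂ → ℂ} (hv : ContDiffOn ℝ ∞ v (Metric.ball 0 R)) (h0 : ∀ᶠ x in 𝓝 p, v x = 0) :
    IsTest p (fun x => cutoff p ρ x * v x) := by
  refine ⟨?_, ?_, ?_⟩
  · rw [contDiff_iff_contDiffAt]
    intro x
    by_cases hx : x ∈ Metric.ball (0 : ℂ) R
    · exact (contDiff_cutoff p ρ).contDiffAt.mul (hv.contDiffAt (Metric.isOpen_ball.mem_nhds hx))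
    · have h1 : 2 * ρ < ‖x - p‖ := by
        have h2 : R ≤ ‖x‖ := by simpa using hx
        have := norm_sub_norm_le x p
        linarith
      have hc : ContinuousAt (fun y => ‖y - p‖) x := by fun_prop
      refine (contDiffAt_const (c := (0 : ℂ))).congr_of_eventuallyEq ?_
      filter_upwards [hc.eventually_const_lt h1] with y hy
      rw [cutoff_eq_zero hρ hy.le, zero_mul]
  · refine HasCompactSupport.intro (isCompact_closedBall p (2 * ρ)) fun x hx => ?_
    have : 2 * ρ < ‖x - p‖ := by simpa [dist_eq_norm] using hx
    rw [cutoff_eq_zero hρ this.le, zero_mul]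
  · rw [notMem_tsupport_iff_eventuallyEq]
    filter_upwards [h0] with x hx
    simp [hx]

/-- The approximants from the definition of H^{1,p} on a larger disk are multiplied by a cutoff
equal to 1 on the disk of radius ρ. The potential terms converge because |A_p| ≤ 1/|x - p| and the
norm of H^{1,p} contains u/|x - p|. -/
lemma MemH1Loc.magApprox {p : ℂ} {u : ℂ → ℂ} {G : Fin 2 → ℂ → ℂ} (h : MemH1Loc p u G) :
    MagApprox p u (magGrad p u G) := by
  intro ρ hρ
  set R := 2 * ρ + ‖p‖ + 1
  have hR : 2 * ρ + ‖p‖ < R := by simp [R]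
  obtain ⟨hu, hG, v, hv, -, hvG, hvw⟩ := h R (by positivity)
  set μ := volume.restrict (Metric.ball p ρ) with hμ
  have hsub : Metric.ball p ρ ⊆ Metric.ball 0 R := Metric.ball_subset_ball' (by
    rw [dist_zero_right]; linarith)
  have hmono : μ ≤ volume.restrict (Metric.ball 0 R) := Measure.restrict_mono hsub le_rfl
  have hev : ∀ n, ∀ x ∈ Metric.ball p ρ, (fun y => cutoff p ρ y * v n y) =ᶠ[𝓝 x] v n :=
    fun n x hx => by
      filter_upwards [Metric.isOpen_ball.mem_nhds hx] with y hy
      rw [cutoff_eq_one hρ (by simpa [dist_eq_norm] using (Metric.mem_ball.1 hy).le), one_mul]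
  have hmem : ∀ᵐ x ∂μ, x ∈ Metric.ball p ρ := ae_restrict_mem measurableSet_ball
  have hne : ∀ᵐ x ∂μ, x ≠ p := ae_restrict_of_ae (by simp [ae_iff])
  have hw : Tendsto (fun n => eLpNorm (fun x => (v n x - u x) / (‖x - p‖ : ℂ)) 2 μ) atTop (𝓝 0) :=
    tendsto_of_tendsto_of_tendsto_of_le_of_le tendsto_const_nhds hvw (fun _ => zero_le)
      fun _ => eLpNorm_mono_measure _ hmono
  refine ⟨fun n x => cutoff p ρ x * v n x,
    fun n => isTest_cutoff_mul_of_contDiffOn hρ hR (hv n).1 (hv n).2.1, fun j => ?_, ?_⟩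
  · have hGj : Tendsto (fun n => eLpNorm (fun x => partialDeriv j (v n) x - G j x) 2 μ)
        atTop (𝓝 0) :=
      tendsto_of_tendsto_of_tendsto_of_le_of_le tendsto_const_nhds (hvG j) (fun _ => zero_le)
        fun _ => eLpNorm_mono_measure _ hmono
    have hsum := hGj.add hw
    rw [add_zero] at hsum
    refine tendsto_of_tendsto_of_tendsto_of_le_of_le tendsto_const_nhds hsum (fun _ => zero_le)
      fun n => ?_
    have m1 : AEStronglyMeasurable (fun x => I * (partialDeriv j (v n) x - G j x)) μ :=
      (((hv n).2.2.2 j).1.sub (hG j).1).mono_measure hmono |>.const_mul I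
    have m2 : AEStronglyMeasurable (fun x => (potential p j x : ℂ) * (v n x - u x)) μ :=
      (measurable_ofReal.comp (measurable_potential p j)).aestronglyMeasurable.mul
        (((hv n).2.2.1.1.sub hu.1).mono_measure hmono)
    calc _ = eLpNorm ((fun x => I * (partialDeriv j (v n) x - G j x)) +
          fun x => (potential p j x : ℂ) * (v n x - u x)) 2 μ := by
          refine eLpNorm_congr_ae ?_
          filter_upwards [hmem] with x hx
          have e1 := hev n x hx
          have e2 : cutoff p ρ x * v n x = v n x := e1.self_of_nhds
          simp only [magD, magGrad, partialDeriv, e1.fderiv_eq, Pi.add_apply]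
          rw [e2]
          ring
      _ ≤ _ := eLpNorm_add_le m1 m2 one_le_two
      _ ≤ _ := by
          gcongr
          · exact eLpNorm_mono_ae (Eventually.of_forall fun x => by simp)
          · refine eLpNorm_mono_ae ?_
            filter_upwards [hne] with x hx
            exact norm_potential_mul_le p x _ j fun h => absurd h hx
  · refine hw.congr fun n => eLpNorm_congr_ae ?_
    filter_upwards [hmem] with x hx
    have e : cutoff p ρ x * v n x = v n x := (hev n x hx).self_of_nhds
    rw [e]

lemma aestronglyMeasurable_of_forall_ball {f : ℂ → ℂ}
    (h : ∀ R : ℝ, 0 < R → AEStronglyMeasurable f (volume.restrict (Metric.ball 0 R))) :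
    AEStronglyMeasurable f volume := by
  have h1 : (⋃ n : ℕ, Metric.ball (0 : ℂ) ((n : ℝ) + 1)) = Set.univ := by
    refine Set.eq_univ_of_forall fun x => Set.mem_iUnion.2 ?_
    obtain ⟨n, hn⟩ := exists_nat_gt ‖x‖
    exact ⟨n, by simp; linarith⟩
  rw [← Measure.restrict_univ (μ := volume), ← h1, aestronglyMeasurable_iUnion_iff]
  exact fun n => h _ (by positivity)

lemma MemH1Loc.aestronglyMeasurable {p : ℂ} {u : ℂ → ℂ} {G : Fin 2 → ℂ → ℂ}
    (h : MemH1Loc p u G) : AEStronglyMeasurable u volume :=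
  aestronglyMeasurable_of_forall_ball fun R hR => (h R hR).1.1

lemma MemH1Loc.aestronglyMeasurable_magGrad {p : ℂ} {u : ℂ → ℂ} {G : Fin 2 → ℂ → ℂ}
    (h : MemH1Loc p u G) (j : Fin 2) : AEStronglyMeasurable (magGrad p u G j) volume :=
  ((aestronglyMeasurable_of_forall_ball fun R hR => ((h R hR).2.1 j).1).const_mul I).add
    ((measurable_ofReal.comp (measurable_potential p j)).aestronglyMeasurable.mul
      h.aestronglyMeasurable)

lemma aestronglyMeasurable_div_norm {p : ℂ} {u : ℂ → ℂ} {μ : Measure ℂ}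
    (hu : AEStronglyMeasurable u μ) :
    AEStronglyMeasurable (fun x => u x / (‖x - p‖ : ℂ)) μ := by
  simp_rw [div_eq_mul_inv]
  exact hu.mul (by fun_prop : Measurable fun x : ℂ => ((‖x - p‖ : ℂ))⁻¹).aestronglyMeasurable

/-! ### Passage to the limit: differences, integrability and the Hardy inequality -/

section

variable {p : ℂ} {u u' : ℂ → ℂ} {M M' : Fin 2 → ℂ → ℂ}

lemma MagApprox.sub (h : MagApprox p u M) (h' : MagApprox p u' M')
    (hu : AEStronglyMeasurable u volume) (hu' : AEStronglyMeasurable u' volume)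
    (hM : ∀ j, AEStronglyMeasurable (M j) volume) (hM' : ∀ j, AEStronglyMeasurable (M' j) volume) :
    MagApprox p (fun x => u x - u' x) (fun j x => M j x - M' j x) := by
  intro ρ hρ
  obtain ⟨v, hv, hvM, hvu⟩ := h ρ hρ
  obtain ⟨w, hw, hwM, hwu⟩ := h' ρ hρ
  set μ := volume.restrict (Metric.ball p ρ)
  refine ⟨fun n x => v n x - w n x, fun n => (hv n).sub (hw n), fun j => ?_, ?_⟩
  · have hs := (hvM j).add (hwM j)
    rw [add_zero] at hs
    refine tendsto_of_tendsto_of_tendsto_of_le_of_le tendsto_const_nhds hs (fun _ => zero_le)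
      fun n => ?_
    have m1 : AEStronglyMeasurable (fun x => magD p (v n) j x - M j x) μ :=
      ((hv n).memLp_magD j μ).1.sub (hM j).restrict
    have m2 : AEStronglyMeasurable (fun x => magD p (w n) j x - M' j x) μ :=
      ((hw n).memLp_magD j μ).1.sub (hM' j).restrict
    refine le_trans (le_of_eq ?_) (eLpNorm_sub_le m1 m2 one_le_two)
    congr 1
    funext x
    simp only [Pi.sub_apply]
    rw [magD_sub ((hv n).differentiableAt x) ((hw n).differentiableAt x)]
    ring
  · have hs := hvu.add hwu
    rw [add_zero] at hs
    refine tendsto_of_tendsto_of_tendsto_of_le_of_le tendsto_const_nhds hs (fun _ => zero_le)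
      fun n => ?_
    have m1 : AEStronglyMeasurable (fun x => (v n x - u x) / (‖x - p‖ : ℂ)) μ :=
      aestronglyMeasurable_div_norm ((hv n).1.continuous.aestronglyMeasurable.sub hu.restrict)
    have m2 : AEStronglyMeasurable (fun x => (w n x - u' x) / (‖x - p‖ : ℂ)) μ :=
      aestronglyMeasurable_div_norm ((hw n).1.continuous.aestronglyMeasurable.sub hu'.restrict)
    refine le_trans (le_of_eq ?_) (eLpNorm_sub_le m1 m2 one_le_two)
    congr 1
    funext x
    simp only [Pi.sub_apply]
    ring

lemma memLp_of_tendsto_eLpNorm_sub {μ : Measure ℂ} {f : ℂ → ℂ} {F : ℕ → ℂ → ℂ}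
    (hf : AEStronglyMeasurable f μ) (hF : ∀ n, MemLp (F n) 2 μ)
    (h : Tendsto (fun n => eLpNorm (fun x => F n x - f x) 2 μ) atTop (𝓝 0)) : MemLp f 2 μ := by
  obtain ⟨n, hn⟩ := (h.eventually_lt_const (by simp : (0 : ENNReal) < 1)).exists
  have h1 : MemLp (fun x => F n x - f x) 2 μ := ⟨(hF n).1.sub hf, hn.trans (by simp)⟩
  have h2 := (hF n).sub h1
  refine h2.congr_norm hf (Eventually.of_forall fun _ => ?_)
  simp

lemma MagApprox.memLp (h : MagApprox p u M) (hM : ∀ j, AEStronglyMeasurable (M j) volume)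
    {ρ : ℝ} (hρ : 0 < ρ) (j : Fin 2) : MemLp (M j) 2 (volume.restrict (Metric.ball p ρ)) := by
  obtain ⟨v, hv, hvM, -⟩ := h ρ hρ
  exact memLp_of_tendsto_eLpNorm_sub (hM j).restrict (fun n => (hv n).memLp_magD j _) (hvM j)

lemma MagApprox.memLp_div (h : MagApprox p u M) (hu : AEStronglyMeasurable u volume)
    {ρ : ℝ} (hρ : 0 < ρ) :
    MemLp (fun x => u x / (‖x - p‖ : ℂ)) 2 (volume.restrict (Metric.ball p ρ)) := by
  obtain ⟨v, hv, -, hvu⟩ := h ρ hρ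
  refine memLp_of_tendsto_eLpNorm_sub (aestronglyMeasurable_div_norm hu.restrict)
    (fun n => (hv n).memLp_div _) (hvu.congr fun n => ?_)
  simp_rw [sub_div]

/-- The magnetic Hardy inequality on annuli around the pole. -/
lemma MagApprox.hardy (h : MagApprox p u M) (hu : AEStronglyMeasurable u volume)
    (hM : ∀ j, AEStronglyMeasurable (M j) volume) {ρ : ℝ} (hρ : 0 < ρ) {J : Set ℝ}
    (hJ : MeasurableSet J) (hJρ : J ⊆ Set.Iio ρ) :
    eLpNorm (fun x => u x / (‖x - p‖ : ℂ)) 2 (volume.restrict {x | ‖x - p‖ ∈ J}) ≤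
      ENNReal.ofReal Real.pi * ∑ j, eLpNorm (M j) 2 (volume.restrict {x | ‖x - p‖ ∈ J}) := by
  obtain ⟨v, hv, hvM, hvu⟩ := h ρ hρ
  set μ := volume.restrict {x : ℂ | ‖x - p‖ ∈ J}
  have hmono : μ ≤ volume.restrict (Metric.ball p ρ) :=
    Measure.restrict_mono (fun x hx => by simpa [dist_eq_norm] using hJρ hx) le_rfl
  have hM0 : ∀ j, Tendsto (fun n => eLpNorm (fun x => magD p (v n) j x - M j x) 2 μ)
      atTop (𝓝 0) := fun j =>
    tendsto_of_tendsto_of_tendsto_of_le_of_le tendsto_const_nhds (hvM j) (fun _ => zero_le)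
      fun _ => eLpNorm_mono_measure _ hmono
  have hu0 : Tendsto (fun n => eLpNorm (fun x => (v n x - u x) / (‖x - p‖ : ℂ)) 2 μ)
      atTop (𝓝 0) :=
    tendsto_of_tendsto_of_tendsto_of_le_of_le tendsto_const_nhds hvu (fun _ => zero_le)
      fun _ => eLpNorm_mono_measure _ hmono
  have hlim := hu0.add (ENNReal.Tendsto.const_mul (a := ENNReal.ofReal Real.pi)
    (tendsto_finsetSum Finset.univ fun j _ =>
      (hM0 j).add (tendsto_const_nhds (x := eLpNorm (M j) 2 μ))) (Or.inr ENNReal.ofReal_ne_top))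
  simp only [zero_add] at hlim
  refine ge_of_tendsto' hlim fun n => ?_
  have m1 : AEStronglyMeasurable (fun x => v n x / (‖x - p‖ : ℂ)) μ := ((hv n).memLp_div _).1
  have m2 : AEStronglyMeasurable (fun x => (v n x - u x) / (‖x - p‖ : ℂ)) μ :=
    aestronglyMeasurable_div_norm ((hv n).1.continuous.aestronglyMeasurable.sub hu.restrict)
  calc _ = eLpNorm ((fun x => v n x / (‖x - p‖ : ℂ)) -
        fun x => (v n x - u x) / (‖x - p‖ : ℂ)) 2 μ := by
        congr 1; funext x; simp only [Pi.sub_apply]; ring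
    _ ≤ _ := eLpNorm_sub_le m1 m2 one_le_two
    _ ≤ ENNReal.ofReal Real.pi * ∑ j, eLpNorm (magD p (v n) j) 2 μ + _ := by
        gcongr
        exact hardy_smooth (hv n).1 hJ
    _ ≤ _ := by
        rw [add_comm]
        gcongr with j
        have m3 : AEStronglyMeasurable (fun x => magD p (v n) j x - M j x) μ :=
          ((hv n).memLp_magD j μ).1.sub (hM j).restrict
        refine le_trans (le_of_eq ?_) (eLpNorm_add_le m3 (hM j).restrict one_le_two)
        congr 1; funext x; simp only [Pi.add_apply]; ring

lemma lintegral_mul_le {μ : Measure ℂ} {f g : ℂ → ℂ} (hf : AEStronglyMeasurable f μ)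
    (hg : AEStronglyMeasurable g μ) :
    ∫⁻ x, ‖f x * g x‖ₑ ∂μ ≤ eLpNorm f 2 μ * eLpNorm g 2 μ := by
  have h := eLpNorm_smul_le_mul_eLpNorm (p := 2) (q := 2) (r := 1) hg hf
  rw [eLpNorm_one_eq_lintegral_enorm] at h
  exact h

lemma eLpNorm_conj {μ : Measure ℂ} (f : ℂ → ℂ) :
    eLpNorm (fun x => conj (f x)) 2 μ = eLpNorm f 2 μ :=
  eLpNorm_congr_norm_ae (Eventually.of_forall fun _ => RCLike.norm_conj _)

lemma aestronglyMeasurable_conj {μ : Measure ℂ} {f : ℂ → ℂ} (hf : AEStronglyMeasurable f μ) :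
    AEStronglyMeasurable (fun x => conj (f x)) μ :=
  continuous_conj.comp_aestronglyMeasurable hf

lemma memLp_conj {μ : Measure ℂ} {f : ℂ → ℂ} (hf : MemLp f 2 μ) :
    MemLp (fun x => conj (f x)) 2 μ :=
  ⟨aestronglyMeasurable_conj hf.1, by rw [eLpNorm_conj]; exact hf.2⟩

end

/-! ### Energy estimates and vanishing of finite-energy solutions -/

section

lemma integrable_mul_conj {μ : Measure ℂ} {f g : ℂ → ℂ} (hf : MemLp f 2 μ) (hg : MemLp g 2 μ) :
    Integrable (fun x => f x * conj (g x)) μ :=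
  hf.integrable_mul (memLp_conj hg)

variable {p : ℂ} {u : ℂ → ℂ} {M : Fin 2 → ℂ → ℂ}

/-- The weak equation may be tested with `η u`, where `η` is a cutoff function. -/
lemma MagApprox.integral_cutoff_eq_zero (h : MagApprox p u M)
    (hu : AEStronglyMeasurable u volume) (hM : ∀ j, AEStronglyMeasurable (M j) volume)
    (hweak : ∀ v, IsTest p v → ∫ x, ∑ j, M j x * conj (magD p v j x) = 0) {ρ : ℝ} (hρ : 0 < ρ) :
    ∫ x in Metric.ball p (3 * ρ), ∑ j, M j x * conj (cutoff p ρ x * M j x +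
      I * partialDeriv j (cutoff p ρ) x * u x) = 0 := by
  -- The cutoff vanishes for |x - p| ≥ 2ρ, so approximation on the disk of radius 3ρ is enough.
  have h3 : 0 < 3 * ρ := by positivity
  obtain ⟨v, hv, hvM, hvu⟩ := h (3 * ρ) h3
  obtain ⟨C, hC0, hC⟩ := exists_partialDeriv_cutoff_le
  set μ := volume.restrict (Metric.ball p (3 * ρ)) with hμ
  have hne : ∀ᵐ x ∂μ, x ≠ p := ae_restrict_of_ae (by simp [ae_iff])
  have hML := fun j => h.memLp hM h3 j
  have hηd : ∀ x, DifferentiableAt ℝ (cutoff p ρ) x := fun x =>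
    (contDiff_cutoff p ρ).contDiffAt.differentiableAt (by simp)
  have hηm : Measurable (cutoff p ρ) := (contDiff_cutoff p ρ).continuous.measurable
  have hdη : ∀ (j : Fin 2) (x z : ℂ), x ≠ p →
      ‖I * partialDeriv j (cutoff p ρ) x * z‖ ≤ C * ‖z / (‖x - p‖ : ℂ)‖ := fun j x z hx => by
    have hn : 0 < ‖x - p‖ := norm_pos_iff.2 (sub_ne_zero.2 hx)
    rw [norm_mul, norm_mul, norm_I, one_mul, norm_div, norm_real, norm_norm]
    have := hC p ρ hρ x j
    calc _ = (‖partialDeriv j (cutoff p ρ) x‖ * ‖x - p‖) * (‖z‖ / ‖x - p‖) := by field_simp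
      _ ≤ _ := by gcongr
  -- By the Leibniz rule N is the magnetic gradient of the cutoff times u. It is the L² limit of the
  -- magnetic gradients of the test functions `cutoff p ρ x * v n x`.
  set N : Fin 2 → ℂ → ℂ := fun j x => cutoff p ρ x * M j x +
    I * partialDeriv j (cutoff p ρ) x * u x with hN
  have hNm : ∀ j, AEStronglyMeasurable (N j) μ := fun j =>
    (hηm.aestronglyMeasurable.mul (hM j).restrict).add
      (((measurable_partialDeriv j _).aestronglyMeasurable.const_mul I).mul hu.restrict)
  have hφ : ∀ n, IsTest p (fun x => cutoff p ρ x * v n x) := fun n => (hv n).cutoff_mul ρ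
  have hφm : ∀ n j, MemLp (magD p (fun x => cutoff p ρ x * v n x) j) 2 μ :=
    fun n j => (hφ n).memLp_magD j μ
  have hφN : ∀ j, Tendsto (fun n => eLpNorm
      (fun x => magD p (fun x => cutoff p ρ x * v n x) j x - N j x) 2 μ) atTop (𝓝 0) := fun j => by
    have hs := (hvM j).add (ENNReal.Tendsto.const_mul (a := ENNReal.ofReal C) hvu
      (Or.inr ENNReal.ofReal_ne_top))
    rw [mul_zero, add_zero] at hs
    refine tendsto_of_tendsto_of_tendsto_of_le_of_le tendsto_const_nhds hs (fun _ => zero_le)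
      fun n => ?_
    have m1 : AEStronglyMeasurable (fun x => cutoff p ρ x * (magD p (v n) j x - M j x)) μ :=
      hηm.aestronglyMeasurable.mul (((hv n).memLp_magD j μ).1.sub (hM j).restrict)
    have m2 : AEStronglyMeasurable
        (fun x => I * partialDeriv j (cutoff p ρ) x * (v n x - u x)) μ :=
      ((measurable_partialDeriv j _).aestronglyMeasurable.const_mul I).mul
        ((hv n).1.continuous.aestronglyMeasurable.sub hu.restrict)
    calc _ = eLpNorm ((fun x => cutoff p ρ x * (magD p (v n) j x - M j x)) +
          fun x => I * partialDeriv j (cutoff p ρ) x * (v n x - u x)) 2 μ := by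
          congr 1; funext x
          simp only [Pi.add_apply, hN]
          rw [magD_mul (hηd x) ((hv n).differentiableAt x)]
          ring
      _ ≤ _ := eLpNorm_add_le m1 m2 one_le_two
      _ ≤ _ := by
          gcongr
          · refine eLpNorm_mono_ae (Eventually.of_forall fun x => ?_)
            rw [norm_mul]
            exact mul_le_of_le_one_left (norm_nonneg _) (norm_cutoff_le _ _ _)
          · refine eLpNorm_le_mul_eLpNorm_of_ae_le_mul ?_ 2
            filter_upwards [hne] with x hx using hdη j x _ hx
  have hNL : ∀ j, MemLp (N j) 2 μ := fun j =>
    memLp_of_tendsto_eLpNorm_sub (hNm j) (fun n => hφm n j) (hφN j)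
  have hzero : ∀ n, ∑ j, ∫ x, M j x * conj (magD p (fun x => cutoff p ρ x * v n x) j x) ∂μ = 0 :=
    fun n => by
      rw [← integral_finsetSum _ fun j _ => integrable_mul_conj (hML j) (hφm n j),
        setIntegral_eq_integral_of_forall_compl_eq_zero]
      · exact hweak _ (hφ n)
      · intro x hx
        have hx2 : 2 * ρ < ‖x - p‖ := by
          have : 3 * ρ ≤ ‖x - p‖ := by simpa [dist_eq_norm] using hx
          linarith
        refine Finset.sum_eq_zero fun j _ => ?_
        rw [magD_mul (hηd x) ((hv n).differentiableAt x), cutoff_eq_zero hρ hx2.le,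
          partialDeriv_cutoff_of_gt hρ hx2]
        simp
  have hlim : Tendsto (fun n => ∑ j, ∫ x, M j x *
      conj (magD p (fun x => cutoff p ρ x * v n x) j x) ∂μ) atTop
      (𝓝 (∑ j, ∫ x, M j x * conj (N j x) ∂μ)) := by
    refine tendsto_finsetSum _ fun j _ => ?_
    refine tendsto_integral_of_L1 (fun x => M j x * conj (N j x))
      ((hML j).1.mul (aestronglyMeasurable_conj (hNm j)))
      (Eventually.of_forall fun n => integrable_mul_conj (hML j) (hφm n j)) ?_
    have hs := ENNReal.Tendsto.const_mul (a := eLpNorm (M j) 2 μ) (hφN j) (Or.inr (hML j).2.ne)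
    rw [mul_zero] at hs
    refine tendsto_of_tendsto_of_tendsto_of_le_of_le tendsto_const_nhds hs (fun _ => zero_le)
      fun n => ?_
    have := lintegral_mul_le (hML j).1 (aestronglyMeasurable_conj ((hφm n j).1.sub (hNm j)))
    rw [eLpNorm_conj] at this
    refine le_trans (le_of_eq (lintegral_congr fun x => ?_)) this
    rw [Pi.sub_apply, map_sub, mul_sub]
  simp_rw [hzero] at hlim
  rw [integral_finsetSum _ fun j _ => integrable_mul_conj (hML j) (hNL j)]
  exact (tendsto_nhds_unique tendsto_const_nhds hlim).symm

/-- A Caccioppoli inequality: the energy in a disk is controlled by the energy outside. -/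
lemma MagApprox.exists_energy_le (hu : AEStronglyMeasurable u volume)
    (hM : ∀ j, AEStronglyMeasurable (M j) volume) (h : MagApprox p u M)
    (hweak : ∀ v, IsTest p v → ∫ x, ∑ j, M j x * conj (magD p v j x) = 0) :
    ∃ K : ENNReal, K ≠ ⊤ ∧ ∀ ρ : ℝ, 0 < ρ →
      ∫⁻ x in Metric.ball p ρ, ∑ j, ‖M j x‖ₑ ^ 2 ≤
        K * (∑ j, eLpNorm (M j) 2 (volume.restrict {x | ρ ≤ ‖x - p‖})) ^ 2 := by
  obtain ⟨C, hC0, hC⟩ := exists_partialDeriv_cutoff_le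
  -- C comes from the gradient of the cutoff and π from the Hardy inequality. Neither depends on ρ.
  refine ⟨ENNReal.ofReal C * ENNReal.ofReal Real.pi,
    ENNReal.mul_ne_top ENNReal.ofReal_ne_top ENNReal.ofReal_ne_top, fun ρ hρ => ?_⟩
  have h3 : 0 < 3 * ρ := by positivity
  have hint := h.integral_cutoff_eq_zero hu hM hweak hρ
  set μ := volume.restrict (Metric.ball p (3 * ρ)) with hμ
  set A : Set ℂ := {x | ‖x - p‖ ∈ Set.Ico ρ (3 * ρ)} with hA
  have hAm : MeasurableSet A := (by fun_prop : Measurable fun x : ℂ => ‖x - p‖) measurableSet_Ico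
  have hne : ∀ᵐ x ∂μ, x ≠ p := ae_restrict_of_ae (by simp [ae_iff])
  have hML := fun j => h.memLp hM h3 j
  have hηm : Measurable (cutoff p ρ) := (contDiff_cutoff p ρ).continuous.measurable
  set B : Fin 2 → ℂ → ℂ := fun j x => I * partialDeriv j (cutoff p ρ) x * u x with hB
  have hBm : ∀ j, AEStronglyMeasurable (B j) volume := fun j =>
    ((measurable_partialDeriv j _).aestronglyMeasurable.const_mul I).mul hu
  have hBle : ∀ j, ∀ x, x ≠ p → ‖B j x‖ ≤ C * ‖u x / (‖x - p‖ : ℂ)‖ := fun j x hx => by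
    have hn : 0 < ‖x - p‖ := norm_pos_iff.2 (sub_ne_zero.2 hx)
    rw [hB, norm_mul, norm_mul, norm_I, one_mul, norm_div, norm_real, norm_norm]
    have := hC p ρ hρ x j
    calc _ = (‖partialDeriv j (cutoff p ρ) x‖ * ‖x - p‖) * (‖u x‖ / ‖x - p‖) := by field_simp
      _ ≤ _ := by gcongr
  have hBL : ∀ j, MemLp (B j) 2 μ := fun j => by
    refine (h.memLp_div hu h3).of_le_mul (hBm j).restrict (c := C) ?_
    filter_upwards [hne] with x hx using hBle j x hx
  have hηL : ∀ j, MemLp (fun x => cutoff p ρ x * M j x) 2 μ := fun j => by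
    refine (hML j).of_le_mul (hηm.aestronglyMeasurable.mul (hM j).restrict) (c := 1)
      (Eventually.of_forall fun x => ?_)
    rw [norm_mul]
    gcongr
    exact norm_cutoff_le _ _ _
  set t : ℂ → ℝ := fun x => (cutoff p ρ x).re with ht
  have htη : ∀ x, cutoff p ρ x = (t x : ℂ) ∧ 0 ≤ t x := fun x => by
    obtain ⟨s, hs, hs0, -⟩ := cutoff_eq_ofReal p ρ x
    simp [ht, hs, hs0]
  set E : ℂ → ℝ := fun x => t x * ∑ j, ‖M j x‖ ^ 2 with hE
  have hE0 : ∀ x, 0 ≤ E x := fun x => mul_nonneg (htη x).2 (by positivity)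
  -- The tested equation splits into the cutoff-weighted energy E and a cross term with B, which
  -- lives where the cutoff is not locally constant, inside the annulus A.
  have e1 : ∀ x, ∑ j, M j x * conj (cutoff p ρ x * M j x + B j x) =
      (E x : ℂ) + ∑ j, M j x * conj (B j x) := fun x => by
    rw [hE, (htη x).1, ofReal_mul, ofReal_sum, Finset.mul_sum, ← Finset.sum_add_distrib]
    refine Finset.sum_congr rfl fun j _ => ?_
    rw [map_add, map_mul, conj_ofReal, ofReal_pow, ← ofReal_pow, ← normSq_eq_norm_sq, ← mul_conj]
    ring
  have iE : Integrable (fun x => (E x : ℂ)) μ := by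
    have : (fun x => (E x : ℂ)) = fun x => ∑ j, M j x * conj (cutoff p ρ x * M j x) := by
      funext x
      rw [hE, (htη x).1, ofReal_mul, ofReal_sum, Finset.mul_sum]
      refine Finset.sum_congr rfl fun j _ => ?_
      rw [map_mul, conj_ofReal, ← normSq_eq_norm_sq, ← mul_conj]
      ring
    rw [this]
    exact integrable_finsetSum _ fun j _ => integrable_mul_conj (hML j) (hηL j)
  have iB : Integrable (fun x => ∑ j, M j x * conj (B j x)) μ :=
    integrable_finsetSum _ fun j _ => integrable_mul_conj (hML j) (hBL j)
  simp_rw [show ∀ (j : Fin 2) (x : ℂ), I * partialDeriv j (cutoff p ρ) x * u x = B j x from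
    fun _ _ => rfl, e1] at hint
  rw [integral_add iE iB, integral_complex_ofReal] at hint
  have e : ∀ z : ℂ, ‖z‖ₑ ^ 2 = ENNReal.ofReal (‖z‖ ^ 2) := fun z => by
    rw [ENNReal.ofReal_pow (norm_nonneg _), ofReal_norm]
  have hAle : volume.restrict A ≤ volume.restrict {x | ρ ≤ ‖x - p‖} :=
    Measure.restrict_mono (fun x hx => hx.1) le_rfl
  -- The Hardy inequality on the annulus alone keeps the energy inside the disk of radius ρ out of
  -- the right side.
  have hwA : eLpNorm (fun x => u x / (‖x - p‖ : ℂ)) 2 (volume.restrict A) ≤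
      ENNReal.ofReal Real.pi * ∑ j, eLpNorm (M j) 2 (volume.restrict {x | ρ ≤ ‖x - p‖}) := by
    refine (h.hardy hu hM h3 (J := Set.Ico ρ (3 * ρ)) measurableSet_Ico fun x hx => hx.2).trans ?_
    gcongr
  calc ∫⁻ x in Metric.ball p ρ, ∑ j, ‖M j x‖ₑ ^ 2
      = ∫⁻ x in Metric.ball p ρ, ENNReal.ofReal (E x) := by
        refine setLIntegral_congr_fun measurableSet_ball fun x hx => ?_
        have h1 : t x = 1 := by
          change (cutoff p ρ x).re = 1
          rw [cutoff_eq_one hρ (by simpa [dist_eq_norm] using (Metric.mem_ball.1 hx).le)]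
          simp
        simp_rw [e, hE, h1, one_mul]
        rw [ENNReal.ofReal_sum_of_nonneg fun _ _ => by positivity]
    _ ≤ ∫⁻ x, ENNReal.ofReal (E x) ∂μ :=
        lintegral_mono' (Measure.restrict_mono (Metric.ball_subset_ball (by linarith)) le_rfl) le_rfl
    _ = ENNReal.ofReal (∫ x, E x ∂μ) := by
        have : Integrable E μ := by simpa using iE.re
        rw [ofReal_integral_eq_lintegral_ofReal this (Eventually.of_forall hE0)]
    _ = ‖∫ x, ∑ j, M j x * conj (B j x) ∂μ‖ₑ := by
        rw [← neg_eq_of_add_eq_zero_right hint, enorm_neg, ← ofReal_norm, norm_real,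
          Real.norm_of_nonneg (integral_nonneg hE0)]
    _ ≤ ∫⁻ x, ‖∑ j, M j x * conj (B j x)‖ₑ ∂μ := enorm_integral_le_lintegral_enorm _
    _ ≤ ∫⁻ x in A, ‖∑ j, M j x * conj (B j x)‖ₑ := by
        rw [hμ, ← lintegral_indicator measurableSet_ball, ← lintegral_indicator hAm]
        refine lintegral_mono fun x => ?_
        by_cases hx : x ∈ A
        · rw [Set.indicator_of_mem hx]
          exact Set.indicator_le_self _ _ _
        · rw [Set.indicator_of_notMem hx]
          by_cases hx2 : x ∈ Metric.ball p (3 * ρ)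
          · have hx3 : ‖x - p‖ < ρ := by
              by_contra! hcon
              exact hx ⟨hcon, by simpa [dist_eq_norm] using hx2⟩
            simp [hx2, hB, partialDeriv_cutoff_of_lt hρ hx3]
          · simp [hx2]
    _ ≤ ∫⁻ x in A, ∑ j, ‖M j x * conj (B j x)‖ₑ := lintegral_mono fun x => enorm_sum_le _ _
    _ = ∑ j, ∫⁻ x in A, ‖M j x * conj (B j x)‖ₑ := lintegral_finsetSum' _ fun j _ =>
        ((hM j).mul (aestronglyMeasurable_conj (hBm j))).restrict.enorm
    _ ≤ ∑ j, eLpNorm (M j) 2 (volume.restrict {x | ρ ≤ ‖x - p‖}) *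
        (ENNReal.ofReal C * (ENNReal.ofReal Real.pi *
          ∑ i, eLpNorm (M i) 2 (volume.restrict {x | ρ ≤ ‖x - p‖}))) := by
        refine Finset.sum_le_sum fun j _ => ?_
        refine (lintegral_mul_le (hM j).restrict
          (aestronglyMeasurable_conj (hBm j)).restrict).trans ?_
        rw [eLpNorm_conj]
        refine mul_le_mul' (eLpNorm_mono_measure _ hAle) ?_
        refine (eLpNorm_le_mul_eLpNorm_of_ae_le_mul (c := C)
          (g := fun x => u x / (‖x - p‖ : ℂ)) ?_ 2).trans (by gcongr)
        filter_upwards [ae_restrict_of_ae (s := A) (by simp [ae_iff] : ∀ᵐ x : ℂ, x ≠ p)] with x hx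
        exact hBle j x hx
    _ = _ := by rw [← Finset.sum_mul]; ring

lemma tendsto_eLpNorm_outside {f : ℂ → ℂ} (hf : MemLp f 2 volume) :
    Tendsto (fun n : ℕ => eLpNorm f 2 (volume.restrict {x | (n : ℝ) ≤ ‖x - p‖})) atTop (𝓝 0) := by
  have hm : ∀ n : ℕ, MeasurableSet {x : ℂ | (n : ℝ) ≤ ‖x - p‖} := fun n =>
    measurableSet_le measurable_const (by fun_prop)
  have h1 : Tendsto (fun n : ℕ => ∫⁻ x, Set.indicator {x : ℂ | (n : ℝ) ≤ ‖x - p‖}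
      (fun x => ‖f x‖ₑ ^ 2) x) atTop (𝓝 (∫⁻ _ : ℂ, 0)) := by
    refine tendsto_lintegral_of_dominated_convergence' (fun x => ‖f x‖ₑ ^ 2) (fun n => ?_)
      (fun n => Eventually.of_forall fun x => Set.indicator_le_self _ _ _) ?_
      (Eventually.of_forall fun x => ?_)
    · exact (hf.1.enorm.pow_const 2).indicator (hm n)
    · rw [← eLpNorm_two_sq]
      exact ENNReal.pow_ne_top hf.2.ne
    · refine tendsto_const_nhds.congr' ?_
      obtain ⟨N, hN⟩ := exists_nat_gt ‖x - p‖
      filter_upwards [eventually_ge_atTop N] with n hn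
      rw [Set.indicator_of_notMem]
      simp only [Set.mem_ofPred_eq, not_le]
      exact hN.trans_le (by exact_mod_cast hn)
  rw [lintegral_zero] at h1
  have h2 := h1.ennrpow_const (1 / 2)
  rw [ENNReal.zero_rpow_of_pos (by norm_num)] at h2
  refine h2.congr fun n => ?_
  rw [lintegral_indicator (hm n), ← eLpNorm_two_sq, ← ENNReal.rpow_natCast, ← ENNReal.rpow_mul]
  norm_num

/-- The constant in the energy estimate is independent of ρ, and the energy outside large disks
tends to 0. So the energy of every fixed disk is 0, and the Hardy inequality then forces u = 0. -/
theorem MagApprox.ae_eq_zero (h : MagApprox p u M) (hu : AEStronglyMeasurable u volume)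
    (hM : ∀ j, MemLp (M j) 2 volume)
    (hweak : ∀ v, IsTest p v → ∫ x, ∑ j, M j x * conj (magD p v j x) = 0) :
    u =ᵐ[volume] 0 := by
  have hMm := fun j => (hM j).1
  obtain ⟨K, hK, hle⟩ := MagApprox.exists_energy_le hu hMm h hweak
  have hlim : Tendsto (fun n : ℕ => K * (∑ j, eLpNorm (M j) 2
      (volume.restrict {x | (n : ℝ) ≤ ‖x - p‖})) ^ 2) atTop (𝓝 0) := by
    have h1 := tendsto_finsetSum (Finset.univ : Finset (Fin 2)) fun j _ =>
      tendsto_eLpNorm_outside (p := p) (hM j)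
    rw [Finset.sum_const_zero] at h1
    have h2 := ENNReal.Tendsto.const_mul (a := K) (ENNReal.Tendsto.pow (n := 2) h1) (Or.inr hK)
    simpa using h2
  have hzero : ∀ m : ℕ, ∀ j, eLpNorm (M j) 2 (volume.restrict (Metric.ball p m)) = 0 :=
    fun m j => by
      have h1 : eLpNorm (M j) 2 (volume.restrict (Metric.ball p m)) ^ 2 ≤ 0 := by
        refine ge_of_tendsto hlim ?_
        filter_upwards [eventually_ge_atTop (m + 1)] with n hn
        have hn0 : (0 : ℝ) < n := by exact_mod_cast (by omega : 0 < n)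
        refine le_trans ?_ (hle n hn0)
        rw [eLpNorm_two_sq]
        calc _ ≤ ∫⁻ x in Metric.ball p n, ‖M j x‖ₑ ^ 2 :=
              lintegral_mono' (Measure.restrict_mono (Metric.ball_subset_ball
                (by exact_mod_cast (by omega : m ≤ n))) le_rfl) le_rfl
          _ ≤ _ := lintegral_mono fun x =>
              Finset.single_le_sum (f := fun j => ‖M j x‖ₑ ^ 2) (fun _ _ => zero_le)
                (Finset.mem_univ j)
      exact pow_eq_zero_iff two_ne_zero |>.1 (le_antisymm h1 zero_le)
  have hball : ∀ m : ℕ, u =ᵐ[volume.restrict (Metric.ball p m)] 0 := fun m => by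
    have hset : {x : ℂ | ‖x - p‖ ∈ Set.Iio (m : ℝ)} = Metric.ball p m := by
      ext x; simp [dist_eq_norm]
    have h1 := h.hardy hu hMm (ρ := m + 1) (by positivity) (J := Set.Iio (m : ℝ))
      measurableSet_Iio (fun x hx => lt_trans (Set.mem_Iio.1 hx) (lt_add_one (m : ℝ)))
    rw [hset] at h1
    simp only [hzero, Finset.sum_const_zero, mul_zero] at h1
    have h2 := (eLpNorm_eq_zero_iff (aestronglyMeasurable_div_norm hu.restrict) two_ne_zero).1
      (le_antisymm h1 zero_le)
    filter_upwards [h2, ae_restrict_of_ae (s := Metric.ball p m)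
      (by simp [ae_iff] : ∀ᵐ x : ℂ, x ≠ p)] with x hx hxp
    have hn : (‖x - p‖ : ℂ) ≠ 0 := by simpa [sub_eq_zero] using hxp
    simpa [div_eq_zero_iff, sub_eq_zero, hxp] using hx
  have hU : (⋃ m : ℕ, Metric.ball p (m : ℝ)) = Set.univ := by
    refine Set.eq_univ_of_forall fun x => Set.mem_iUnion.2 ?_
    obtain ⟨n, hn⟩ := exists_nat_gt ‖x - p‖
    exact ⟨n, by simpa [dist_eq_norm] using hn⟩
  rw [Filter.EventuallyEq, ← Measure.restrict_univ (μ := volume), ← hU, ae_restrict_iUnion_iff]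
  exact hball

end

/-! ### Uniqueness of the limit profile -/

lemma measurable_angle (a : ℝ) : Measurable (angle a) := by
  unfold angle
  simp_rw [toIcoMod_eq_add_fract_mul]
  fun_prop

lemma measurable_asymptote (k : ℕ) (p : ℂ) : Measurable (asymptote k p) := by
  have h1 : Measurable (thetaPole p) :=
    (measurable_angle _).comp (measurable_id.sub_const p)
  have h2 : Measurable (thetaOrigin p) := measurable_angle _
  have h3 : Measurable thetaZero := measurable_angle _
  unfold asymptote psi
  fun_prop

/-- The asymptote cancels in the difference, whose energy is finite outside the disk of radius 2 by
the condition at infinity and inside it by membership in H^{1,p}_loc. `MagApprox.ae_eq_zero` then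
applies. -/
lemma IsLimitProfile.ae_eq {k : ℕ} {p : ℂ} {Ψ₁ Ψ₂ : ℂ → ℂ} (h₁ : IsLimitProfile k p Ψ₁)
    (h₂ : IsLimitProfile k p Ψ₂) : Ψ₁ =ᵐ[volume] Ψ₂ := by
  obtain ⟨G₁, hm₁, hw₁, he₁⟩ := h₁
  obtain ⟨G₂, hm₂, hw₂, he₂⟩ := h₂
  have ha := hm₁.magApprox.sub hm₂.magApprox hm₁.aestronglyMeasurable hm₂.aestronglyMeasurable
    hm₁.aestronglyMeasurable_magGrad hm₂.aestronglyMeasurable_magGrad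
  have hu := hm₁.aestronglyMeasurable.sub hm₂.aestronglyMeasurable
  have hMm : ∀ j, AEStronglyMeasurable (fun x => magGrad p Ψ₁ G₁ j x - magGrad p Ψ₂ G₂ j x)
      volume := fun j =>
    (hm₁.aestronglyMeasurable_magGrad j).sub (hm₂.aestronglyMeasurable_magGrad j)
  have houter : ∀ (Ψ : ℂ → ℂ) (G : Fin 2 → ℂ → ℂ), MemH1Loc p Ψ G →
      (∀ r : ℝ, 1 < r → ∫⁻ x in (Metric.ball (0 : ℂ) r)ᶜ,
        ∑ j, ‖magGrad p (fun y => Ψ y - asymptote k p y)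
          (fun i y => G i y - partialDeriv i (asymptote k p) y) j x‖ₑ ^ 2 < ⊤) →
      ∀ j, MemLp (magGrad p (fun y => Ψ y - asymptote k p y)
          (fun i y => G i y - partialDeriv i (asymptote k p) y) j) 2
          (volume.restrict (Metric.ball (0 : ℂ) 2)ᶜ) := fun Ψ G hm he j => by
    refine ⟨?_, ?_⟩
    · have e : magGrad p (fun y => Ψ y - asymptote k p y)
          (fun i y => G i y - partialDeriv i (asymptote k p) y) j =
          fun x => magGrad p Ψ G j x - magD p (asymptote k p) j x := by
        funext x
        exact magGrad_sub p Ψ _ G (fun i => partialDeriv i (asymptote k p)) j x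
      rw [e]
      exact ((hm.aestronglyMeasurable_magGrad j).sub
        (measurable_magGrad p (measurable_asymptote k p) j).aestronglyMeasurable).restrict
    · have h1 := he 2 one_lt_two
      have h2 := lt_of_le_of_lt (lintegral_mono fun x =>
        Finset.single_le_sum (f := fun j => ‖magGrad p (fun y => Ψ y - asymptote k p y)
          (fun i y => G i y - partialDeriv i (asymptote k p) y) j x‖ₑ ^ 2) (fun _ _ => zero_le)
                (Finset.mem_univ j)) h1
      rw [← eLpNorm_two_sq] at h2
      by_contra hcon
      rw [not_lt_top_iff.1 hcon] at h2
      simp at h2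
  have hM : ∀ j, MemLp (fun x => magGrad p Ψ₁ G₁ j x - magGrad p Ψ₂ G₂ j x) 2 volume :=
    fun j => by
      have hin := ha.memLp hMm (ρ := 2 + ‖p‖ + 1) (by positivity) j
      have hin' : MemLp (fun x => magGrad p Ψ₁ G₁ j x - magGrad p Ψ₂ G₂ j x) 2
          (volume.restrict (Metric.ball (0 : ℂ) 2)) :=
        hin.mono_measure (Measure.restrict_mono (Metric.ball_subset_ball' (by simp)) le_rfl)
      have hout : MemLp (fun x => magGrad p Ψ₁ G₁ j x - magGrad p Ψ₂ G₂ j x) 2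
          (volume.restrict (Metric.ball (0 : ℂ) 2)ᶜ) := by
        refine ((houter Ψ₁ G₁ hm₁ he₁ j).sub (houter Ψ₂ G₂ hm₂ he₂ j)).congr_norm
          (hMm j).restrict (Eventually.of_forall fun x => ?_)
        simp only [Pi.sub_apply, magGrad]
        congr 1
        ring
      refine ⟨hMm j, ?_⟩
      have h3 : eLpNorm (fun x => magGrad p Ψ₁ G₁ j x - magGrad p Ψ₂ G₂ j x) 2 volume ^ 2 < ⊤ := by
        rw [eLpNorm_two_sq, ← lintegral_add_compl _ (measurableSet_ball (x := (0 : ℂ)) (ε := 2)),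
          ← eLpNorm_two_sq, ← eLpNorm_two_sq]
        exact ENNReal.add_lt_top.2 ⟨ENNReal.pow_lt_top hin'.2, ENNReal.pow_lt_top hout.2⟩
      by_contra hcon
      rw [not_lt_top_iff.1 hcon] at h3
      simp at h3
  have hw : ∀ v, IsTest p v →
      ∫ x, ∑ j, (magGrad p Ψ₁ G₁ j x - magGrad p Ψ₂ G₂ j x) * conj (magD p v j x) = 0 :=
    fun v hv => by
      have hi : ∀ (Ψ : ℂ → ℂ) (G : Fin 2 → ℂ → ℂ), MemH1Loc p Ψ G →
          Integrable (fun x => ∑ j, magGrad p Ψ G j x * conj (magD p v j x)) := fun Ψ G hm => by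
        refine integrable_finsetSum _ fun j _ => ?_
        obtain ⟨R, hR⟩ := hv.2.1.isCompact.isBounded.subset_ball p
        have hL := hm.magApprox.memLp hm.aestronglyMeasurable_magGrad (ρ := max R 1)
          (by positivity) j
        have h1 : IntegrableOn (fun x => magGrad p Ψ G j x * conj (magD p v j x))
            (Metric.ball p (max R 1)) := integrable_mul_conj hL (hv.memLp_magD j _)
        refine (integrableOn_iff_integrable_of_support_subset fun x hx => ?_).1 h1
        by_contra hxb
        have hx2 : x ∉ tsupport v := fun hxs =>
          hxb (Metric.ball_subset_ball (le_max_left _ _) (hR hxs))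
        apply hx
        simp [magD, magGrad, partialDeriv, fderiv_of_notMem_tsupport ℝ hx2,
          image_eq_zero_of_notMem_tsupport hx2]
      have h1 := hw₁ v hv.1 hv.2.1 hv.2.2
      have h2 := hw₂ v hv.1 hv.2.1 hv.2.2
      have h3 := integral_sub (hi Ψ₁ G₁ hm₁) (hi Ψ₂ G₂ hm₂)
      simp only [magD] at h3
      rw [h1, h2, sub_zero] at h3
      rw [← h3]
      congr 1
      funext x
      rw [← Finset.sum_sub_distrib]
      exact Finset.sum_congr rfl fun j _ => by ring
  have := MagApprox.ae_eq_zero ha hu hM hw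
  filter_upwards [this] with x hx
  exact sub_eq_zero.1 hx

/-! ### The Fourier coefficient of the limit profile -/

lemma polarPt_one (t : ℝ) : polarPt 1 t = exp (t * I) := by
  apply Complex.ext
  · simp [polarPt, exp_ofReal_mul_I_re]
  · simp [polarPt, exp_ofReal_mul_I_im]

lemma norm_polarPt_one (t : ℝ) : ‖polarPt 1 t‖ = 1 := by
  rw [polarPt_one, norm_exp_ofReal_mul_I]

lemma limitProfile_spec (n : ℕ) {p : ℂ} (hp : ‖p‖ = 1) :
    IsLimitProfile (2 * n + 1) p (limitProfile (2 * n + 1) p) ∧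
      ContinuousOn (limitProfile (2 * n + 1) p) {p}ᶜ :=
  Classical.epsilon_spec (p := fun Ψ : ℂ → ℂ => IsLimitProfile (2 * n + 1) p Ψ ∧
    ContinuousOn Ψ {p}ᶜ) ⟨_, isLimitProfile_twistedIm n hp,
      continuousOn_twistedIm p (differentiable_profileFun n p)⟩

/-- Two functions that agree almost everywhere and are continuous off p agree at every point off p,
so the choice made in `limitProfile` does not matter there. -/
lemma limitProfile_eq (n : ℕ) {p x : ℂ} (hp : ‖p‖ = 1) (hx : x ≠ p) :
    limitProfile (2 * n + 1) p x = twistedIm p (profileFun n p) x := by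
  obtain ⟨h, hc⟩ := limitProfile_spec n hp
  exact Measure.eqOn_open_of_ae_eq (U := {p}ᶜ)
    (ae_restrict_of_ae (h.ae_eq (isLimitProfile_twistedIm n hp))) isOpen_compl_singleton hc
    (continuousOn_twistedIm p (differentiable_profileFun n p)) hx

lemma psiTwo_eq (k : ℕ) (t : ℝ) : psiTwo k t = spinSin k t / ((Real.sqrt Real.pi : ℝ) : ℂ) := by
  rw [psiTwo, spinSin, show I * ((t / 2 : ℝ) : ℂ) = I / 2 * t by push_cast; ring]
  ring

/-- This allows the integration over the circle to start at the angle of p, where θ_p and θ_0^p are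
explicit. -/
lemma periodic_xiIntegrand {k : ℕ} (hk : Odd k) (p : ℂ) (r : ℝ) :
    Function.Periodic (xiIntegrand k p r) (2 * Real.pi) := fun t => by
  have h1 : polarPt r (t + 2 * Real.pi) = polarPt r t := by simp [polarPt]
  have h2 : psiTwo k (t + 2 * Real.pi) = psiTwo k t := by
    have := spinSin_add_int_mul hk t 1
    rw [Int.cast_one, one_mul] at this
    rw [psiTwo_eq, psiTwo_eq, this]
  simp only [xiIntegrand, h1, h2]

/-! ### The explicit integrand and its symmetries -/

/-- The integrand of `√π ξ_p(1)` for `p = e^{iβ}` at `e^{i(β+τ)}`, where `c = (n + 1/2) β`. -/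
noncomputable def trace (n : ℕ) (c τ : ℝ) : ℝ :=
  (((Real.sqrt (2 * Real.sin (τ / 2)) : ℝ) : ℂ) * (exp (((c + τ / 4 + Real.pi / 4 : ℝ) : ℂ) * I) *
    Polynomial.aeval (exp (τ * I) - 1) (profilePoly n))).im *
      Real.sin (c + (2 * n + 1) / 2 * τ)

lemma continuous_trace (n : ℕ) (c : ℝ) : Continuous (trace n c) := by
  have h : Continuous fun τ : ℝ => Polynomial.aeval (exp (τ * I) - 1) (profilePoly n) :=
    (profilePoly n).continuous_aeval.comp (by fun_prop)
  unfold trace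
  fun_prop

/-- The exponential and the sine are both multiplied by (-1)^j. -/
lemma trace_add_int_mul_pi (n : ℕ) (c τ : ℝ) (j : ℤ) :
    trace n (c + j * Real.pi) τ = trace n c τ := by
  have h1 : exp (((c + j * Real.pi + τ / 4 + Real.pi / 4 : ℝ) : ℂ) * I) =
      (((-1) ^ j : ℝ) : ℂ) * exp (((c + τ / 4 + Real.pi / 4 : ℝ) : ℂ) * I) := by
    push_cast
    rw [← exp_pi_mul_I, ← exp_int_mul, ← exp_add]
    congr 1; ring
  have h2 : ((-1 : ℝ)) ^ j * (-1) ^ j = 1 := by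
    rw [← mul_zpow]; simp
  rw [trace, trace, h1, show c + j * Real.pi + (2 * n + 1) / 2 * τ =
    c + (2 * n + 1) / 2 * τ + j * Real.pi by ring, Real.sin_add_int_mul_pi, im_ofReal_mul,
    im_ofReal_mul, mul_assoc (((-1 : ℝ) ^ j : ℝ) : ℂ), im_ofReal_mul]
  linear_combination (Real.sqrt (2 * Real.sin (τ / 2)) * (exp (((c + τ / 4 + Real.pi / 4 : ℝ) : ℂ) *
    I) * Polynomial.aeval (exp (τ * I) - 1) (profilePoly n)).im *
      Real.sin (c + (2 * n + 1) / 2 * τ)) * h2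

/-- The substitution conjugates e^{iτ}, hence also the value of the polynomial, whose coefficients
are real. The exponential becomes minus its conjugate, so the imaginary part is unchanged, as are
both sines. -/
lemma trace_neg_two_pi_sub (n : ℕ) (c τ : ℝ) :
    trace n (-c) (2 * Real.pi - τ) = trace n c τ := by
  have h1 : exp (((2 * Real.pi - τ : ℝ) : ℂ) * I) = conj (exp (τ * I)) := by
    rw [← exp_conj, map_mul, conj_I, conj_ofReal,
      show ((2 * Real.pi - τ : ℝ) : ℂ) * I = τ * -I + 2 * Real.pi * I by push_cast; ring, exp_add,
      exp_two_pi_mul_I, mul_one]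
  have h2 : exp (((-c + (2 * Real.pi - τ) / 4 + Real.pi / 4 : ℝ) : ℂ) * I) =
      -conj (exp (((c + τ / 4 + Real.pi / 4 : ℝ) : ℂ) * I)) := by
    rw [← exp_conj, map_mul, conj_I, conj_ofReal,
      show ((-c + (2 * Real.pi - τ) / 4 + Real.pi / 4 : ℝ) : ℂ) * I =
        ((c + τ / 4 + Real.pi / 4 : ℝ) : ℂ) * -I + Real.pi * I by push_cast; ring, exp_add,
      exp_pi_mul_I]
    ring
  have h3 : Real.sin ((2 * Real.pi - τ) / 2) = Real.sin (τ / 2) := by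
    rw [show (2 * Real.pi - τ) / 2 = Real.pi - τ / 2 by ring, Real.sin_pi_sub]
  have h4 : Real.sin (-c + (2 * n + 1) / 2 * (2 * Real.pi - τ)) =
      Real.sin (c + (2 * n + 1) / 2 * τ) := by
    rw [show -c + (2 * n + 1) / 2 * (2 * Real.pi - τ) =
      (Real.pi - (c + (2 * n + 1) / 2 * τ)) + n * (2 * Real.pi) by ring,
      Real.sin_add_nat_mul_two_pi, Real.sin_pi_sub]
  have h5 : Polynomial.aeval (conj (exp (τ * I)) - 1) (profilePoly n) =
      conj (Polynomial.aeval (exp (τ * I) - 1) (profilePoly n)) := by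
    rw [← Polynomial.aeval_conj, map_sub, map_one]
  rw [trace, trace, h1, h2, h3, h4, h5, im_ofReal_mul, im_ofReal_mul, neg_mul, ← map_mul, neg_im,
    conj_im, neg_neg]

/-- This gives the modulus and the angle of x - p for x on the unit circle. -/
lemma exp_add_sub_exp (β τ : ℝ) : exp (((β + τ : ℝ) : ℂ) * I) - exp (β * I) =
    ((2 * Real.sin (τ / 2) : ℝ) : ℂ) * exp (((β + τ / 2 + Real.pi / 2 : ℝ) : ℂ) * I) := by
  have h1 : exp (((β + τ : ℝ) : ℂ) * I) = exp (((β + τ / 2 : ℝ) : ℂ) * I) * exp ((τ / 2 : ℝ) * I) := by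
    rw [← exp_add]; congr 1; push_cast; ring
  have h2 : exp (β * I) = exp (((β + τ / 2 : ℝ) : ℂ) * I) * exp (-(τ / 2 : ℝ) * I) := by
    rw [← exp_add]; congr 1; push_cast; ring
  have h3 : exp (((β + τ / 2 + Real.pi / 2 : ℝ) : ℂ) * I) = exp (((β + τ / 2 : ℝ) : ℂ) * I) * I := by
    rw [show ((β + τ / 2 + Real.pi / 2 : ℝ) : ℂ) * I = ((β + τ / 2 : ℝ) : ℂ) * I +
      Real.pi / 2 * I by push_cast; ring, exp_add, exp_pi_div_two_mul_I]
  rw [h1, h2, h3, exp_mul_I ((τ / 2 : ℝ) : ℂ), exp_mul_I (-((τ / 2 : ℝ) : ℂ)), cos_neg, sin_neg]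
  push_cast
  ring

/-- The phase e^{-iθ_p/2} removes that of the profile, and e^{iθ_0^p/2} removes that of conj ψ_2.
What is left is the real number Im(w g) sin(kθ_0^p/2)/√π. -/
lemma xiIntegrand_eq (n : ℕ) {p : ℂ} (hp : ‖p‖ = 1) {τ : ℝ} (hτ : τ ∈ Set.Ioo 0 (2 * Real.pi)) :
    xiIntegrand (2 * n + 1) p 1 (angle 0 p + τ) =
      ((trace n ((2 * n + 1) / 2 * angle 0 p) τ / Real.sqrt Real.pi : ℝ) : ℂ) := by
  obtain ⟨h0, h2⟩ := hτ
  set β := angle 0 p with hβ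
  have hpβ : exp (β * I) = p := exp_angle_of_norm_one hp
  set x := polarPt 1 (β + τ) with hx
  have hxe : x = exp (((β + τ : ℝ) : ℂ) * I) := polarPt_one _
  have hs : 0 < 2 * Real.sin (τ / 2) := by
    have := Real.sin_pos_of_pos_of_lt_pi (x := τ / 2) (by linarith) (by linarith)
    linarith
  have hxp : x - p = ((2 * Real.sin (τ / 2) : ℝ) : ℂ) *
      exp (((β + τ / 2 + Real.pi / 2 : ℝ) : ℂ) * I) := by
    rw [← exp_add_sub_exp, hxe, hpβ]
  have hne : x ≠ p := by
    rw [← sub_ne_zero, hxp]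
    exact mul_ne_zero (ofReal_ne_zero.2 hs.ne') (exp_ne_zero _)
  have hO : thetaOrigin p x = β + τ :=
    angle_eq one_pos (by rw [hxe, ofReal_one, one_mul]) ⟨by linarith, by linarith⟩
  -- For 0 < τ < 2π this angle lies between β + π/2 and β + 3π/2, inside the range of θ_p.
  have hP : angle β (x - p) = β + τ / 2 + Real.pi / 2 :=
    angle_eq hs hxp ⟨by linarith [Real.pi_pos], by linarith⟩
  have hcx : conj p * x = exp (τ * I) := by
    rw [hxe, ofReal_add, add_mul, exp_add, hpβ, ← mul_assoc, conj_mul_self_of_norm_one hp, one_mul]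
  have hb : sqrtBranch β (x - p) * profileFun n p x =
      ((Real.sqrt (2 * Real.sin (τ / 2)) : ℝ) : ℂ) *
        (exp ((((2 * n + 1) / 2 * β + τ / 4 + Real.pi / 4 : ℝ) : ℂ) * I) *
          Polynomial.aeval (exp (τ * I) - 1) (profilePoly n)) := by
    have hnorm : ‖x - p‖ = 2 * Real.sin (τ / 2) := by
      rw [hxp, norm_mul, norm_exp_ofReal_mul_I, norm_real, Real.norm_of_nonneg hs.le, mul_one]
    have he : exp (I / 2 * ((β + τ / 2 + Real.pi / 2 : ℝ) : ℂ)) * p ^ n =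
        exp ((((2 * n + 1) / 2 * β + τ / 4 + Real.pi / 4 : ℝ) : ℂ) * I) := by
      rw [← hpβ, ← exp_nat_mul, ← exp_add]
      congr 1; push_cast; ring
    rw [sqrtBranch, hP, hnorm, ← Real.sqrt_eq_rpow, profileFun, hcx, ← he]
    ring
  have hc : exp (I / 2 * ((β + τ : ℝ) : ℂ)) * conj (psiTwo (2 * n + 1) (β + τ)) =
      ((Real.sin ((2 * n + 1) / 2 * β + (2 * n + 1) / 2 * τ) / Real.sqrt Real.pi : ℝ) : ℂ) := by
    have h1 : exp (I / 2 * ((β + τ : ℝ) : ℂ)) * conj (exp (I / 2 * ((β + τ : ℝ) : ℂ))) = 1 := by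
      rw [mul_conj, normSq_eq_norm_sq,
        show I / 2 * ((β + τ : ℝ) : ℂ) = (((β + τ) / 2 : ℝ) : ℂ) * I by push_cast; ring,
        norm_exp_ofReal_mul_I]
      simp
    rw [psiTwo_eq, spinSin, map_div₀, map_mul, conj_ofReal, conj_ofReal, ofReal_div,
      ← mul_div_assoc, ← mul_assoc, h1, one_mul]
    congr 4
    push_cast; ring
  rw [xiIntegrand, ← hx, hO, limitProfile_eq n hp hne, twistedIm_eq_exp_mul_im β hne, hb, mul_assoc,
    hc, show thetaPole p x = angle β (x - p) from rfl, ← mul_assoc, ← exp_add, trace, neg_mul,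
    neg_add_cancel, exp_zero, one_mul]
  push_cast
  ring

lemma intervalIntegrable_and_xi_eq (n : ℕ) {p : ℂ} (hp : ‖p‖ = 1) :
    IntervalIntegrable (xiIntegrand (2 * n + 1) p 1) volume 0 (2 * Real.pi) ∧
      xi (2 * n + 1) p 1 = ((∫ τ in (0 : ℝ)..(2 * Real.pi),
        trace n ((2 * n + 1) / 2 * angle 0 p) τ / Real.sqrt Real.pi : ℝ) : ℂ) := by
  have hper := periodic_xiIntegrand (k := 2 * n + 1) ⟨n, rfl⟩ p 1
  set β := angle 0 p with hβ
  set J : ℝ → ℂ := fun τ =>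
    ((trace n ((2 * n + 1) / 2 * β) τ / Real.sqrt Real.pi : ℝ) : ℂ) with hJ
  have hJc : Continuous J :=
    continuous_ofReal.comp ((continuous_trace n _).div_const _)
  have hper' : Function.Periodic (fun τ => xiIntegrand (2 * n + 1) p 1 (β + τ)) (2 * Real.pi) :=
    fun τ => by
      change xiIntegrand (2 * n + 1) p 1 (β + (τ + 2 * Real.pi)) = _
      rw [← add_assoc, hper]
  -- At τ = 2π the point on the circle is the pole itself, so this one value is discarded.
  have hae : ∀ᵐ τ, τ ∈ Set.uIoc 0 (2 * Real.pi) →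
      xiIntegrand (2 * n + 1) p 1 (β + τ) = J τ := by
    filter_upwards [(by simp [ae_iff] : ∀ᵐ τ : ℝ, τ ≠ 2 * Real.pi)] with τ hne hτ
    rw [Set.uIoc_of_le Real.two_pi_pos.le] at hτ
    exact xiIntegrand_eq n hp ⟨hτ.1, hτ.2.lt_of_ne hne⟩
  have hi : IntervalIntegrable (fun τ => xiIntegrand (2 * n + 1) p 1 (β + τ)) volume 0
      (2 * Real.pi) := by
    refine (hJc.intervalIntegrable 0 (2 * Real.pi)).congr_ae ?_
    refine (ae_restrict_iff' measurableSet_uIoc).2 ?_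
    filter_upwards [hae] with τ h hτ using (h hτ).symm
  refine ⟨?_, ?_⟩
  · have h1 := hper'.intervalIntegrable₀ Real.two_pi_pos.ne' hi (-β) (2 * Real.pi - β)
    have h2 := h1.comp_sub_right β
    simpa using h2
  · rw [xi, ← intervalIntegral.integral_ofReal, ← intervalIntegral.integral_congr_ae hae,
      intervalIntegral.integral_comp_add_left, add_zero]
    have := hper.intervalIntegral_add_eq 0 β
    rwa [zero_add] at this

/-- The angle of e^{iα} in [0, 2π) differs from α by some 2πm, which shifts c by the multiple (2n +
1)m of π. Hence α itself may be used. -/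
lemma f_eq (n : ℕ) (α : ℝ) : f (2 * n + 1) α = ((∫ τ in (0 : ℝ)..(2 * Real.pi),
    trace n ((2 * n + 1) / 2 * α) τ / Real.sqrt Real.pi : ℝ) : ℂ) - ((Real.sqrt Real.pi : ℝ) : ℂ) := by
  have hp := norm_polarPt_one α
  obtain ⟨m, hm⟩ := exists_int_of_exp_eq (s := angle 0 (polarPt 1 α)) (t := α)
    (by rw [exp_angle_of_norm_one hp, polarPt_one])
  have h : ∀ τ, trace n ((2 * n + 1) / 2 * angle 0 (polarPt 1 α)) τ =
      trace n ((2 * n + 1) / 2 * α) τ := fun τ => by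
    rw [hm, ← trace_add_int_mul_pi n ((2 * n + 1) / 2 * α) τ ((2 * n + 1) * m)]
    congr 1
    push_cast; ring
  rw [f, (intervalIntegrable_and_xi_eq n hp).2]
  simp_rw [h]

lemma f_sub_two_pi_div (n : ℕ) (α : ℝ) :
    f (2 * n + 1) α = f (2 * n + 1) (α - 2 * Real.pi / (2 * n + 1 : ℕ)) := by
  have h : ∀ τ, trace n ((2 * n + 1) / 2 * (α - 2 * Real.pi / (2 * n + 1 : ℕ))) τ =
      trace n ((2 * n + 1) / 2 * α) τ := fun τ => by
    -- Here c = kα/2 is shifted by (k/2)(-2π/k) = -π.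
    rw [← trace_add_int_mul_pi n ((2 * n + 1) / 2 * α) τ (-1)]
    congr 1
    push_cast
    field_simp
    ring
  rw [f_eq, f_eq]
  simp_rw [h]

lemma f_two_pi_sub (n : ℕ) (α : ℝ) :
    f (2 * n + 1) α = f (2 * n + 1) (2 * Real.pi - α) := by
  have h : ∀ τ, trace n ((2 * n + 1) / 2 * (2 * Real.pi - α)) (2 * Real.pi - τ) =
      trace n ((2 * n + 1) / 2 * α) τ := fun τ => by
    -- The new parameter is (k/2)(2π - α) = kπ - c, which is -c up to 2n + 1 shifts by π. The change
    -- of variable τ ↦ 2π - τ in the integral completes the reflection.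
    rw [← trace_neg_two_pi_sub n _ τ, ← trace_add_int_mul_pi n (-((2 * n + 1) / 2 * α)) _ (2 * n + 1)]
    congr 1
    push_cast; ring
  have h2 := intervalIntegral.integral_comp_sub_left (a := 0) (b := 2 * Real.pi) (fun τ =>
    trace n ((2 * n + 1) / 2 * (2 * Real.pi - α)) τ / Real.sqrt Real.pi) (2 * Real.pi)
  simp_rw [h, sub_self, sub_zero] at h2
  rw [f_eq, f_eq, h2]

end AharonovBohm

theorem corollary4p3 (k : ℕ) (hk : Odd k) :
    -- the limit profiles exist, are unique, and the integrals defining `f` converge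
    (∀ α : ℝ,
      (∃ Ψ : ℂ → ℂ, AharonovBohm.IsLimitProfile k (AharonovBohm.polarPt 1 α) Ψ ∧
        ContinuousOn Ψ {AharonovBohm.polarPt 1 α}ᶜ) ∧
      (∀ Ψ₁ Ψ₂ : ℂ → ℂ, AharonovBohm.IsLimitProfile k (AharonovBohm.polarPt 1 α) Ψ₁ →
        AharonovBohm.IsLimitProfile k (AharonovBohm.polarPt 1 α) Ψ₂ →
          Ψ₁ =ᵐ[MeasureTheory.volume] Ψ₂) ∧
      IntervalIntegrable (AharonovBohm.xiIntegrand k (AharonovBohm.polarPt 1 α) 1)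
        MeasureTheory.volume 0 (2 * Real.pi)) ∧
    -- the invariance of `f`
    ∀ α : ℝ,
      AharonovBohm.f k α = AharonovBohm.f k (α - 2 * Real.pi / k) ∧
      AharonovBohm.f k α = AharonovBohm.f k (2 * Real.pi - α) := by
  obtain ⟨n, rfl⟩ := hk
  refine ⟨fun α => ?_, fun α => ⟨AharonovBohm.f_sub_two_pi_div n α,
    AharonovBohm.f_two_pi_sub n α⟩⟩
  have hp := AharonovBohm.norm_polarPt_one α
  exact ⟨⟨_, AharonovBohm.limitProfile_spec n hp⟩, fun Ψ₁ Ψ₂ h₁ h₂ => h₁.ae_eq h₂,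
    (AharonovBohm.intervalIntegrable_and_xi_eq n hp).1⟩
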